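/- An instance of $\mathrm{DDT}_{\mathsf E}$ (drone delivery with movement restrictions, minimum delivery time, edge handovers) consists of a connected graph $G=(V,E)$ with $n$ nodes and edge lengths $\ell:E\to\mathbb{R}_{\ge 0}$; $k\ge 1$ agents, where agent $a$ has an initial position $p_a\in V$, a velocity $v_a>0$, and a connected subgraph $G_a=(V_a,E_a)$ of $G$ with $p_a\in V_a$ to which its movements are restricted, such that the subgraphs $G_a$ together cover $G$; and a start node $s$ and a destination node $y$ of a package. A schedule is a list of trips $1,\dots,h$. In trip $i$, an agent $a_i$ leaves, at a time $t_i\ge 0$, its current location (its initial position, or the location at which it last dropped off the package, in which case $t_i$ is not earlier than that drop-off), moves within $G_{a_i}$ along a walk $O_i$ to the current location $u_{i-1}$ of the package, and then carries the package within $G_{a_i}$ along a walk $U_i$ to a location $u_i$. Locations may be nodes or interior points of edges, $u_0=s$, and $u_h=y$. With $T(u_0)=0$ and $$T(u_i)=\max\Bigl\{T(u_{i-1}),\ t_i+\frac{\ell(O_i)}{v_{a_i}}\Bigr\}+\frac{\ell(U_i)}{v_{a_i}},$$ the delivery time of the schedule is $T(u_h)$. Theorem. There is a polynomial-time $\min\{2n-1,\,2k-1\}$-approximation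 algorithm for $\mathrm{DDT}_{\mathsf E}$: an algorithm that, for every instance, computes a feasible schedule whose delivery time is at most $\min\{2n-1,2k-1\}$ times the delivery time of every feasible schedule. Here polynomial time means that the number of steps, with unit-cost arithmetic operations and comparisons on real numbers, is bounded by a polynomial in $n+k$, and that on instances with rational lengths and velocities the total bit cost is also bounded by a polynomial in the bit size of the instance. -/

import Mathlib

namespace DroneDelivery

/-! ### Model of computation

A program is a finite term of a first-order functional language over Booleans, natural numbers,
real numbers, pairs and lists.  Every constructor is a constant-time operation of a real RAM
(unit-cost `+ - * / <` on real numbers, no rounding; successor and comparison of natural numbers;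
building and taking apart pairs and list cells by pointers), except for the control structures
`comp`, `pair`, `ite`, `listCase` and `fold`, which are charged for the parts that they execute.
The only numerical constants are `0` and `1`, and loops only run through lists that are part of the
data.  So a program with `t` steps runs in time `O(t)` on a real RAM. -/

/-- The data types of the programming language. -/
inductive Ty : Type
  | bool : Ty
  | nat : Ty
  | real : Ty
  | prod : Ty → Ty → Ty
  | list : Ty → Ty

/-- The values of a data type. -/
@[reducible] def Ty.Val : Ty → Type
  | .bool => Bool
  | .nat => ℕ
  | .real => ℝ
  | .prod α β => α.Val × β.Val
  | .list α => List α.Val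

/-- `Prog α β`: programs with an input of type `α` and an output of type `β`. -/
inductive Prog : Ty → Ty → Type
  | id {α : Ty} : Prog α α
  | comp {α β γ : Ty} (g : Prog β γ) (f : Prog α β) : Prog α γ
  | pair {γ α β : Ty} (f : Prog γ α) (g : Prog γ β) : Prog γ (.prod α β)
  | fst {α β : Ty} : Prog (.prod α β) α
  | snd {α β : Ty} : Prog (.prod α β) β
  | tt {γ : Ty} : Prog γ .bool
  | ff {γ : Ty} : Prog γ .bool
  | ite {γ α : Ty} (c : Prog γ .bool) (f g : Prog γ α) : Prog γ α
  | zero {γ : Ty} : Prog γ .nat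
  | succ : Prog .nat .nat
  | natEq : Prog (.prod .nat .nat) .bool
  | natLt : Prog (.prod .nat .nat) .bool
  | nil {γ α : Ty} : Prog γ (.list α)
  | cons {α : Ty} : Prog (.prod α (.list α)) (.list α)
  | listCase {γ α β : Ty} (f : Prog γ β) (g : Prog (.prod γ (.prod α (.list α))) β) :
      Prog (.prod γ (.list α)) β
  | fold {γ α σ : Ty} (f : Prog (.prod γ (.prod α σ)) σ) :
      Prog (.prod γ (.prod (.list α) σ)) σ
  | realZero {γ : Ty} : Prog γ .real
  | realOne {γ : Ty} : Prog γ .real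
  | realAdd : Prog (.prod .real .real) .real
  | realSub : Prog (.prod .real .real) .real
  | realMul : Prog (.prod .real .real) .real
  | realDiv : Prog (.prod .real .real) .real
  | realLt : Prog (.prod .real .real) .bool

namespace Prog

/-- The output of a program.  `fold f` on `(c, l, s)` runs the loop
`for a in l do s := f (c, a, s)` and returns the last `s`. -/
noncomputable def eval : {α β : Ty} → Prog α β → α.Val → β.Val
  | _, _, .id, x => x
  | _, _, .comp g f, x => g.eval (f.eval x)
  | _, _, .pair f g, x => (f.eval x, g.eval x)
  | _, _, .fst, x => x.1
  | _, _, .snd, x => x.2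
  | _, _, .tt, _ => true
  | _, _, .ff, _ => false
  | _, _, .ite c f g, x => if c.eval x = true then f.eval x else g.eval x
  | _, _, .zero, _ => (0 : ℕ)
  | _, _, .succ, x => Nat.succ x
  | _, _, .natEq, x => decide (x.1 = x.2)
  | _, _, .natLt, x => decide (x.1 < x.2)
  | _, _, .nil, _ => []
  | _, _, .cons, x => x.1 :: x.2
  | _, _, .listCase f g, x =>
      match x.2 with
      | [] => f.eval x.1
      | a :: l => g.eval (x.1, (a, l))
  | _, _, .fold f, x => x.2.1.foldl (fun s a => f.eval (x.1, (a, s))) x.2.2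
  | _, _, .realZero, _ => (0 : ℝ)
  | _, _, .realOne, _ => (1 : ℝ)
  | _, _, .realAdd, x => x.1 + x.2
  | _, _, .realSub, x => x.1 - x.2
  | _, _, .realMul, x => x.1 * x.2
  | _, _, .realDiv, x => x.1 / x.2
  | _, _, .realLt, x => decide (x.1 < x.2)

/-- The cost of a loop over a list: `step` is the effect of one pass through the body on the state,
`c` is the cost of one pass. -/
def loopCost {A S : Type} (step : S → A → S) (c : S → A → ℕ) : List A → S → ℕ
  | [], _ => 1
  | a :: l, s => 1 + c s a + loopCost step c l (step s a)

/-- The cost of running a program on an input, where every operation costs `1`, and an operation on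
real numbers costs in addition the total `size` of its operands and of its result. -/
noncomputable def cost (size : ℝ → ℕ) : {α β : Ty} → Prog α β → α.Val → ℕ
  | _, _, .id, _ => 1
  | _, _, .comp g f, x => 1 + f.cost size x + g.cost size (f.eval x)
  | _, _, .pair f g, x => 1 + f.cost size x + g.cost size x
  | _, _, .fst, _ => 1
  | _, _, .snd, _ => 1
  | _, _, .tt, _ => 1
  | _, _, .ff, _ => 1
  | _, _, .ite c f g, x =>
      1 + c.cost size x + (if c.eval x = true then f.cost size x else g.cost size x)
  | _, _, .zero, _ => 1
  | _, _, .succ, _ => 1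
  | _, _, .natEq, _ => 1
  | _, _, .natLt, _ => 1
  | _, _, .nil, _ => 1
  | _, _, .cons, _ => 1
  | _, _, .listCase f g, x =>
      match x.2 with
      | [] => 1 + f.cost size x.1
      | a :: l => 1 + g.cost size (x.1, (a, l))
  | _, _, .fold f, x =>
      loopCost (fun s a => f.eval (x.1, (a, s))) (fun s a => f.cost size (x.1, (a, s))) x.2.1 x.2.2
  | _, _, .realZero, _ => 1 + size 0
  | _, _, .realOne, _ => 1 + size 1
  | _, _, .realAdd, x => 1 + size x.1 + size x.2 + size (x.1 + x.2)
  | _, _, .realSub, x => 1 + size x.1 + size x.2 + size (x.1 - x.2)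
  | _, _, .realMul, x => 1 + size x.1 + size x.2 + size (x.1 * x.2)
  | _, _, .realDiv, x => 1 + size x.1 + size x.2 + size (x.1 / x.2)
  | _, _, .realLt, x => 1 + size x.1 + size x.2

end Prog

open Classical in
/-- The number of binary digits of numerator and denominator of a rational number (and `0` for an
irrational number; this value is only used where all numbers are rational). -/
noncomputable def bitLength (x : ℝ) : ℕ :=
  if h : ∃ r : ℚ, (r : ℝ) = x then h.choose.num.natAbs.size + h.choose.den.size else 0

theorem bitLength_ratCast (r : ℚ) : bitLength (r : ℝ) = r.num.natAbs.size + r.den.size := by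
  have h : ∃ r' : ℚ, (r' : ℝ) = (r : ℝ) := ⟨r, rfl⟩
  have h' : h.choose = r := by exact_mod_cast h.choose_spec
  rw [bitLength, dif_pos h, h']

/-- The number of steps of a program on an input: every operation counts `1`. -/
noncomputable def Prog.steps {α β : Ty} (P : Prog α β) (x : α.Val) : ℕ :=
  P.cost (fun _ => 0) x

/-- The bit cost of a program on an input with rational numbers: an arithmetical operation or
comparison is charged for the bit lengths of its operands and of its result.  Polynomial bit cost
means polynomial time on a Turing machine. -/
noncomputable def Prog.bitCost {α β : Ty} (P : Prog α β) (x : α.Val) : ℕ :=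
  P.cost bitLength x

/-! ### Instances of the delivery problem -/

/-- An instance: a connected graph with `n` nodes and with nonnegative edge lengths, `k ≥ 1` agents
with initial positions, velocities and ranges (connected subgraphs that together cover the graph),
and the start node and destination node of the package.  (Energy consumption rates play no role for
the delivery time.) -/
structure Instance where
  n : ℕ
  k : ℕ
  G : SimpleGraph (Fin n)
  connected : G.Connected
  len : Sym2 (Fin n) → ℝ
  len_nonneg : ∀ e ∈ G.edgeSet, 0 ≤ len e
  k_pos : 1 ≤ k
  pos : Fin k → Fin n
  vel : Fin k → ℝ
  vel_pos : ∀ a, 0 < vel a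
  range : Fin k → G.Subgraph
  range_connected : ∀ a, (range a).Connected
  pos_mem : ∀ a, pos a ∈ (range a).verts
  range_cover : ⨆ a, range a = ⊤
  source : Fin n
  target : Fin n

/-- Locations: nodes, and points in the interior of edges.  `inner u v x`, for `u < v`, is the point
of the edge `{u, v}` at distance `x` from `u`. -/
inductive Loc (n : ℕ) : Type
  | node (v : Fin n) : Loc n
  | inner (u v : Fin n) (x : ℝ) : Loc n

/-- A trip: the agent sets out at time `start`, moves along `empty` to the pick-up location of the
package, and then carries the package along `carry` to the drop-off location. -/
structure Trip (n k : ℕ) where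
  agent : Fin k
  start : ℝ
  empty : List (Loc n)
  carry : List (Loc n)

/-- A schedule is a list of trips. -/
abbrev Schedule (n k : ℕ) := List (Trip n k)

namespace Instance

variable (I : Instance)

/-- The locations of an instance: all nodes, and the points strictly between the ends of an edge. -/
def IsLoc : Loc I.n → Prop
  | .node _ => True
  | .inner u v x => u < v ∧ I.G.Adj u v ∧ 0 < x ∧ x < I.len s(u, v)

/-- Agent `a` can move from one location to the other along (a part of) a single edge of its
range. -/
def Seg (a : Fin I.k) : Loc I.n → Loc I.n → Prop
  | .node u, .node v => (I.range a).Adj u v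
  | .node w, .inner u v _ => (I.range a).Adj u v ∧ (w = u ∨ w = v)
  | .inner u v _, .node w => (I.range a).Adj u v ∧ (w = u ∨ w = v)
  | .inner u v _, .inner u' v' _ => (I.range a).Adj u v ∧ u' = u ∧ v' = v

/-- The length of the part of an edge between two locations on that edge. -/
noncomputable def segLen : Loc I.n → Loc I.n → ℝ
  | .node u, .node v => I.len s(u, v)
  | .node w, .inner u v x => if w = u then x else I.len s(u, v) - x
  | .inner u v x, .node w => if w = u then x else I.len s(u, v) - x
  | .inner _ _ x, .inner _ _ x' => |x - x'|

/-- The sequence `L` of locations is a walk of agent `a` from `p` to `q`. -/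
def IsWalk (a : Fin I.k) (L : List (Loc I.n)) (p q : Loc I.n) : Prop :=
  L.head? = some p ∧ L.getLast? = some q ∧ (∀ r ∈ L, I.IsLoc r) ∧ L.IsChain (I.Seg a)

/-- The length of a walk. -/
noncomputable def walkLen : List (Loc I.n) → ℝ
  | [] => 0
  | [_] => 0
  | p :: q :: L => I.segLen p q + walkLen (q :: L)

/-- The time at which the package is dropped off at the end of the trip `S`, if it is available at
the pick-up location at time `T`. -/
noncomputable def arrival (T : ℝ) (S : Trip I.n I.k) : ℝ :=
  max T (S.start + I.walkLen S.empty / I.vel S.agent) + I.walkLen S.carry / I.vel S.agent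

/-- The delivery time of a schedule. -/
noncomputable def deliveryTime (S : Schedule I.n I.k) : ℝ :=
  S.foldl I.arrival 0

/-- Feasibility of the rest of a schedule, when the package is at location `p` since time `T`, and
each agent `a` is at location `loc a` and is free to move from time `free a` on. -/
def FeasibleFrom (loc : Fin I.k → Loc I.n) (free : Fin I.k → ℝ) (p : Loc I.n) (T : ℝ) :
    Schedule I.n I.k → Prop
  | [] => p = .node I.target
  | S :: L => free S.agent ≤ S.start ∧ I.IsWalk S.agent S.empty (loc S.agent) p ∧
      ∃ q, I.IsWalk S.agent S.carry p q ∧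
        FeasibleFrom (Function.update loc S.agent q)
          (Function.update free S.agent (I.arrival T S)) q (I.arrival T S) L

/-- Feasible schedules (with handovers at nodes and at interior points of edges): at time `0` the
package is at the start node and each agent is at its initial position; at the end the package is at
the destination node. -/
def Feasible (S : Schedule I.n I.k) : Prop :=
  I.FeasibleFrom (fun a => .node (I.pos a)) (fun _ => 0) (.node I.source) 0 S

open Classical in
/-- The edges of a graph, each listed once, as pairs `(u, v)` with `u < v`. -/
noncomputable def edgeList {n : ℕ} (Adj : Fin n → Fin n → Prop) : List (Fin n × Fin n) :=
  ((List.finRange n).product (List.finRange n)).filter (fun e => e.1 < e.2 ∧ Adj e.1 e.2)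

open Classical in
/-- The nodes of agent `a`'s range. -/
noncomputable def rangeNodes (a : Fin I.k) : List (Fin I.n) :=
  (List.finRange I.n).filter (fun v => v ∈ (I.range a).verts)

/-- Input of an algorithm: the list of nodes, the list of edges with their lengths, the list of
agents (initial position, velocity, nodes of the range, edges of the range), the start node and the
destination node. -/
@[reducible] def inputTy : Ty :=
  .prod (.list .nat)
    (.prod (.list (.prod (.prod .nat .nat) .real))
      (.prod (.list (.prod .nat (.prod .real (.prod (.list .nat) (.list (.prod .nat .nat))))))
        (.prod .nat .nat)))

/-- The input that describes the instance. -/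
noncomputable def encode : inputTy.Val :=
  ((List.finRange I.n).map (fun v => (v : ℕ)),
   (edgeList I.G.Adj).map (fun e => (((e.1 : ℕ), (e.2 : ℕ)), I.len s(e.1, e.2))),
   (List.finRange I.k).map (fun a =>
      ((I.pos a : ℕ), I.vel a, (I.rangeNodes a).map (fun v => (v : ℕ)),
        (edgeList (I.range a).Adj).map (fun e => ((e.1 : ℕ), (e.2 : ℕ))))),
   (I.source : ℕ), (I.target : ℕ))

/-- The data of a location: `(u, v, x)` with `u < v` for a point in the interior of an edge, and
`(v, v, 0)` for a node. -/
@[reducible] def locTy : Ty := .prod .nat (.prod .nat .real)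

/-- Output of an algorithm: a list of trips (agent, start time, empty walk, delivery walk). -/
@[reducible] def outputTy : Ty :=
  .list (.prod .nat (.prod .real (.prod (.list locTy) (.list locTy))))

/-- The data of a location. -/
noncomputable def encodeLoc {n : ℕ} : Loc n → locTy.Val
  | .node v => ((v : ℕ), (v : ℕ), (0 : ℝ))
  | .inner u v x => ((u : ℕ), (v : ℕ), x)

/-- The output that describes a schedule. -/
noncomputable def encodeSchedule {n k : ℕ} (S : Schedule n k) : outputTy.Val :=
  S.map (fun t => ((t.agent : ℕ), t.start, t.empty.map encodeLoc, t.carry.map encodeLoc))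

/-- All edge lengths and velocities are rational numbers. -/
def IsRational : Prop :=
  (∀ e ∈ I.G.edgeSet, ∃ r : ℚ, (r : ℝ) = I.len e) ∧ ∀ a, ∃ r : ℚ, (r : ℝ) = I.vel a

/-- The size of an instance with rational numbers: the number of nodes and agents and the bit
lengths of all edge lengths and velocities. -/
noncomputable def bitSize : ℕ :=
  I.n + I.k + ((edgeList I.G.Adj).map (fun e => bitLength (I.len s(e.1, e.2)))).sum +
    ∑ a, bitLength (I.vel a)

end Instance

end DroneDelivery

namespace DroneDelivery

/-! ### Programs in an environment -/

/-! Relax the problem: let every agent be available at every location of its range from the earliest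
time at which it could get there from its initial position, no matter what it has carried before.
Agents then no longer obstruct each other. Two layers of Dijkstra's algorithm (`primL_spec`) solve
this: one computes the earliest times of each agent at the nodes (`agentTable_spec`), the other
computes times `T` of the package, where an edge is crossed greedily by handing over to a faster
agent at the first point where one can be met (`traverseL_spec`). The times `T`, extended to the
interior of edges, form a potential that no feasible schedule can beat (`lower_bound`,
`le_deliveryTime`), so `T` at the destination is at most the optimum.

The relaxed solution may use an agent several times. If an agent `a` is to take the package again
after others had it, all trips from its old one on are dropped: `a` keeps the package from its old
pick-up location, carries it to its initial position and from there to the new location. Since `a`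
could reach both locations from its initial position by the current time `T'`, this shortcut takes
at most `2 * T'`. In the end every agent makes at most one trip, hence may set out at time 0, and a
route with `c` shortcuts has delivery time at most `(1 + 2 * c) * T` (`RouteInv.push`,
`RouteInv.exists_schedule`).

It remains to see that `c ≤ n - 1` and `c ≤ k - 1`. On one edge the agents that take over are faster
and faster, so none of them recurs there. A second shortcut on the same edge therefore reaches back
to a trip from before the edge and deletes the first one; each edge contributes at most one
(`RouteShape.push`), and a label of Dijkstra's algorithm uses at most `n - 1` edges. Moreover a new
shortcut replaces at least two trips of different agents by a single one, which gives `k - 1`.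

For the running time, a program whose loops and numbers stay below `N` has cost polynomial in `N`
(`Good.cost_le`). Size estimates are made once for an abstract measure (`SizeModel`), and used for
the step count with all sizes 0 and for the bit cost with rational bit lengths. Bit lengths do not
explode because each new time contains the previous one only once, so sizes add up along a route
(`sz_meetL`). -/

def natEqB (a b : ℕ) : Bool := decide (a = b)

def natLtB (a b : ℕ) : Bool := decide (a < b)

noncomputable def realLtB (x y : ℝ) : Bool := decide (x < y)

@[simp] theorem natEqB_iff {a b : ℕ} : natEqB a b = true ↔ a = b := decide_eq_true_iff

@[simp] theorem natLtB_iff {a b : ℕ} : natLtB a b = true ↔ a < b := decide_eq_true_iff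

@[simp] theorem realLtB_iff {x y : ℝ} : realLtB x y = true ↔ x < y := decide_eq_true_iff

namespace Prog

variable {α β γ σ τ : Ty}

/-- A program that ignores the most recent variable of its environment. -/
def up (f : Prog γ β) : Prog (.prod γ α) β := comp f fst

/-- Variables are de Bruijn indices into an environment of nested pairs that grows on the right. -/
def v0 : Prog (.prod γ α) α := snd

def v1 {α₀ : Ty} : Prog (.prod (.prod γ α) α₀) α := up v0

def v2 {α₀ α₁ : Ty} : Prog (.prod (.prod (.prod γ α) α₀) α₁) α := up v1

def v3 {α₀ α₁ α₂ : Ty} : Prog (.prod (.prod (.prod (.prod γ α) α₀) α₁) α₂) α := up v2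

def p1 (f : Prog γ (.prod α β)) : Prog γ α := comp fst f

def p2 (f : Prog γ (.prod α β)) : Prog γ β := comp snd f

def letE (e : Prog γ α) (f : Prog (.prod γ α) β) : Prog γ β := comp f (pair id e)

/-- In the body, `v0` is the loop state and `v1` the current element; likewise in `caseE`, `v0` is
the tail and `v1` the head. -/
def foldE (l : Prog γ (.list α)) (s : Prog γ σ) (f : Prog (.prod (.prod γ α) σ) σ) : Prog γ σ :=
  comp (fold (comp f (pair (pair fst (comp fst snd)) (comp snd snd)))) (pair id (pair l s))

def caseE (l : Prog γ (.list α)) (f : Prog γ β) (g : Prog (.prod (.prod γ α) (.list α)) β) :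
    Prog γ β :=
  comp (listCase f (comp g (pair (pair fst (comp fst snd)) (comp snd snd)))) (pair id l)

def consE (a : Prog γ α) (l : Prog γ (.list α)) : Prog γ (.list α) := comp cons (pair a l)

def single (a : Prog γ α) : Prog γ (.list α) := consE a nil

def natEqE (a b : Prog γ .nat) : Prog γ .bool := comp natEq (pair a b)

def natLtE (a b : Prog γ .nat) : Prog γ .bool := comp natLt (pair a b)

def addE (a b : Prog γ .real) : Prog γ .real := comp realAdd (pair a b)

def subE (a b : Prog γ .real) : Prog γ .real := comp realSub (pair a b)

def mulE (a b : Prog γ .real) : Prog γ .real := comp realMul (pair a b)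

def divE (a b : Prog γ .real) : Prog γ .real := comp realDiv (pair a b)

def ltE (a b : Prog γ .real) : Prog γ .bool := comp realLt (pair a b)

section Eval

variable {x : γ.Val}

@[simp] theorem eval_up (f : Prog γ β) (x : (Ty.prod γ α).Val) :
    (up f).eval x = f.eval x.1 := rfl
@[simp] theorem eval_v0 (x : (Ty.prod γ α).Val) : v0.eval x = x.2 := rfl
@[simp] theorem eval_v1 {α₀ : Ty} (x : (Ty.prod (.prod γ α) α₀).Val) : v1.eval x = x.1.2 := rfl
@[simp] theorem eval_v2 {α₀ α₁ : Ty} (x : (Ty.prod (.prod (.prod γ α) α₀) α₁).Val) :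
    v2.eval x = x.1.1.2 := rfl
@[simp] theorem eval_v3 {α₀ α₁ α₂ : Ty}
    (x : (Ty.prod (.prod (.prod (.prod γ α) α₀) α₁) α₂).Val) : v3.eval x = x.1.1.1.2 := rfl
@[simp] theorem eval_p1 (f : Prog γ (.prod α β)) : (p1 f).eval x = (f.eval x).1 := rfl
@[simp] theorem eval_p2 (f : Prog γ (.prod α β)) : (p2 f).eval x = (f.eval x).2 := rfl
@[simp] theorem eval_letE (e : Prog γ α) (f : Prog (.prod γ α) β) :
    (letE e f).eval x = f.eval (x, e.eval x) := rfl
@[simp] theorem eval_foldE (l : Prog γ (.list α)) (s : Prog γ σ)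
    (f : Prog (.prod (.prod γ α) σ) σ) :
    (foldE l s f).eval x = (l.eval x).foldl (fun s a => f.eval ((x, a), s)) (s.eval x) := rfl
theorem eval_caseE (l : Prog γ (.list α)) (f : Prog γ β)
    (g : Prog (.prod (.prod γ α) (.list α)) β) :
    (caseE l f g).eval x =
      match l.eval x with
      | [] => f.eval x
      | a :: l' => g.eval ((x, a), l') := by
  rw [caseE, eval, eval, eval, eval]
  cases l.eval x <;> rfl
@[simp] theorem eval_consE (a : Prog γ α) (l : Prog γ (.list α)) :
    (consE a l).eval x = a.eval x :: l.eval x := rfl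
@[simp] theorem eval_single (a : Prog γ α) : (single a).eval x = [a.eval x] := rfl
@[simp] theorem eval_natEqE (a b : Prog γ .nat) :
    (natEqE a b).eval x = natEqB (a.eval x) (b.eval x) := rfl
@[simp] theorem eval_natLtE (a b : Prog γ .nat) :
    (natLtE a b).eval x = natLtB (a.eval x) (b.eval x) := rfl
@[simp] theorem eval_addE (a b : Prog γ .real) :
    (addE a b).eval x = (a.eval x + b.eval x : ℝ) := rfl
@[simp] theorem eval_subE (a b : Prog γ .real) :
    (subE a b).eval x = (a.eval x - b.eval x : ℝ) := rfl
@[simp] theorem eval_mulE (a b : Prog γ .real) :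
    (mulE a b).eval x = (a.eval x * b.eval x : ℝ) := rfl
@[simp] theorem eval_divE (a b : Prog γ .real) :
    (divE a b).eval x = (a.eval x / b.eval x : ℝ) := rfl
@[simp] theorem eval_ltE (a b : Prog γ .real) :
    (ltE a b).eval x = realLtB (a.eval x) (b.eval x) := rfl
@[simp] theorem eval_id' : (id : Prog γ γ).eval x = x := rfl
@[simp] theorem eval_comp' (g : Prog α β) (f : Prog γ α) : (comp g f).eval x = g.eval (f.eval x) :=
  rfl
@[simp] theorem eval_pair' (f : Prog γ α) (g : Prog γ β) :
    (pair f g).eval x = (f.eval x, g.eval x) := rfl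
@[simp] theorem eval_fst' (x : (Ty.prod γ α).Val) : fst.eval x = x.1 := rfl
@[simp] theorem eval_snd' (x : (Ty.prod γ α).Val) : snd.eval x = x.2 := rfl
@[simp] theorem eval_tt' : (tt : Prog γ .bool).eval x = true := rfl
@[simp] theorem eval_ff' : (ff : Prog γ .bool).eval x = false := rfl
@[simp] theorem eval_ite' (c : Prog γ .bool) (f g : Prog γ α) :
    (ite c f g).eval x = if c.eval x = true then f.eval x else g.eval x := rfl
@[simp] theorem eval_zero' : (zero : Prog γ .nat).eval x = 0 := rfl
@[simp] theorem eval_succ' (m : ℕ) : succ.eval m = m + 1 := rfl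
@[simp] theorem eval_nil' : (nil : Prog γ (.list α)).eval x = [] := rfl
@[simp] theorem eval_realZero' : (realZero : Prog γ .real).eval x = (0 : ℝ) := rfl
@[simp] theorem eval_realOne' : (realOne : Prog γ .real).eval x = (1 : ℝ) := rfl

end Eval

/-! ### A uniform cost bound -/

/-- A property of all passes of a loop. -/
def LoopAll {A S : Type} (step : S → A → S) (p : S → A → Prop) : List A → S → Prop
  | [], _ => True
  | a :: l, s => p s a ∧ LoopAll step p l (step s a)

/-- The invariant sees the part of the list that is still to come, so it can count the remaining
passes. This is needed where numbers grow a little in each pass. -/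
theorem LoopAll.of_inv {A S : Type} {step : S → A → S} {p : S → A → Prop} (inv : List A → S → Prop)
    (hstep : ∀ a l s, inv (a :: l) s → p s a ∧ inv l (step s a)) :
    ∀ l s, inv l s → LoopAll step p l s
  | [], _, _ => trivial
  | a :: l, s, h => ⟨(hstep a l s h).1, of_inv inv hstep l _ (hstep a l s h).2⟩

theorem LoopAll.of_forall {A S : Type} {step : S → A → S} {p : S → A → Prop} {l : List A}
    (h : ∀ a ∈ l, ∀ s, p s a) (s : S) : LoopAll step p l s :=
  of_inv (fun l _ => ∀ a ∈ l, ∀ s, p s a)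
    (fun a _ s h => ⟨h a (by simp) s, fun b hb => h b (by simp [hb])⟩) l s h

/-- In the run of the program, all loops run through lists of length at most `N`, and all operations
are on real numbers of size at most `N`, also the results. -/
def Good (size : ℝ → ℕ) (N : ℕ) : {α β : Ty} → Prog α β → α.Val → Prop
  | _, _, .id, _ => True
  | _, _, .comp g f, x => f.Good size N x ∧ g.Good size N (f.eval x)
  | _, _, .pair f g, x => f.Good size N x ∧ g.Good size N x
  | _, _, .fst, _ => True
  | _, _, .snd, _ => True
  | _, _, .tt, _ => True
  | _, _, .ff, _ => True
  | _, _, .ite c f g, x =>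
      c.Good size N x ∧ (if c.eval x = true then f.Good size N x else g.Good size N x)
  | _, _, .zero, _ => True
  | _, _, .succ, _ => True
  | _, _, .natEq, _ => True
  | _, _, .natLt, _ => True
  | _, _, .nil, _ => True
  | _, _, .cons, _ => True
  | _, _, .listCase f g, x =>
      match x.2 with
      | [] => f.Good size N x.1
      | a :: l => g.Good size N (x.1, (a, l))
  | _, _, .fold f, x => x.2.1.length ≤ N ∧
      LoopAll (fun s a => f.eval (x.1, (a, s))) (fun s a => f.Good size N (x.1, (a, s))) x.2.1 x.2.2
  | _, _, .realZero, _ => size 0 ≤ N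
  | _, _, .realOne, _ => size 1 ≤ N
  | _, _, .realAdd, x => size x.1 ≤ N ∧ size x.2 ≤ N ∧ size (x.1 + x.2) ≤ N
  | _, _, .realSub, x => size x.1 ≤ N ∧ size x.2 ≤ N ∧ size (x.1 - x.2) ≤ N
  | _, _, .realMul, x => size x.1 ≤ N ∧ size x.2 ≤ N ∧ size (x.1 * x.2) ≤ N
  | _, _, .realDiv, x => size x.1 ≤ N ∧ size x.2 ≤ N ∧ size (x.1 / x.2) ≤ N
  | _, _, .realLt, x => size x.1 ≤ N ∧ size x.2 ≤ N

open Polynomial in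
/-- A polynomial bound for the cost of the good runs of a program. -/
noncomputable def bound : {α β : Ty} → Prog α β → Polynomial ℕ
  | _, _, .comp g f => 1 + f.bound + g.bound
  | _, _, .pair f g => 1 + f.bound + g.bound
  | _, _, .ite c f g => 1 + c.bound + (f.bound + g.bound)
  | _, _, .listCase f g => 1 + (f.bound + g.bound)
  | _, _, .fold f => 1 + X * (1 + f.bound)
  | _, _, _ => 1 + 3 * X

theorem loopCost_le {A S : Type} {step : S → A → S} {c : S → A → ℕ} {b : ℕ} :
    ∀ (l : List A) (s : S), LoopAll step (fun s a => c s a ≤ b) l s →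
      loopCost step c l s ≤ 1 + l.length * (1 + b)
  | [], s, _ => by simp [loopCost]
  | a :: l, s, h => by
      have h1 := loopCost_le l _ h.2
      have h2 : c s a ≤ b := h.1
      simp only [loopCost, List.length_cons]
      linarith [h1, h2, add_mul l.length 1 (1 + b)]

theorem LoopAll.imp {A S : Type} {step : S → A → S} {p q : S → A → Prop}
    (h : ∀ s a, p s a → q s a) : ∀ (l : List A) (s : S), LoopAll step p l s → LoopAll step q l s
  | [], _, _ => trivial
  | _ :: l, _, hp => ⟨h _ _ hp.1, imp h l _ hp.2⟩

/-- Induction on the program: a loop costs at most its length times the bound for one pass, and an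
operation on reals involves at most three numbers. Loop states may grow during a run, which is why
`Good` speaks about the passes that really occur. -/
theorem Good.cost_le {size : ℝ → ℕ} {N : ℕ} {α β : Ty} (P : Prog α β) :
    ∀ x : α.Val, P.Good size N x → P.cost size x ≤ P.bound.eval N := by
  induction P with
  | comp g f hg hf =>
    intro x h
    have h1 := hf x h.1
    have h2 := hg _ h.2
    simp only [cost, bound, Polynomial.eval_add, Polynomial.eval_one]
    omega
  | pair f g hf hg =>
    intro x h
    have h1 := hf x h.1
    have h2 := hg x h.2
    simp only [cost, bound, Polynomial.eval_add, Polynomial.eval_one]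
    omega
  | ite c f g hc hf hg =>
    intro x h
    obtain ⟨h0, h⟩ := h
    have h1 := hc x h0
    simp only [cost, bound, Polynomial.eval_add, Polynomial.eval_one]
    split_ifs at h ⊢ with hx
    · have := hf x h
      omega
    · have := hg x h
      omega
  | listCase f g hf hg =>
    rintro ⟨x, l⟩ h
    cases l with
    | nil =>
      have := hf x h
      simp only [cost, bound, Polynomial.eval_add, Polynomial.eval_one]
      omega
    | cons a l =>
      have : g.cost size (x, (a, l)) ≤ g.bound.eval N := hg _ h
      simp only [cost, bound, Polynomial.eval_add, Polynomial.eval_one]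
      omega
  | fold f hf =>
    rintro ⟨x, l, s⟩ h
    simp only [cost, bound, Polynomial.eval_add, Polynomial.eval_one, Polynomial.eval_mul,
      Polynomial.eval_X]
    refine (loopCost_le l s (LoopAll.imp (fun s a => hf _) l s h.2)).trans ?_
    gcongr
    exact h.1
  | realZero | realOne =>
    intro x h
    simp only [Good] at h
    simp only [cost, bound, Polynomial.eval_add, Polynomial.eval_one, Polynomial.eval_mul,
      Polynomial.eval_X, Polynomial.eval_ofNat]
    omega
  | realAdd | realSub | realMul | realDiv | realLt =>
    intro x h
    simp only [Good] at h
    simp only [cost, bound, Polynomial.eval_add, Polynomial.eval_one, Polynomial.eval_mul,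
      Polynomial.eval_X, Polynomial.eval_ofNat]
    omega
  | _ =>
    intro x h
    simp [cost, bound]

section GoodEnv

variable {size : ℝ → ℕ} {N : ℕ} {x : γ.Val}

@[simp] theorem good_up (f : Prog γ β) (x : (Ty.prod γ α).Val) :
    (up f).Good size N x ↔ f.Good size N x.1 := by simp [up, Good]
@[simp] theorem good_v0 {x : (Ty.prod γ α).Val} : (v0 : Prog (.prod γ α) α).Good size N x := trivial
@[simp] theorem good_v1 {α₀ : Ty} {x : (Ty.prod (.prod γ α) α₀).Val} :
    (v1 : Prog (.prod (.prod γ α) α₀) α).Good size N x := ⟨trivial, trivial⟩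
@[simp] theorem good_v2 {α₀ α₁ : Ty} {x : (Ty.prod (.prod (.prod γ α) α₀) α₁).Val} :
    (v2 : Prog (.prod (.prod (.prod γ α) α₀) α₁) α).Good size N x := ⟨trivial, good_v1⟩
@[simp] theorem good_v3 {α₀ α₁ α₂ : Ty} {x : (Ty.prod (.prod (.prod (.prod γ α) α₀) α₁) α₂).Val} :
    (v3 : Prog (.prod (.prod (.prod (.prod γ α) α₀) α₁) α₂) α).Good size N x := ⟨trivial, good_v2⟩
@[simp] theorem good_p1 (f : Prog γ (.prod α β)) :
    (p1 f).Good size N x ↔ f.Good size N x := by simp [p1, Good]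
@[simp] theorem good_p2 (f : Prog γ (.prod α β)) :
    (p2 f).Good size N x ↔ f.Good size N x := by simp [p2, Good]
@[simp] theorem good_letE (e : Prog γ α) (f : Prog (.prod γ α) β) :
    (letE e f).Good size N x ↔ e.Good size N x ∧ f.Good size N (x, e.eval x) := by
  simp [letE, Good]
@[simp] theorem good_foldE (l : Prog γ (.list α)) (s : Prog γ σ)
    (f : Prog (.prod (.prod γ α) σ) σ) :
    (foldE l s f).Good size N x ↔ l.Good size N x ∧ s.Good size N x ∧ (l.eval x).length ≤ N ∧
      LoopAll (fun s a => f.eval ((x, a), s)) (fun s a => f.Good size N ((x, a), s))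
        (l.eval x) (s.eval x) := by
  simp [foldE, Good, and_assoc]
theorem good_caseE (l : Prog γ (.list α)) (f : Prog γ β)
    (g : Prog (.prod (.prod γ α) (.list α)) β) :
    (caseE l f g).Good size N x ↔ l.Good size N x ∧
      match l.eval x with
      | [] => f.Good size N x
      | a :: l' => g.Good size N ((x, a), l') := by
  simp only [caseE, Good, eval_pair', eval_id', true_and, and_congr_right_iff]
  intro _
  cases l.eval x
  · rfl
  · simp
@[simp] theorem good_consE (a : Prog γ α) (l : Prog γ (.list α)) :
    (consE a l).Good size N x ↔ a.Good size N x ∧ l.Good size N x := by simp [consE, Good]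
@[simp] theorem good_single (a : Prog γ α) :
    (single a).Good size N x ↔ a.Good size N x := by simp [single, Good]
@[simp] theorem good_natEqE (a b : Prog γ .nat) :
    (natEqE a b).Good size N x ↔ a.Good size N x ∧ b.Good size N x := by simp [natEqE, Good]
@[simp] theorem good_natLtE (a b : Prog γ .nat) :
    (natLtE a b).Good size N x ↔ a.Good size N x ∧ b.Good size N x := by simp [natLtE, Good]
@[simp] theorem good_addE (a b : Prog γ .real) :
    (addE a b).Good size N x ↔ (a.Good size N x ∧ b.Good size N x) ∧ size (a.eval x) ≤ N ∧
      size (b.eval x) ≤ N ∧ size (a.eval x + b.eval x) ≤ N := by simp [addE, Good]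
@[simp] theorem good_subE (a b : Prog γ .real) :
    (subE a b).Good size N x ↔ (a.Good size N x ∧ b.Good size N x) ∧ size (a.eval x) ≤ N ∧
      size (b.eval x) ≤ N ∧ size (a.eval x - b.eval x) ≤ N := by simp [subE, Good]
@[simp] theorem good_mulE (a b : Prog γ .real) :
    (mulE a b).Good size N x ↔ (a.Good size N x ∧ b.Good size N x) ∧ size (a.eval x) ≤ N ∧
      size (b.eval x) ≤ N ∧ size (a.eval x * b.eval x) ≤ N := by simp [mulE, Good]
@[simp] theorem good_divE (a b : Prog γ .real) :
    (divE a b).Good size N x ↔ (a.Good size N x ∧ b.Good size N x) ∧ size (a.eval x) ≤ N ∧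
      size (b.eval x) ≤ N ∧ size (a.eval x / b.eval x) ≤ N := by simp [divE, Good]
@[simp] theorem good_ltE (a b : Prog γ .real) :
    (ltE a b).Good size N x ↔ (a.Good size N x ∧ b.Good size N x) ∧ size (a.eval x) ≤ N ∧
      size (b.eval x) ≤ N := by simp [ltE, Good]
@[simp] theorem good_id' : (id : Prog γ γ).Good size N x := trivial
@[simp] theorem good_comp' (g : Prog α β) (f : Prog γ α) :
    (comp g f).Good size N x ↔ f.Good size N x ∧ g.Good size N (f.eval x) := Iff.rfl
@[simp] theorem good_pair' (f : Prog γ α) (g : Prog γ β) :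
    (pair f g).Good size N x ↔ f.Good size N x ∧ g.Good size N x := Iff.rfl
@[simp] theorem good_fst' {x : (Ty.prod γ α).Val} : (fst : Prog (.prod γ α) γ).Good size N x :=
  trivial
@[simp] theorem good_snd' {x : (Ty.prod γ α).Val} : (snd : Prog (.prod γ α) α).Good size N x :=
  trivial
@[simp] theorem good_tt' : (tt : Prog γ .bool).Good size N x := trivial
@[simp] theorem good_ff' : (ff : Prog γ .bool).Good size N x := trivial
@[simp] theorem good_ite' (c : Prog γ .bool) (f g : Prog γ α) :
    (ite c f g).Good size N x ↔ c.Good size N x ∧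
      (if c.eval x = true then f.Good size N x else g.Good size N x) := Iff.rfl
@[simp] theorem good_zero' : (zero : Prog γ .nat).Good size N x := trivial
@[simp] theorem good_succ' (m : ℕ) : succ.Good size N m := trivial
@[simp] theorem good_nil' : (nil : Prog γ (.list α)).Good size N x := trivial
@[simp] theorem good_realZero' : (realZero : Prog γ .real).Good size N x ↔ size 0 ≤ N := Iff.rfl
@[simp] theorem good_realOne' : (realOne : Prog γ .real).Good size N x ↔ size 1 ≤ N := Iff.rfl

end GoodEnv

end Prog

/-! ### List comprehension, minima, reversal -/

section Lists

variable {A B : Type}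

/-- List comprehension (the order of the result is of no importance). -/
def collectL (f : A → List B) (l : List A) : List B :=
  l.foldl (fun s a => (f a).foldl (fun s b => b :: s) s) []

theorem foldl_cons_eq (l s : List A) : l.foldl (fun s b => b :: s) s = l.reverse ++ s := by
  induction l generalizing s with
  | nil => rfl
  | cons a l ih => simp [ih]

theorem collectL_eq (f : A → List B) (l : List A) :
    collectL f l = (l.reverse.map (fun a => (f a).reverse)).flatten := by
  have : ∀ s : List B, l.foldl (fun s a => (f a).foldl (fun s b => b :: s) s) s =
      (l.reverse.map (fun a => (f a).reverse)).flatten ++ s := by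
    induction l with
    | nil => intro s; rfl
    | cons a l ih =>
      intro s
      rw [List.foldl_cons, ih, foldl_cons_eq]
      simp
  rw [collectL, this, List.append_nil]

@[simp] theorem mem_collectL {f : A → List B} {l : List A} {b : B} :
    b ∈ collectL f l ↔ ∃ a ∈ l, b ∈ f a := by
  simp [collectL_eq]

theorem length_collectL_le {f : A → List B} {m : ℕ} {l : List A} (h : ∀ a ∈ l, (f a).length ≤ m) :
    (collectL f l).length ≤ l.length * m := by
  rw [collectL_eq, List.length_flatten]
  have := List.sum_le_card_nsmul
    (((l.reverse.map (fun a => (f a).reverse))).map List.length) m (by simpa using h)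
  simpa using this

/-- Comparison of keys: a smaller first component is better, then a larger second component. -/
noncomputable def keyLt (a b : ℝ × ℝ) : Bool :=
  if realLtB a.1 b.1 = true then true
  else if realLtB b.1 a.1 = true then false else realLtB b.2 a.2

def KeyLe (a b : ℝ × ℝ) : Prop := a.1 < b.1 ∨ (a.1 = b.1 ∧ b.2 ≤ a.2)

theorem KeyLe.refl (a : ℝ × ℝ) : KeyLe a a := Or.inr ⟨rfl, le_rfl⟩

theorem KeyLe.trans {a b c : ℝ × ℝ} (h : KeyLe a b) (h' : KeyLe b c) : KeyLe a c := by
  unfold KeyLe at *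
  grind

theorem KeyLe.fst_le {a b : ℝ × ℝ} (h : KeyLe a b) : a.1 ≤ b.1 := by
  rcases h with h | h
  · exact h.le
  · exact h.1.le

theorem keyLe_of_keyLt {a b : ℝ × ℝ} (h : keyLt a b = true) : KeyLe a b := by
  unfold keyLt realLtB at h
  unfold KeyLe
  grind

theorem keyLe_of_not_keyLt {a b : ℝ × ℝ} (h : ¬ keyLt a b = true) : KeyLe b a := by
  unfold keyLt realLtB at h
  unfold KeyLe
  grind

noncomputable def argminStep (s : List ((ℝ × ℝ) × A)) (c : (ℝ × ℝ) × A) : List ((ℝ × ℝ) × A) :=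
  match s with
  | [] => [c]
  | b :: _ => if keyLt c.1 b.1 = true then [c] else [b]

/-- A best element of a list (as a list of length at most 1). -/
noncomputable def argminL (l : List ((ℝ × ℝ) × A)) : List ((ℝ × ℝ) × A) := l.foldl argminStep []

theorem foldl_argminStep (l : List ((ℝ × ℝ) × A)) (b : (ℝ × ℝ) × A) :
    ∃ b' ∈ b :: l, l.foldl argminStep [b] = [b'] ∧ ∀ c ∈ b :: l, KeyLe b'.1 c.1 := by
  induction l generalizing b with
  | nil => exact ⟨b, by simp, rfl, by simp [KeyLe.refl]⟩
  | cons c l ih =>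
    simp only [List.foldl_cons, argminStep]
    split_ifs with h
    · obtain ⟨b', hb', he, hle⟩ := ih c
      refine ⟨b', List.mem_cons_of_mem _ hb', he, fun d hd => ?_⟩
      rcases List.mem_cons.1 hd with rfl | hd
      · exact (hle c (by simp)).trans (keyLe_of_keyLt h)
      · exact hle d hd
    · obtain ⟨b', hb', he, hle⟩ := ih b
      refine ⟨b', ?_, he, fun d hd => ?_⟩
      · rcases List.mem_cons.1 hb' with rfl | hb'
        · simp
        · simp [hb']
      · rcases List.mem_cons.1 hd with rfl | hd
        · exact hle d (by simp)
        · rcases List.mem_cons.1 hd with rfl | hd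
          · exact (hle b (by simp)).trans (keyLe_of_not_keyLt h)
          · exact hle d (by simp [hd])

theorem argminL_cases (l : List ((ℝ × ℝ) × A)) :
    (l = [] ∧ argminL l = []) ∨ ∃ b ∈ l, argminL l = [b] ∧ ∀ c ∈ l, KeyLe b.1 c.1 := by
  cases l with
  | nil => exact Or.inl ⟨rfl, rfl⟩
  | cons a l => exact Or.inr (foldl_argminStep l a)

noncomputable def memL (m : ℕ) (l : List (ℕ × A)) : Bool :=
  l.foldl (fun s e => if natEqB m e.1 = true then true else s) false

@[simp] theorem memL_eq_true {m : ℕ} {l : List (ℕ × A)} : memL m l = true ↔ ∃ e ∈ l, e.1 = m := by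
  have : ∀ s : Bool, l.foldl (fun s e => if natEqB m e.1 = true then true else s) s = true ↔
      s = true ∨ ∃ e ∈ l, e.1 = m := by
    induction l with
    | nil => simp
    | cons a l ih =>
      intro s
      rw [List.foldl_cons, ih]
      by_cases h : m = a.1
      · simp [h]
      · have : a.1 ≠ m := Ne.symm h
        simp [h, this]
  simpa [memL] using this false

end Lists

namespace Prog

variable {α β γ σ τ : Ty} {size : ℝ → ℕ} {N : ℕ} {x : γ.Val}

def collectE (l : Prog γ (.list α)) (f : Prog (.prod γ α) (.list β)) : Prog γ (.list β) :=
  foldE l nil (foldE (up f) v0 (consE v1 v0))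

@[simp] theorem eval_collectE (l : Prog γ (.list α)) (f : Prog (.prod γ α) (.list β)) :
    (collectE l f).eval x = collectL (fun a => f.eval (x, a)) (l.eval x) := rfl

theorem good_collectE {l : Prog γ (.list α)} {f : Prog (.prod γ α) (.list β)}
    (hl : l.Good size N x) (hN : (l.eval x).length ≤ N)
    (h : ∀ a ∈ l.eval x, f.Good size N (x, a) ∧ (f.eval (x, a)).length ≤ N) :
    (collectE l f).Good size N x := by
  simp only [collectE, good_foldE, hl, hN, good_nil', true_and]
  refine LoopAll.of_forall (fun a ha s => ?_) _
  have := h a ha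
  simp only [good_up, eval_up, good_v0, true_and, this.1, this.2, good_consE, good_v1,
    and_self]
  exact LoopAll.of_forall (fun _ _ _ => trivial) _

def argminE (l : Prog γ (.list (.prod (.prod .real .real) α))) :
    Prog γ (.list (.prod (.prod .real .real) α)) :=
  foldE l nil (caseE v0 (single v1)
    (ite
      (ite (ltE (p1 (p1 v3)) (p1 (p1 v1))) tt
        (ite (ltE (p1 (p1 v1)) (p1 (p1 v3))) ff (ltE (p2 (p1 v1)) (p2 (p1 v3)))))
      (single v3) (single v1)))

theorem eval_argminE (l : Prog γ (.list (.prod (.prod .real .real) α))) :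
    (argminE l).eval x = argminL (l.eval x) := by
  simp only [argminE, eval_foldE, argminL, eval_nil']
  congr 1
  funext s c
  rw [eval_caseE]
  cases s with
  | nil => rfl
  | cons b s =>
    simp only [eval_v0, eval_ite', eval_single, eval_v1, eval_v3, eval_ltE, eval_p1, eval_p2,
      eval_tt', eval_ff', argminStep, keyLt]
    rfl

theorem good_argminE {l : Prog γ (.list (.prod (.prod .real .real) α))} (hl : l.Good size N x)
    (hN : (l.eval x).length ≤ N)
    (h : ∀ c ∈ l.eval x, size c.1.1 ≤ N ∧ size c.1.2 ≤ N) :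
    (argminE l).Good size N x := by
  simp only [argminE, good_foldE, hl, hN, good_nil', true_and, eval_nil']
  -- The element kept so far is always one of the list, so its keys are among the numbers with
  -- bounded size.
  refine LoopAll.of_inv (fun l' s => (∀ c ∈ l', c ∈ l.eval x) ∧ ∀ c ∈ s, c ∈ l.eval x) ?_ _ _
    ⟨fun _ h => h, by simp⟩
  rintro a l' s ⟨h1, h2⟩
  have ha := h a (h1 a (by simp))
  constructor
  · rw [good_caseE]
    cases s with
    | nil => simp
    | cons b s =>
      have hb := h b (h2 b (by simp))
      simp [ha, hb]
  · refine ⟨fun c hc => h1 c (by simp [hc]), ?_⟩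
    rw [eval_caseE]
    cases s with
    | nil => simpa using h1 a (by simp)
    | cons b s =>
      have e1 := h1 a (by simp)
      have e2 := h2 b (by simp)
      intro c
      simp only [eval_v0, eval_ite', eval_single, eval_v1]
      split_ifs
      all_goals
        simp only [List.mem_singleton, eval_v3]
        rintro rfl
        assumption

def memE (m : Prog γ .nat) (l : Prog γ (.list (.prod .nat α))) : Prog γ .bool :=
  foldE l ff (ite (natEqE (up (up m)) (p1 v1)) tt v0)

@[simp] theorem eval_memE (m : Prog γ .nat) (l : Prog γ (.list (.prod .nat α))) :
    (memE m l).eval x = memL (m.eval x) (l.eval x) := rfl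

theorem good_memE {m : Prog γ .nat} {l : Prog γ (.list (.prod .nat α))} (hm : m.Good size N x)
    (hl : l.Good size N x) (hN : (l.eval x).length ≤ N) : (memE m l).Good size N x := by
  simp only [memE, good_foldE, hl, hN, good_ff', true_and]
  refine LoopAll.of_forall (fun a _ s => ?_) _
  simp [hm]

/-- `revE l s` puts the elements of `l`, in reversed order, in front of `s`. -/
def revE (l s : Prog γ (.list α)) : Prog γ (.list α) := foldE l s (consE v1 v0)

@[simp] theorem eval_revE (l s : Prog γ (.list α)) :
    (revE l s).eval x = (l.eval x).reverse ++ s.eval x := by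
  rw [← foldl_cons_eq]; rfl

theorem good_revE {l s : Prog γ (.list α)} (hl : l.Good size N x) (hs : s.Good size N x)
    (hN : (l.eval x).length ≤ N) : (revE l s).Good size N x := by
  simp only [revE, good_foldE, hl, hs, hN, true_and]
  exact LoopAll.of_forall (fun _ _ _ => by simp) _

def tailE (l : Prog γ (.list α)) : Prog γ (.list α) := caseE l nil v0

@[simp] theorem eval_tailE (l : Prog γ (.list α)) : (tailE l).eval x = (l.eval x).tail := by
  rw [tailE, eval_caseE]
  cases l.eval x <;> rfl

theorem good_tailE {l : Prog γ (.list α)} (hl : l.Good size N x) : (tailE l).Good size N x := by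
  rw [tailE, good_caseE]
  refine ⟨hl, ?_⟩
  cases l.eval x <;> simp

end Prog

/-! ### Earliest arrival times -/

section Prim

variable {A : Type}

abbrev EdgeData := (ℕ × ℕ) × ℝ

/-- These are the extensions of settled nodes along one edge to nodes not yet settled. The second
key is 0 because ties between times do not matter here, unlike for agents on an edge. -/
noncomputable def primCandsL (relax : EdgeData → ℝ × A → List (ℝ × A)) (D : List EdgeData)
    (S : List (ℕ × (ℝ × A))) : List ((ℝ × ℝ) × (ℕ × (ℝ × A))) :=
  collectL (fun e => collectL (fun d =>
    if natEqB d.1.1 e.1 = true then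
      if memL d.1.2 S = true then [] else collectL (fun c => [((c.1, 0), (d.1.2, c))]) (relax d e.2)
    else []) D) S

noncomputable def primStepL (relax : EdgeData → ℝ × A → List (ℝ × A)) (D : List EdgeData)
    (S : List (ℕ × (ℝ × A))) : List (ℕ × (ℝ × A)) :=
  match argminL (primCandsL relax D S) with
  | [] => S
  | b :: _ => b.2 :: S

/-- The algorithm of Dijkstra, where `relax d c` is the list of the labels that the end of the
edge `d` gets from the label `c` at the start of `d`. -/
noncomputable def primL (relax : EdgeData → ℝ × A → List (ℝ × A)) (D : List EdgeData)
    (rounds : List ℕ) (e : ℕ × (ℝ × A)) : List (ℕ × (ℝ × A)) :=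
  rounds.foldl (fun S _ => primStepL relax D S) [e]

variable {relax : EdgeData → ℝ × A → List (ℝ × A)} {D : List EdgeData} {S : List (ℕ × (ℝ × A))}

theorem mem_primCandsL {b : (ℝ × ℝ) × (ℕ × (ℝ × A))} :
    b ∈ primCandsL relax D S ↔ ∃ e ∈ S, ∃ d ∈ D, d.1.1 = e.1 ∧ (∀ e' ∈ S, e'.1 ≠ d.1.2) ∧
      ∃ c ∈ relax d e.2, b = ((c.1, 0), (d.1.2, c)) := by
  simp only [primCandsL, mem_collectL, natEqB_iff]
  refine exists_congr fun e => and_congr_right fun _ => exists_congr fun d =>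
    and_congr_right fun _ => ?_
  by_cases h : d.1.1 = e.1
  · by_cases h' : memL d.1.2 S = true
    · have := memL_eq_true.1 h'
      simp only [h, if_true, h', List.not_mem_nil, true_and, false_iff]
      grind
    · have := mt memL_eq_true.2 h'
      push Not at this
      simp [h, h', mem_collectL]
      grind
  · simp [h]

/-- The lower bound later needs only `closed`, an inequality along each edge between settled nodes;
`frontier`, the usual monotonicity of Dijkstra's algorithm, serves to preserve it. The level in
`val` is the number of rounds so far, which bounds the number of edges behind a label. -/
structure PrimInv (relax : EdgeData → ℝ × A → List (ℝ × A)) (D : List EdgeData)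
    (Val : ℕ → ℕ → ℝ × A → Prop) (e₀ : ℕ × (ℝ × A)) (S : List (ℕ × (ℝ × A))) : Prop where
  first_mem : e₀ ∈ S
  nodup : (S.map Prod.fst).Nodup
  val : ∀ e ∈ S, Val (S.length - 1) e.1 e.2
  closed : ∀ e ∈ S, ∀ d ∈ D, d.1.1 = e.1 → ∀ c ∈ relax d e.2, ∀ e' ∈ S, e'.1 = d.1.2 →
    e'.2.1 ≤ c.1
  frontier : ∀ b ∈ primCandsL relax D S, ∀ e ∈ S, e.2.1 ≤ b.1.1

/-- `Val j u c` is what is known about a label `c` at node `u` reached by at most `j` edges. A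
relaxation must not decrease the time, but no monotonicity in the starting label is required, as
optimality of the labels is never claimed. -/
structure PrimHyp (relax : EdgeData → ℝ × A → List (ℝ × A)) (D : List EdgeData)
    (Val : ℕ → ℕ → ℝ × A → Prop) (n : ℕ) (e₀ : ℕ × (ℝ × A)) : Prop where
  mono : ∀ j u c, Val j u c → Val (j + 1) u c
  relax : ∀ j c, ∀ d ∈ D, Val j d.1.1 c → ∀ c' ∈ relax d c,
    Val (j + 1) d.1.2 c' ∧ c.1 ≤ c'.1
  first : Val 0 e₀.1 e₀.2
  lt : ∀ j u c, Val j u c → u < n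

variable {Val : ℕ → ℕ → ℝ × A → Prop} {n : ℕ} {e₀ : ℕ × (ℝ × A)}

theorem PrimInv.length_le (H : PrimHyp relax D Val n e₀) (h : PrimInv relax D Val e₀ S) :
    S.length ≤ n := by
  have h1 : S.map Prod.fst ⊆ List.range n := by
    intro u hu
    obtain ⟨e, he, rfl⟩ := List.mem_map.1 hu
    exact List.mem_range.2 (H.lt _ _ _ (h.val e he))
  simpa using (h.nodup.subperm h1).length_le

theorem PrimInv.length_pos (h : PrimInv relax D Val e₀ S) : 0 < S.length :=
  List.length_pos_of_mem h.first_mem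

theorem PrimInv.singleton (H : PrimHyp relax D Val n e₀)
    (h0 : ∀ d ∈ D, d.1.1 = e₀.1 → d.1.1 ≠ d.1.2) : PrimInv relax D Val e₀ [e₀] where
  first_mem := by simp
  nodup := by simp
  val := by simpa using H.first
  closed := by
    intro e he d hd hde c hc e' he' hed
    simp only [List.mem_singleton] at he he'
    subst he he'
    exact absurd (hde.trans hed) (h0 d hd hde)
  frontier := by
    intro b hb e he
    obtain ⟨e', he', d, hd, hde, -, c, hc, rfl⟩ := mem_primCandsL.1 hb
    obtain rfl := List.mem_singleton.1 he
    obtain rfl := List.mem_singleton.1 he'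
    exact (H.relax 0 e'.2 d hd (by rw [hde]; exact H.first) c hc).2

/-- The new label has the smallest time among all candidates and, by `frontier`, is not earlier than
any settled one. An edge from a settled node to the new one obeys `closed` since it was a candidate
itself; an edge back to a settled node obeys it since times do not decrease. -/
theorem PrimInv.step (H : PrimHyp relax D Val n e₀)
    (h0 : ∀ d ∈ D, d.1.1 ≠ d.1.2) (h : PrimInv relax D Val e₀ S) :
    PrimInv relax D Val e₀ (primStepL relax D S) ∧
      (primCandsL relax D S ≠ [] → (primStepL relax D S).length = S.length + 1) ∧
      (primCandsL relax D S = [] → primStepL relax D S = S) := by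
  rcases argminL_cases (primCandsL relax D S) with ⟨hc, hm⟩ | ⟨b, hb, hm, hle⟩
  · simp only [primStepL, hm]
    exact ⟨h, fun h' => absurd hc h', fun _ => trivial⟩
  · simp only [primStepL, hm]
    refine ⟨?_, fun _ => by simp, fun h' => absurd hb (by simp [h'])⟩
    obtain ⟨e, he, d, hd, hde, hn, c, hcr, hbe⟩ := mem_primCandsL.1 hb
    have hb2 : b.2 = (d.1.2, c) := by rw [hbe]
    have hb1 : b.1.1 = c.1 := by rw [hbe]
    have hfr : ∀ e' ∈ S, e'.2.1 ≤ c.1 := fun e' he' => hb1 ▸ h.frontier b hb e' he'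
    have hlen := h.length_pos
    have hnd : ((b.2 :: S).map Prod.fst).Nodup := by
      simp only [hb2, List.map_cons, List.nodup_cons, List.mem_map, not_exists, not_and]
      exact ⟨fun e' he' => hn e' he', h.nodup⟩
    have hvr := H.relax (S.length - 1) e.2 d hd (by rw [hde]; exact h.val e he) c hcr
    have hvc : Val S.length d.1.2 c := by
      have := hvr.1
      rwa [Nat.sub_add_cancel hlen] at this
    have hval : ∀ e' ∈ b.2 :: S, Val S.length e'.1 e'.2 := by
      intro e' he'
      rcases List.mem_cons.1 he' with rfl | he'
      · rw [hb2]; exact hvc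
      · have := H.mono _ _ _ (h.val e' he')
        rwa [Nat.sub_add_cancel hlen] at this
    refine ⟨List.mem_cons_of_mem _ h.first_mem, hnd, by simpa using hval, ?_, ?_⟩
    · intro e₁ he₁ d₁ hd₁ hde₁ c₁ hc₁ e₂ he₂ hed₂
      rcases List.mem_cons.1 he₁ with rfl | he₁
      · rcases List.mem_cons.1 he₂ with rfl | he₂
        · exact absurd (hde₁.trans hed₂) (h0 d₁ hd₁)
        · refine (hfr e₂ he₂).trans ?_
          rw [hb2] at hc₁ hde₁
          exact (H.relax _ c d₁ hd₁ (by rw [hde₁]; exact hvc) c₁ hc₁).2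
      · rcases List.mem_cons.1 he₂ with rfl | he₂
        · by_cases hx : ∀ e' ∈ S, e'.1 ≠ d₁.1.2
          · have hmem : ((c₁.1, 0), (d₁.1.2, c₁)) ∈ primCandsL relax D S :=
              mem_primCandsL.2 ⟨e₁, he₁, d₁, hd₁, hde₁, hx, c₁, hc₁, rfl⟩
            have := (hle _ hmem).fst_le
            rw [hb2]
            rwa [hb1] at this
          · push Not at hx
            obtain ⟨e', he', hx⟩ := hx
            rw [hb2] at hed₂
            exact absurd (hx.trans hed₂.symm) (hn e' he')
        · exact h.closed e₁ he₁ d₁ hd₁ hde₁ c₁ hc₁ e₂ he₂ hed₂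
    · intro b₁ hb₁ e₁ he₁
      obtain ⟨e₂, he₂, d₂, hd₂, hde₂, hn₂, c₂, hc₂, rfl⟩ := mem_primCandsL.1 hb₁
      have hcc : c.1 ≤ c₂.1 := by
        rcases List.mem_cons.1 he₂ with rfl | he₂
        · rw [hb2] at hc₂ hde₂
          exact (H.relax _ c d₂ hd₂ (by rw [hde₂]; exact hvc) c₂ hc₂).2
        · have hmem : ((c₂.1, 0), (d₂.1.2, c₂)) ∈ primCandsL relax D S :=
            mem_primCandsL.2 ⟨e₂, he₂, d₂, hd₂, hde₂,
              fun e' he' => hn₂ e' (List.mem_cons_of_mem _ he'), c₂, hc₂, rfl⟩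
          have := (hle _ hmem).fst_le
          rwa [hb1] at this
      rcases List.mem_cons.1 he₁ with rfl | he₁
      · rw [hb2]; exact hcc
      · exact (hfr e₁ he₁).trans hcc

theorem PrimInv.foldl (H : PrimHyp relax D Val n e₀) (h0 : ∀ d ∈ D, d.1.1 ≠ d.1.2)
    (rounds : List ℕ) (h : PrimInv relax D Val e₀ S) :
    PrimInv relax D Val e₀ (rounds.foldl (fun S _ => primStepL relax D S) S) ∧
      (S.length + rounds.length ≤
          (rounds.foldl (fun S _ => primStepL relax D S) S).length ∨
        primCandsL relax D (rounds.foldl (fun S _ => primStepL relax D S) S) = []) := by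
  induction rounds generalizing S with
  | nil => exact ⟨h, Or.inl le_rfl⟩
  | cons a l ih =>
    obtain ⟨h1, h2, h3⟩ := h.step H h0
    obtain ⟨h4, h5⟩ := ih h1
    refine ⟨h4, ?_⟩
    rw [List.foldl_cons, List.length_cons]
    by_cases hc : primCandsL relax D S = []
    · right
      have hfix : ∀ l : List ℕ, l.foldl (fun S _ => primStepL relax D S) S = S := by
        intro l
        induction l with
        | nil => rfl
        | cons a l ih => rw [List.foldl_cons, h3 hc, ih]
      rw [h3 hc, hfix, hc]
    · rw [h2 hc] at h5
      rcases h5 with h5 | h5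
      · left; omega
      · right; exact h5

/-- The result of the algorithm. -/
theorem primL_spec (H : PrimHyp relax D Val n e₀) (h0 : ∀ d ∈ D, d.1.1 ≠ d.1.2)
    {rounds : List ℕ} (hr : rounds.length = n) :
    PrimInv relax D Val e₀ (primL relax D rounds e₀) ∧
      ∀ e ∈ primL relax D rounds e₀, ∀ d ∈ D, d.1.1 = e.1 → ∀ c ∈ relax d e.2,
        ∃ e' ∈ primL relax D rounds e₀, e'.1 = d.1.2 ∧ e'.2.1 ≤ c.1 := by
  obtain ⟨h1, h2⟩ := (PrimInv.singleton H fun d hd _ => h0 d hd).foldl H h0 rounds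
  refine ⟨h1, fun e he d hd hde c hc => ?_⟩
  have h3 : primCandsL relax D (primL relax D rounds e₀) = [] := by
    rcases h2 with h2 | h2
    -- The initial entry and `n` successful rounds would settle `n + 1` distinct nodes.
    · have h4 := h1.length_le H
      rw [hr, List.length_singleton] at h2
      omega
    · exact h2
  by_cases hx : ∀ e' ∈ primL relax D rounds e₀, e'.1 ≠ d.1.2
  · have hmem : ((c.1, 0), (d.1.2, c)) ∈ primCandsL relax D (primL relax D rounds e₀) :=
      mem_primCandsL.2 ⟨e, he, d, hd, hde, hx, c, hc, rfl⟩
    simp [h3] at hmem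
  · push Not at hx
    obtain ⟨e', he', hx⟩ := hx
    exact ⟨e', he', hx, h1.closed e he d hd hde c hc e' he' hx⟩

end Prim

/-! ### Dijkstra's algorithm as a program -/

namespace Prog

variable {γ δ τ : Ty} {size : ℝ → ℕ} {N : ℕ}

@[reducible] def edgeTy : Ty := .prod (.prod .nat .nat) .real

@[reducible] def entryTy (τ : Ty) : Ty := .prod .nat (.prod .real τ)

def primCandsE (relax : Prog (.prod (.prod γ edgeTy) (.prod .real τ)) (.list (.prod .real τ))) :
    Prog (.prod (.prod γ (.list edgeTy)) (.list (entryTy τ)))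
      (.list (.prod (.prod .real .real) (entryTy τ))) :=
  collectE v0 (collectE v2
    (ite (natEqE (p1 (p1 v0)) (p1 v1))
      (ite (memE (p2 (p1 v0)) v2) nil
        (collectE (comp relax (pair (pair (up (up (up fst))) v0) (p2 v1)))
          (single (pair (pair (p1 v0) realZero) (pair (p2 (p1 v1)) v0)))))
      nil))

def primStepE (relax : Prog (.prod (.prod γ edgeTy) (.prod .real τ)) (.list (.prod .real τ))) :
    Prog (.prod (.prod γ (.list edgeTy)) (.list (entryTy τ))) (.list (entryTy τ)) :=
  caseE (argminE (primCandsE relax)) v0 (consE (p2 v1) v2)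

def primE (relax : Prog (.prod (.prod γ edgeTy) (.prod .real τ)) (.list (.prod .real τ)))
    (ctx : Prog δ γ) (D : Prog δ (.list edgeTy)) (rounds : Prog δ (.list .nat))
    (e : Prog δ (entryTy τ)) : Prog δ (.list (entryTy τ)) :=
  foldE rounds (single e) (comp (primStepE relax) (pair (pair (up (up ctx)) (up (up D))) v0))

theorem eval_primCandsE
    (relax : Prog (.prod (.prod γ edgeTy) (.prod .real τ)) (.list (.prod .real τ)))
    (x : γ.Val) (D : List EdgeData) (S : List (entryTy τ).Val) :
    (primCandsE relax).eval ((x, D), S) =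
      primCandsL (fun d c => relax.eval ((x, d), c)) D S := rfl

theorem eval_primStepE
    (relax : Prog (.prod (.prod γ edgeTy) (.prod .real τ)) (.list (.prod .real τ)))
    (x : γ.Val) (D : List EdgeData) (S : List (entryTy τ).Val) :
    (primStepE relax).eval ((x, D), S) =
      primStepL (fun d c => relax.eval ((x, d), c)) D S := by
  rw [primStepE, eval_caseE, eval_argminE, eval_primCandsE, primStepL]
  cases argminL (primCandsL (fun d c => relax.eval ((x, d), c)) D S) <;> rfl

theorem eval_primE
    (relax : Prog (.prod (.prod γ edgeTy) (.prod .real τ)) (.list (.prod .real τ)))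
    (ctx : Prog δ γ) (D : Prog δ (.list edgeTy)) (rounds : Prog δ (.list .nat))
    (e : Prog δ (entryTy τ)) (x : δ.Val) :
    (primE relax ctx D rounds e).eval x =
      primL (fun d c => relax.eval ((ctx.eval x, d), c)) (D.eval x) (rounds.eval x)
        (e.eval x) := by
  simp only [primE, eval_foldE, primL, eval_single]
  congr 1
  funext S a
  exact eval_primStepE relax _ _ _

/-- Each relaxation returns at most one label, so there are at most `n` times the number of edges
candidates. Only labels of level below `n` occur, hence the relaxation has to be checked for those
alone. -/
theorem good_primE
    {relax : Prog (.prod (.prod γ edgeTy) (.prod .real τ)) (.list (.prod .real τ))}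
    {ctx : Prog δ γ} {D : Prog δ (.list edgeTy)} {rounds : Prog δ (.list .nat)}
    {e : Prog δ (entryTy τ)} {x : δ.Val} {Val : ℕ → ℕ → ℝ × τ.Val → Prop} {n : ℕ}
    (H : PrimHyp (fun d c => relax.eval ((ctx.eval x, d), c)) (D.eval x) Val n (e.eval x))
    (h0 : ∀ d ∈ (D.eval x : List EdgeData), d.1.1 ≠ d.1.2)
    (hctx : ctx.Good size N x) (hD : D.Good size N x) (hr : rounds.Good size N x)
    (he : e.Good size N x) (hrN : (rounds.eval x).length ≤ N)
    (hDN : n * (D.eval x).length ≤ N) (hnN : n ≤ N) (hz : size 0 ≤ N)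
    (hrel : ∀ j < n, ∀ c, ∀ d ∈ (D.eval x : List EdgeData), Val j d.1.1 c →
      relax.Good size N ((ctx.eval x, d), c) ∧ (relax.eval ((ctx.eval x, d), c)).length ≤ 1 ∧
        ∀ c' ∈ (relax.eval ((ctx.eval x, d), c) : List (ℝ × τ.Val)), size c'.1 ≤ N) :
    (primE relax ctx D rounds e).Good size N x := by
  have hn1 : 1 ≤ n := by have := H.lt _ _ _ H.first; omega
  have hDN' : (D.eval x).length ≤ N := (Nat.le_mul_of_pos_left _ hn1).trans hDN
  simp only [primE, good_foldE, hr, hrN, good_single, he, true_and, good_comp', good_pair', good_up,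
    hctx, hD, good_v0, eval_pair', eval_up, eval_v0, eval_comp', eval_single]
  have hinv := PrimInv.singleton H fun d hd _ => h0 d hd
  refine LoopAll.of_inv (fun _ S => PrimInv (fun d c => relax.eval ((ctx.eval x, d), c))
    (D.eval x) Val (e.eval x) S) ?_ _ _ hinv
  intro a l S hS
  refine ⟨?_, ?_⟩
  swap
  · have := (hS.step H h0).1
    rw [← eval_primStepE] at this
    exact this
  have hSn := hS.length_le H
  have hSp := hS.length_pos
  have hev : ∀ e ∈ S, ∀ d ∈ (D.eval x : List EdgeData), d.1.1 = e.1 →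
      relax.Good size N ((ctx.eval x, d), e.2) ∧
        (relax.eval ((ctx.eval x, d), e.2)).length ≤ 1 ∧
        ∀ c' ∈ (relax.eval ((ctx.eval x, d), e.2) : List (ℝ × τ.Val)), size c'.1 ≤ N :=
    fun e he d hd hde => hrel (S.length - 1) (by omega) e.2 d hd (by rw [hde]; exact hS.val e he)
  have hlen1 : ∀ e ∈ S, ∀ d ∈ (D.eval x : List EdgeData), (if natEqB d.1.1 e.1 = true then
      if memL d.1.2 S = true then [] else
        collectL (fun c : ℝ × τ.Val => [((c.1, (0 : ℝ)), (d.1.2, c))])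
          (relax.eval ((ctx.eval x, d), e.2))
      else []).length ≤ 1 := by
    intro e he d hd
    split_ifs with h1 h2
    · simp
    · refine (length_collectL_le (m := 1) (fun _ _ => by simp)).trans ?_
      simpa using (hev e he d hd (natEqB_iff.1 h1)).2.1
    · simp
  have hcl : (primCandsL (fun d c => relax.eval ((ctx.eval x, d), c)) (D.eval x) S).length ≤ N := by
    refine (length_collectL_le (m := (D.eval x).length) fun e he => ?_).trans
      ((Nat.mul_le_mul_right _ hSn).trans hDN)
    refine (length_collectL_le (m := 1) fun d hd => hlen1 e he d hd).trans ?_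
    simp
  rw [primStepE, good_caseE]
  refine ⟨good_argminE ?_ ?_ ?_, ?_⟩
  · rw [primCandsE]
    refine good_collectE good_v0 (hSn.trans hnN) fun e he => ⟨?_, ?_⟩
    · refine good_collectE good_v2 hDN' fun d hd => ⟨?_, ?_⟩
      · rw [good_ite']
        refine ⟨by simp, ?_⟩
        split_ifs with h1
        · rw [good_ite']
          refine ⟨good_memE (by simp) (by simp) (hSn.trans hnN), ?_⟩
          split_ifs with h2
          · trivial
          · have h3 := hev e he d hd (natEqB_iff.1 h1)
            refine good_collectE (by simpa using h3.1) (by simpa using h3.2.1.trans (hn1.trans hnN))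
              fun c hc => ⟨by simpa using hz, by simpa using hn1.trans hnN⟩
        · trivial
      · exact (hlen1 e he d hd).trans (hn1.trans hnN)
    · refine (length_collectL_le (m := 1) fun d hd => hlen1 e he d hd).trans ?_
      simpa using hDN'
  · exact hcl
  · rw [eval_primCandsE]
    intro b hb
    obtain ⟨e, he, d, hd, hde, -, c, hc, rfl⟩ := mem_primCandsL.1 hb
    exact ⟨(hev e he d hd hde).2.2 c hc, hz⟩
  · cases (argminE (primCandsE relax)).eval ((ctx.eval x, D.eval x), S) <;> simp

end Prog

namespace Instance

variable {I : Instance}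

/-! ### Walks -/

theorem Seg.symm {a : Fin I.k} {p q : Loc I.n} (h : I.Seg a p q) : I.Seg a q p := by
  cases p <;> cases q
  · exact SimpleGraph.Subgraph.Adj.symm h
  · exact h
  · exact h
  · obtain ⟨h, rfl, rfl⟩ := h
    exact ⟨h, rfl, rfl⟩

theorem segLen_comm (p q : Loc I.n) : I.segLen p q = I.segLen q p := by
  cases p <;> cases q
  · simp only [segLen, Sym2.eq_swap]
  · rfl
  · rfl
  · simp only [segLen, abs_sub_comm]

theorem walkLen_append_cons (L₁ : List (Loc I.n)) (p : Loc I.n) (L₂ : List (Loc I.n)) :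
    I.walkLen (L₁ ++ p :: L₂) = I.walkLen (L₁ ++ [p]) + I.walkLen (p :: L₂) := by
  induction L₁ with
  | nil => simp [walkLen]
  | cons q L ih =>
    cases L with
    | nil => simp [walkLen]
    | cons r L =>
      simp only [List.cons_append, walkLen] at ih ⊢
      linarith

theorem walkLen_reverse (L : List (Loc I.n)) : I.walkLen L.reverse = I.walkLen L := by
  induction L with
  | nil => rfl
  | cons p L ih =>
    cases L with
    | nil => rfl
    | cons q L =>
      rw [List.reverse_cons, List.reverse_cons, List.append_assoc, List.singleton_append,
        walkLen_append_cons, ← List.reverse_cons, ih]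
      simp only [walkLen, segLen_comm p q]
      ring

theorem IsWalk.reverse {a : Fin I.k} {L : List (Loc I.n)} {p q : Loc I.n} (h : I.IsWalk a L p q) :
    I.IsWalk a L.reverse q p := by
  obtain ⟨h1, h2, h3, h4⟩ := h
  refine ⟨by simpa using h2, by simpa using h1, by simpa using h3, ?_⟩
  rw [List.isChain_reverse]
  exact h4.imp fun _ _ h => h.symm

/-- A list of data of locations describes a walk of the given length. -/
def RawWalk (I : Instance) (a : Fin I.k) (W : List (ℕ × (ℕ × ℝ))) (p q : Loc I.n) (l : ℝ) : Prop :=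
  ∃ L, W = L.map encodeLoc ∧ I.IsWalk a L p q ∧ I.walkLen L = l

theorem RawWalk.reverse {a : Fin I.k} {W : List (ℕ × (ℕ × ℝ))} {p q : Loc I.n} {l : ℝ}
    (h : I.RawWalk a W p q l) : I.RawWalk a W.reverse q p l := by
  obtain ⟨L, rfl, h, rfl⟩ := h
  exact ⟨L.reverse, by simp, h.reverse, walkLen_reverse L⟩

theorem RawWalk.singleton (a : Fin I.k) {p : Loc I.n} (h : I.IsLoc p) :
    I.RawWalk a [encodeLoc p] p p 0 :=
  ⟨[p], rfl, ⟨rfl, rfl, by simpa using h, List.isChain_singleton _⟩, rfl⟩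

theorem RawWalk.cons {a : Fin I.k} {W : List (ℕ × (ℕ × ℝ))} {p q r : Loc I.n} {l : ℝ}
    (h : I.RawWalk a W p q l) (hs : I.Seg a r p) (hr : I.IsLoc r) :
    I.RawWalk a (encodeLoc r :: W) r q (I.segLen r p + l) := by
  obtain ⟨L, rfl, ⟨h1, h2, h3, h4⟩, rfl⟩ := h
  cases L with
  | nil => simp at h1
  | cons p' L =>
    obtain rfl : p' = p := by simpa using h1
    refine ⟨r :: p' :: L, rfl, ⟨rfl, by simpa using h2, ?_, ?_⟩, rfl⟩
    · intro x hx
      rcases List.mem_cons.1 hx with rfl | hx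
      · exact hr
      · exact h3 x hx
    · exact List.isChain_cons_cons.2 ⟨hs, h4⟩

/-- The tail is taken because the common location `q` would otherwise occur twice. -/
theorem RawWalk.trans {a : Fin I.k} {W₁ W₂ : List (ℕ × (ℕ × ℝ))} {p q r : Loc I.n} {l₁ l₂ : ℝ}
    (h : I.RawWalk a W₁ p q l₁) (h' : I.RawWalk a W₂ q r l₂) :
    I.RawWalk a (W₁ ++ W₂.tail) p r (l₁ + l₂) := by
  obtain ⟨L, rfl, hL, rfl⟩ := h
  induction L generalizing p with
  | nil => exact absurd hL.1 (by simp)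
  | cons p' L ih =>
    obtain ⟨h1, h2, h3, h4⟩ := hL
    obtain rfl : p' = p := by simpa using h1
    cases L with
    | nil =>
      obtain rfl : p' = q := by simpa using h2
      obtain ⟨L', rfl, h5, rfl⟩ := h'
      cases L' with
      | nil => exact absurd h5.1 (by simp)
      | cons q' L' =>
        have h6 := h5.1
        obtain rfl : q' = p' := by simpa using h6
        exact ⟨q' :: L', by simp, h5, by simp [walkLen]⟩
    | cons p₂ L =>
      have h5 := List.isChain_cons_cons.1 h4
      have := (ih (p := p₂) ⟨rfl, by simpa using h2, fun x hx => h3 x (List.mem_cons_of_mem _ hx),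
        h5.2⟩).cons h5.1 (h3 p' (by simp))
      rw [← add_assoc] at this
      exact this

theorem segLen_nonneg {a : Fin I.k} {p q : Loc I.n} (hp : I.IsLoc p) (hq : I.IsLoc q)
    (h : I.Seg a p q) : 0 ≤ I.segLen p q := by
  cases p <;> cases q
  · exact I.len_nonneg _ (SimpleGraph.Subgraph.Adj.adj_sub h)
  · simp only [segLen]
    split_ifs
    · exact hq.2.2.1.le
    · linarith [hq.2.2.2]
  · simp only [segLen]
    split_ifs
    · exact hp.2.2.1.le
    · linarith [hp.2.2.2]
  · exact abs_nonneg _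

theorem RawWalk.nonneg {a : Fin I.k} {W : List (ℕ × (ℕ × ℝ))} {p q : Loc I.n} {l : ℝ}
    (h : I.RawWalk a W p q l) : 0 ≤ l := by
  obtain ⟨L, -, ⟨-, -, h3, h4⟩, rfl⟩ := h
  induction L with
  | nil => exact le_rfl
  | cons p' L ih =>
    cases L with
    | nil => exact le_rfl
    | cons p₂ L =>
      have h5 := List.isChain_cons_cons.1 h4
      have := ih (fun x hx => h3 x (List.mem_cons_of_mem _ hx)) h5.2
      have := segLen_nonneg (h3 p' (by simp)) (h3 p₂ (by simp)) h5.1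
      simp only [walkLen]
      linarith

/-! ### Routes -/

abbrev RawWalkData := List (ℕ × (ℕ × ℝ))

/-- An agent, whether it carries the package via its initial position, the (reversed) walk to the
pick-up location, and the (reversed) walk with the package. -/
abbrev RouteRec := ℕ × (Bool × (RawWalkData × RawWalkData))

/-- A route (the last trip first) that takes the package to a location, with different agents in
all trips, in comparison with an arrival time `T`. -/
inductive RouteInv (I : Instance) : List RouteRec → Loc I.n → ℝ → Prop
  | nil {T : ℝ} (h : 0 ≤ T) : RouteInv I [] (.node I.source) T
  | cons {R : List RouteRec} {w w' : Loc I.n} {T T' : ℝ} {a : Fin I.k} {s : Bool}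
      {B C : RawWalkData} {lB lC : ℝ} (h : RouteInv I R w T) (ha : ∀ r ∈ R, r.1 ≠ a)
      (hB : I.RawWalk a B w (.node (I.pos a)) lB) (hC : I.RawWalk a C w' w lC) (hT : T ≤ T')
      (hlB : lB / I.vel a ≤ T') (hplain : s = false → max T (lB / I.vel a) + lC / I.vel a ≤ T')
      (hshort : s = true → lC / I.vel a ≤ 2 * T') : RouteInv I ((a, (s, (B, C))) :: R) w' T'

theorem RouteInv.nonneg {R : List RouteRec} {w : Loc I.n} {T : ℝ} (h : RouteInv I R w T) :
    0 ≤ T := by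
  induction h with
  | nil h => exact h
  | cons _ _ _ _ hT _ _ _ ih => exact ih.trans hT

theorem RouteInv.mono {R : List RouteRec} {w : Loc I.n} {T T' : ℝ} (h : RouteInv I R w T)
    (hT : T ≤ T') : RouteInv I R w T' := by
  cases h with
  | nil h => exact .nil (h.trans hT)
  | cons h ha hB hC hT' hlB hp hs =>
    exact .cons h ha hB hC (hT'.trans hT) (hlB.trans hT) (fun e => (hp e).trans hT)
      (fun e => (hs e).trans (by linarith))

theorem RouteInv.nodup {R : List RouteRec} {w : Loc I.n} {T : ℝ} (h : RouteInv I R w T) :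
    (R.map Prod.fst).Nodup ∧ ∀ r ∈ R, r.1 < I.k := by
  induction h with
  | nil h => simp
  | @cons R w w' T T' a s B C lB lC h ha _ _ _ _ _ _ ih =>
    refine ⟨?_, ?_⟩
    · rw [List.map_cons, List.nodup_cons]
      refine ⟨fun hm => ?_, ih.1⟩
      obtain ⟨r, hr, he⟩ := List.mem_map.1 hm
      exact ha r hr he
    · intro r hr
      rcases List.mem_cons.1 hr with rfl | hr
      · exact a.2
      · exact ih.2 r hr

theorem RouteInv.length_le {R : List RouteRec} {w : Loc I.n} {T : ℝ} (h : RouteInv I R w T) :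
    R.length ≤ I.k := by
  have h1 : R.map Prod.fst ⊆ List.range I.k := by
    intro u hu
    obtain ⟨e, he, rfl⟩ := List.mem_map.1 hu
    exact List.mem_range.2 (h.nodup.2 e he)
  simpa using (h.nodup.1.subperm h1).length_le

/-- This is what survives when a route is cut at an agent's old trip for a shortcut: the route
before that trip, and the walk between the old pick-up location and the agent's initial position. -/
theorem RouteInv.suffix {Q R₀ : List RouteRec} {r : RouteRec} {w : Loc I.n} {T : ℝ}
    (h : RouteInv I (Q ++ r :: R₀) w T) :
    ∃ w₀ T₀, ∃ a : Fin I.k, ∃ lB, RouteInv I R₀ w₀ T₀ ∧ T₀ ≤ T ∧ r.1 = a ∧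
      I.RawWalk a r.2.2.1 w₀ (.node (I.pos a)) lB ∧ lB / I.vel a ≤ T ∧ ∀ r' ∈ R₀, r'.1 ≠ a := by
  induction Q generalizing w T with
  | nil =>
    cases h with
    | cons h ha hB hC hT hlB hp hs => exact ⟨_, _, _, _, h, hT, rfl, hB, hlB, ha⟩
  | cons q Q ih =>
    cases h with
    | cons h ha hB hC hT hlB hp hs =>
      obtain ⟨w₀, T₀, a, lB, h1, h2, h3, h4, h5, h6⟩ := ih h
      exact ⟨w₀, T₀, a, lB, h1, h2.trans hT, h3, h4, h5.trans hT, h6⟩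

/-- The number of trips via the initial position of the agent. -/
def shortcuts (R : List RouteRec) : ℕ := R.countP (fun r => r.2.1)

def routeTrips (R : List RouteRec) : outputTy.Val :=
  R.foldl (fun s r => (r.1, ((0 : ℝ), (r.2.2.1.reverse, r.2.2.2.reverse))) :: s) []

theorem routeTrips_eq (R : List RouteRec) : routeTrips R =
    (R.map (fun r => (r.1, ((0 : ℝ), (r.2.2.1.reverse, r.2.2.2.reverse))))).reverse := by
  have : ∀ s : List (ℕ × (ℝ × (RawWalkData × RawWalkData))),
      R.foldl (fun s r => (r.1, ((0 : ℝ), (r.2.2.1.reverse, r.2.2.2.reverse))) :: s) s =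
      (R.map (fun r => (r.1, ((0 : ℝ), (r.2.2.1.reverse, r.2.2.2.reverse))))).reverse ++ s := by
    induction R with
    | nil => simp
    | cons r R ih => intro s; rw [List.foldl_cons, ih]; simp
  rw [routeTrips]
  exact (this []).trans (List.append_nil _)

theorem routeTrips_cons (r : RouteRec) (R : List RouteRec) : routeTrips (r :: R) =
    routeTrips R ++ [(r.1, ((0 : ℝ), (r.2.2.1.reverse, r.2.2.2.reverse)))] := by
  simp [routeTrips_eq]

/-- A route gives rise to a feasible schedule. -/
theorem RouteInv.exists_schedule {R : List RouteRec} {w : Loc I.n} {T : ℝ} (h : RouteInv I R w T) :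
    ∃ (S : Schedule I.n I.k) (loc : Fin I.k → Loc I.n) (free : Fin I.k → ℝ),
      routeTrips R = encodeSchedule S ∧
      (∀ a : Fin I.k, (∀ r ∈ R, r.1 ≠ a) → loc a = .node (I.pos a) ∧ free a = 0) ∧
      (∀ S', I.FeasibleFrom loc free w (S.foldl I.arrival 0) S' →
        I.FeasibleFrom (fun a => .node (I.pos a)) (fun _ => 0) (.node I.source) 0 (S ++ S')) ∧
      S.foldl I.arrival 0 ≤ (1 + 2 * shortcuts R) * T := by
  induction h with
  | nil h =>
    refine ⟨[], fun a => .node (I.pos a), fun _ => 0, rfl, by simp, fun S' h => h, ?_⟩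
    simpa [shortcuts] using h
  | @cons R w w' T T' a s B C lB lC h ha hB hC hT hlB hp hs ih =>
    obtain ⟨S, loc, free, h1, h2, h3, h4⟩ := ih
    obtain ⟨LB, hLB, hwB, hlenB⟩ := hB.reverse
    obtain ⟨LC, hLC, hwC, hlenC⟩ := hC.reverse
    -- The agent has made no earlier trip, so it still waits at its initial position and may set out
    -- at time 0.
    obtain ⟨hla, hfa⟩ := h2 a ha
    set t : Trip I.n I.k := ⟨a, 0, LB, LC⟩ with ht
    have hT0 : 0 ≤ T := h.nonneg
    refine ⟨S ++ [t], Function.update loc a w',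
      Function.update free a (I.arrival (S.foldl I.arrival 0) t), ?_, ?_, ?_, ?_⟩
    · rw [routeTrips_cons, h1]
      simp [encodeSchedule, ht, hLB, hLC]
    · intro b hb
      have hba : b ≠ a := fun e => hb _ (List.mem_cons_self) (by rw [e])
      have := h2 b fun r hr => hb r (List.mem_cons_of_mem _ hr)
      simp [hba, this]
    · intro S' hS'
      rw [List.append_assoc]
      refine h3 _ ⟨by simp [ht, hfa], by simpa [ht, hla] using hwB, w', hwC, ?_⟩
      simpa using hS'
    · rw [List.foldl_append, List.foldl_cons, List.foldl_nil, arrival]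
      simp only [ht, hlenB, hlenC, zero_add]
      have hc : (0 : ℝ) ≤ shortcuts R := Nat.cast_nonneg _
      cases s with
      | false =>
        have e : shortcuts ((↑a, (false, (B, C))) :: R) = shortcuts R := by simp [shortcuts]
        rw [e]
        have hp := hp rfl
        have hlC : 0 ≤ lC / I.vel a := div_nonneg hC.nonneg (I.vel_pos a).le
        -- On a plain trip the factor stays the same: the time of the pick-up grows by it at most,
        -- and the carrying time is already included in the unscaled bound `hp`.
        have h5 : max (S.foldl I.arrival 0) (lB / I.vel a) ≤
            (1 + 2 * shortcuts R) * max T (lB / I.vel a) := by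
          have : 0 ≤ max T (lB / I.vel a) := hT0.trans (le_max_left _ _)
          refine max_le (h4.trans (by gcongr; exact le_max_left _ _)) ?_
          nlinarith [le_max_right T (lB / I.vel a)]
        nlinarith
      | true =>
        have e : shortcuts ((↑a, (true, (B, C))) :: R) = shortcuts R + 1 := by simp [shortcuts]
        rw [e]
        have hs := hs rfl
        -- On a shortcut the pick-up happens by `(1 + 2 * c) * T'`, and the carrying adds at most `2
        -- * T'`.
        have h5 : max (S.foldl I.arrival 0) (lB / I.vel a) ≤ (1 + 2 * shortcuts R) * T' := by
          refine max_le (h4.trans (by gcongr)) ?_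
          nlinarith
        push_cast
        nlinarith

/-! ### The lower bound -/

/-- A potential argument: `r` bounds from below when an agent can be at a location, `F` when the
package can. Both bounds survive every segment of a walk. The carrying agent needs both of them, as
it travels with the package and may be used again later. -/
theorem lower_bound (r : Fin I.k → Loc I.n → ℝ) (F : Loc I.n → ℝ)
    (hr0 : ∀ a, r a (.node (I.pos a)) ≤ 0) (hF0 : F (.node I.source) ≤ 0)
    (hr : ∀ a p q, I.IsLoc p → I.IsLoc q → I.Seg a p q → r a q ≤ r a p + I.segLen p q / I.vel a)
    (hF : ∀ a p q, I.IsLoc p → I.IsLoc q → I.Seg a p q → ∀ t, F p ≤ t → r a p ≤ t →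
      F q ≤ t + I.segLen p q / I.vel a)
    {S : Schedule I.n I.k} (hS : I.Feasible S) : F (.node I.target) ≤ I.deliveryTime S := by
  have hwr : ∀ a L p q, I.IsWalk a L p q → ∀ t, r a p ≤ t → r a q ≤ t + I.walkLen L / I.vel a ∧
      (F p ≤ t → F q ≤ t + I.walkLen L / I.vel a) := by
    intro a L
    induction L with
    | nil => intro p q h; exact absurd h.1 (by simp)
    | cons p' L ih =>
      rintro p q ⟨h1, h2, h3, h4⟩ t ht
      obtain rfl : p' = p := by simpa using h1
      cases L with
      | nil =>
        obtain rfl : p' = q := by simpa using h2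
        simpa [walkLen] using ht
      | cons p₂ L =>
        have h5 := List.isChain_cons_cons.1 h4
        have l1 := h3 p' (by simp)
        have l2 := h3 p₂ (by simp)
        have e1 := hr a p' p₂ l1 l2 h5.1
        have e2 := ih p₂ q ⟨rfl, by simpa using h2, fun x hx => h3 x (List.mem_cons_of_mem _ hx),
          h5.2⟩ (t + I.segLen p' p₂ / I.vel a) (by linarith)
        simp only [walkLen, add_div, ← add_assoc]
        exact ⟨e2.1, fun h => e2.2 (hF a p' p₂ l1 l2 h5.1 t h ht)⟩
  have main : ∀ (S : Schedule I.n I.k) (loc : Fin I.k → Loc I.n) (free : Fin I.k → ℝ) (p : Loc I.n)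
      (T : ℝ), (∀ a, r a (loc a) ≤ free a) → F p ≤ T → I.FeasibleFrom loc free p T S →
      F (.node I.target) ≤ S.foldl I.arrival T := by
    intro S
    induction S with
    | nil =>
      intro loc free p T _ hp h
      obtain rfl : p = .node I.target := h
      exact hp
    | cons S L ih =>
      rintro loc free p T hloc hp ⟨h1, h2, q, h3, h4⟩
      have e1 := (hwr _ _ _ _ h2 S.start ((hloc _).trans h1)).1
      have e2 := hwr _ _ _ _ h3 (max T (S.start + I.walkLen S.empty / I.vel S.agent))
        (e1.trans (le_max_right _ _))
      refine ih _ _ q _ (fun a => ?_) (e2.2 (hp.trans (le_max_left _ _))) h4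
      by_cases ha : a = S.agent
      · subst ha
        simpa [arrival] using e2.1
      · simpa [ha] using hloc a
  exact main S _ _ _ _ hr0 hF0 hS

/-- The earliest time at which an agent can be at a location, if it can be at the nodes at the times
`ρ`. -/
noncomputable def reach (I : Instance) (ρ : Fin I.k → Fin I.n → ℝ) (a : Fin I.k) : Loc I.n → ℝ
  | .node u => ρ a u
  | .inner u v x => min (ρ a u + x / I.vel a) (ρ a v + (I.len s(u, v) - x) / I.vel a)

/-- The earliest times `τ` of the package on its way from `u` to `v` along an edge, as a function of
the distance from `u`. -/
structure IsTraj (I : Instance) (ρ : Fin I.k → Fin I.n → ℝ) (T : Fin I.n → ℝ) (u v : Fin I.n)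
    (τ : ℝ → ℝ) : Prop where
  enter : ∀ a, (I.range a).Adj u v → ∀ t x, T u ≤ t → ρ a u ≤ t → 0 ≤ x → x ≤ I.len s(u, v) →
    τ x ≤ t + x / I.vel a
  le_zero : T u ≤ τ 0
  mono : ∀ x x', 0 ≤ x → x ≤ x' → x' ≤ I.len s(u, v) → τ x ≤ τ x'
  carry : ∀ a, (I.range a).Adj u v → ∀ x x' t, 0 ≤ x → x ≤ x' → x' ≤ I.len s(u, v) → τ x ≤ t →
    min (ρ a u + x / I.vel a) (ρ a v + (I.len s(u, v) - x) / I.vel a) ≤ t →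
    τ x' ≤ t + (x' - x) / I.vel a
  leave : T v ≤ τ (I.len s(u, v))

/-- At an interior point the potential is the smaller of the trajectories from the two ends of the
edge. Movement in the direction of a trajectory is controlled by `carry`; movement against it gains
nothing, as trajectories are nondecreasing and start no earlier than the package is at their first
node. -/
theorem le_deliveryTime (ρ : Fin I.k → Fin I.n → ℝ) (T : Fin I.n → ℝ)
    (hρ0 : ∀ a, ρ a (I.pos a) ≤ 0)
    (hρ : ∀ a u v, (I.range a).Adj u v → ρ a v ≤ ρ a u + I.len s(u, v) / I.vel a)
    (hT0 : T I.source ≤ 0) (hT : ∀ u v, I.G.Adj u v → ∃ τ, IsTraj I ρ T u v τ)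
    {S : Schedule I.n I.k} (hS : I.Feasible S) : T I.target ≤ I.deliveryTime S := by
  classical
  choose! τ hτ using hT
  have hadj : ∀ {a u v}, (I.range a).Adj u v → IsTraj I ρ T u v (τ u v) :=
    fun h => hτ _ _ (h.adj_sub)
  have hsw : ∀ u v : Fin I.n, I.len s(v, u) = I.len s(u, v) := fun u v => by rw [Sym2.eq_swap]
  refine lower_bound (reach I ρ) (fun p => match p with
    | .node u => T u
    | .inner u v x => min (τ u v x) (τ v u (I.len s(u, v) - x))) hρ0 hT0 ?_ ?_ hS
  · intro a p q hp hq hs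
    have hv := I.vel_pos a
    cases p with
    | node u =>
      cases q with
      | node v => exact hρ a u v hs
      | inner u' v' x =>
        obtain ⟨hs, rfl | rfl⟩ := hs
        · simp [reach, segLen]
        · have : u ≠ u' := hq.1.ne'
          simp [reach, segLen, this]
    | inner u' v' x =>
      have hx := hp.2.2
      cases q with
      | node u =>
        obtain ⟨hs, rfl | rfl⟩ := hs
        · simp only [reach, segLen, if_true]
          have h1 := hρ a v' u hs.symm
          rw [hsw] at h1
          rw [← sub_le_iff_le_add]
          have : 0 < x / I.vel a := by have := hx.1; positivity
          refine le_min (by linarith) ?_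
          rw [sub_div]
          linarith
        · have : u ≠ u' := hp.1.ne'
          simp only [reach, segLen, if_neg this]
          have h1 := hρ a u' u hs
          rw [← sub_le_iff_le_add]
          have : 0 < (I.len s(u', u) - x) / I.vel a := by
            have : 0 < I.len s(u', u) - x := by linarith [hx.2]
            positivity
          refine le_min ?_ (by linarith)
          rw [sub_div]
          linarith
      | inner u v x' =>
        obtain ⟨hs, rfl, rfl⟩ := hs
        simp only [reach, segLen]
        have h1 : x' / I.vel a ≤ x / I.vel a + |x - x'| / I.vel a := by
          rw [← add_div]
          gcongr
          linarith [neg_abs_le (x - x')]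
        have h2 : (I.len s(u, v) - x') / I.vel a ≤
            (I.len s(u, v) - x) / I.vel a + |x - x'| / I.vel a := by
          rw [← add_div]
          gcongr
          linarith [le_abs_self (x - x')]
        rw [← sub_le_iff_le_add]
        refine le_min ?_ ?_
        · linarith [min_le_left (ρ a u + x' / I.vel a)
            (ρ a v + (I.len s(u, v) - x') / I.vel a)]
        · linarith [min_le_right (ρ a u + x' / I.vel a)
            (ρ a v + (I.len s(u, v) - x') / I.vel a)]
  · intro a p q hp hq hs t ht hrt
    have hv := I.vel_pos a
    cases p with
    | node u =>
      cases q with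
      | node v =>
        have h := hadj hs
        exact h.leave.trans (h.enter a hs t _ ht hrt (I.len_nonneg _ hs.adj_sub) le_rfl)
      | inner u' v' x =>
        have hx := hq.2.2
        obtain ⟨hs, rfl | rfl⟩ := hs
        · simp only [segLen, if_true]
          exact min_le_of_left_le ((hadj hs).enter a hs t _ ht hrt hx.1.le hx.2.le)
        · have : u ≠ u' := hq.1.ne'
          simp only [segLen, if_neg this]
          exact min_le_of_right_le ((hadj hs.symm).enter a hs.symm t _ ht hrt (by linarith [hx.2])
            (by rw [hsw]; linarith [hx.1]))
    | inner u' v' x =>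
      have hx := hp.2.2
      cases q with
      | node u =>
        obtain ⟨hs, rfl | rfl⟩ := hs
        · simp only [segLen, if_true]
          have h1 := hadj hs
          have h2 := hadj hs.symm
          have hxv : 0 < x / I.vel a := by have := hx.1; positivity
          rcases min_le_iff.1 ht with ht | ht
          -- The package entered from `u` and is only brought back to `u`.
          · linarith [h1.le_zero, h1.mono 0 x le_rfl hx.1.le hx.2.le]
          · have h3 := h2.carry a hs.symm (I.len s(u, v') - x) (I.len s(u, v')) t
              (by linarith [hx.2]) (by linarith [hx.1]) (by rw [hsw]) ht ?_
            · have h4 := h2.leave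
              rw [hsw] at h4
              rw [sub_sub_cancel] at h3
              exact h4.trans h3
            · rw [hsw u v', min_comm, sub_sub_cancel]
              exact hrt
        · have hne : u ≠ u' := hp.1.ne'
          simp only [segLen, if_neg hne]
          have h1 := hadj hs
          have h2 := hadj hs.symm
          have hxv : 0 < (I.len s(u', u) - x) / I.vel a := by
            have : 0 < I.len s(u', u) - x := by linarith [hx.2]
            positivity
          rcases min_le_iff.1 ht with ht | ht
          · exact h1.leave.trans (h1.carry a hs x _ t hx.1.le hx.2.le le_rfl ht hrt)
          · linarith [h2.le_zero, h2.mono 0 (I.len s(u', u) - x) le_rfl (by linarith [hx.2])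
              (by rw [hsw]; linarith [hx.1])]
      | inner u v x' =>
        obtain ⟨hs, rfl, rfl⟩ := hs
        have hx' := hq.2.2
        have h1 := hadj hs
        have h2 := hadj hs.symm
        have hab : 0 ≤ |x - x'| / I.vel a := by positivity
        simp only [segLen]
        rcases min_le_iff.1 ht with ht | ht
        · refine min_le_of_left_le ?_
          rcases le_total x x' with hxx | hxx
          · rw [abs_sub_comm, abs_of_nonneg (by linarith)]
            exact h1.carry a hs x x' t hx.1.le hxx hx'.2.le ht hrt
          · linarith [h1.mono x' x hx'.1.le hxx hx.2.le]
        · refine min_le_of_right_le ?_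
          rcases le_total x x' with hxx | hxx
          · linarith [h2.mono (I.len s(u, v) - x') (I.len s(u, v) - x) (by linarith [hx'.2])
              (by linarith) (by rw [hsw]; linarith [hx.1])]
          · rw [abs_of_nonneg (by linarith)]
            have h3 := h2.carry a hs.symm (I.len s(u, v) - x) (I.len s(u, v) - x') t
              (by linarith [hx.2]) (by linarith) (by rw [hsw]; linarith [hx'.1]) ht ?_
            · rwa [sub_sub_sub_cancel_left] at h3
            · rw [hsw u v, min_comm, sub_sub_cancel]
              exact hrt

end Instance

namespace Instance

variable {I : Instance}

/-! ### Extension of a route -/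

abbrev LegData := ℕ × ((((ℕ × (ℕ × ℝ)) × RawWalkData)) × ((ℕ × (ℕ × ℝ)) × RawWalkData))

/-- The route up to the pick-up of the package by agent `a`, who then carries the package via its
initial position to the start of the walk `b` (in reversed order). -/
def cutL (a : ℕ) (b : RawWalkData) (R : List RouteRec) : List RouteRec :=
  R.foldl (fun s r =>
    match s with
    | [] => if natEqB r.1 a = true then [(a, (true, (r.2.2.1, b ++ r.2.2.1.reverse.tail)))]
        else []
    | _ :: _ => r :: s) []

/-- Walks are stored backwards, so the end of the leg precedes its start. -/
def plainRec (g : LegData) : RouteRec := (g.1, (false, (g.2.1.2, [g.2.2.1, g.2.1.1])))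

/-- Extension of a route by the leg `g` of an agent, given by the start, the end, and walks from
there to the initial position of the agent. -/
def pushL (R : List RouteRec) (g : LegData) : List RouteRec :=
  match R with
  | [] => [plainRec g]
  | r :: R' =>
    if natEqB r.1 g.1 = true then (r.1, (r.2.1, (r.2.2.1, g.2.2.1 :: r.2.2.2))) :: R'
    else
      match (cutL g.1 g.2.2.2 R').reverse with
      | [] => plainRec g :: R
      | r' :: R'' => r' :: R''

theorem cutL_cases (a : ℕ) (b : RawWalkData) (R : List RouteRec) :
    ((∀ r ∈ R, r.1 ≠ a) ∧ cutL a b R = []) ∨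
      ∃ Q r R₀, R = Q ++ r :: R₀ ∧ r.1 = a ∧
        (cutL a b R).reverse = (a, (true, (r.2.2.1, b ++ r.2.2.1.reverse.tail))) :: R₀ := by
  have this : ∀ (R : List RouteRec) (x : RouteRec) (s : List RouteRec), R.foldl (fun s r =>
      match s with
      | [] => if natEqB r.1 a = true then
          [(a, (true, (r.2.2.1, b ++ r.2.2.1.reverse.tail)))] else []
      | _ :: _ => r :: s) (x :: s) = R.reverse ++ x :: s := by
    intro R
    induction R with
    | nil => simp
    | cons y R ih =>
      intro x s
      rw [List.foldl_cons, List.reverse_cons, List.append_assoc]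
      exact ih y (x :: s)
  induction R with
  | nil => left; simp [cutL]
  | cons r R ih =>
    by_cases h : r.1 = a
    · right
      refine ⟨[], r, R, rfl, h, ?_⟩
      rw [cutL, List.foldl_cons]
      simp only [natEqB_iff.2 h, if_true]
      rw [this]
      simp
    · have e : cutL a b (r :: R) = cutL a b R := by
        rw [cutL, List.foldl_cons]
        simp [h, cutL]
      rw [e]
      rcases ih with ⟨h1, h2⟩ | ⟨Q, r', R₀, h1, h2, h3⟩
      · left
        exact ⟨by simpa [h] using h1, h2⟩
      · right
        exact ⟨r :: Q, r', R₀, by simp [h1], h2, h3⟩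

/-- The cases depend on the agent's old trip: none, the last one, or an earlier one. In the third
case at least one trip `q` of another agent lies after it and gets lost; this is the source of the
bound `k - 1`. -/
theorem pushL_cases (R : List RouteRec) (g : LegData) :
    ((∀ r ∈ R, r.1 ≠ g.1) ∧ pushL R g = plainRec g :: R) ∨
    (∃ r R₀, R = r :: R₀ ∧ r.1 = g.1 ∧
      pushL R g = (r.1, (r.2.1, (r.2.2.1, g.2.2.1 :: r.2.2.2))) :: R₀) ∨
    ∃ q Q r R₀, R = q :: Q ++ r :: R₀ ∧ r.1 = g.1 ∧ q.1 ≠ g.1 ∧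
      pushL R g = (g.1, (true, (r.2.2.1, g.2.2.2 ++ r.2.2.1.reverse.tail))) :: R₀ := by
  cases R with
  | nil => left; simp [pushL]
  | cons q R =>
    by_cases h : q.1 = g.1
    · right; left
      exact ⟨q, R, rfl, h, by simp [pushL, h]⟩
    · rcases cutL_cases g.1 g.2.2.2 R with ⟨h1, h2⟩ | ⟨Q, r, R₀, h1, h2, h3⟩
      · left
        exact ⟨by simpa [h] using h1, by simp [pushL, h, h2]⟩
      · right; right
        exact ⟨q, Q, r, R₀, by simp [h1], h2, h, by simp [pushL, h, h3]⟩

/-- Bounds for the lengths of the walks of a route. -/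
def RouteBd (b c : ℕ) (R : List RouteRec) : Prop :=
  ∀ r ∈ R, r.2.2.1.length ≤ b ∧ r.2.2.2.length ≤ c

/-- At most `j` trips of a route go via the initial position of the agent, apart from one exception
among the most recent trips, which are trips of agents in `X`. -/
def RouteShape (X : ℕ → Prop) (j : ℕ) (R : List RouteRec) : Prop :=
  ∃ R₁ R₀, R = R₁ ++ R₀ ∧ shortcuts R₁ ≤ 1 ∧ shortcuts R₀ ≤ j ∧ ∀ r ∈ R₁, X r.1

theorem shortcuts_cons (r : RouteRec) (R : List RouteRec) :
    shortcuts (r :: R) = shortcuts R + if r.2.1 = true then 1 else 0 := by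
  simp [shortcuts, List.countP_cons]

theorem shortcuts_append (R R' : List RouteRec) :
    shortcuts (R ++ R') = shortcuts R + shortcuts R' := by
  simp [shortcuts]

theorem RouteShape.of_le {X : ℕ → Prop} {j : ℕ} {R : List RouteRec} (h : shortcuts R ≤ j) :
    RouteShape X j R :=
  ⟨[], R, rfl, by simp [shortcuts], h, by simp⟩

theorem RouteShape.shortcuts_le {X : ℕ → Prop} {j : ℕ} {R : List RouteRec} (h : RouteShape X j R) :
    shortcuts R ≤ j + 1 := by
  obtain ⟨R₁, R₀, rfl, h1, h2, -⟩ := h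
  rw [shortcuts_append]
  omega

theorem RouteShape.imp {X Y : ℕ → Prop} {j : ℕ} {R : List RouteRec} (h : RouteShape X j R)
    (hXY : ∀ a, X a → Y a) : RouteShape Y j R := by
  obtain ⟨R₁, R₀, h1, h2, h3, h4⟩ := h
  exact ⟨R₁, R₀, h1, h2, h3, fun r hr => hXY _ (h4 r hr)⟩

/-- An agent outside `X` has no trip in `R₁`. If it makes a shortcut, its old trip lies in `R₀`, so
that all of `R₁` is dropped together with the one shortcut allowed there, and the new shortcut takes
its place. -/
theorem RouteShape.push {X : ℕ → Prop} {j : ℕ} {R : List RouteRec} (h : RouteShape X j R)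
    {g : LegData} (hg : ¬ X g.1) : RouteShape (fun a => X a ∨ a = g.1) j (pushL R g) := by
  obtain ⟨R₁, R₀, hR, h1, h2, h3⟩ := h
  rcases pushL_cases R g with ⟨-, e⟩ | ⟨r, R', hR', hr, e⟩ | ⟨q, Q, r, R', hR', hr, -, e⟩
  · refine ⟨plainRec g :: R₁, R₀, by rw [e, hR]; rfl, ?_, h2, ?_⟩
    · rw [shortcuts_cons]
      simpa [plainRec] using h1
    · intro r hr
      rcases List.mem_cons.1 hr with rfl | hr
      · right; rfl
      · left; exact h3 r hr
  · cases R₁ with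
    | nil =>
      refine .of_le ?_
      rw [e]
      rw [List.nil_append] at hR
      rw [← hR, hR', shortcuts_cons] at h2
      rw [shortcuts_cons]
      exact h2
    | cons r₁ R₁ =>
      rw [hR', List.cons_append, List.cons.injEq] at hR
      have := h3 r₁ (by simp)
      rw [← hR.1, hr] at this
      exact absurd this hg
  · refine ⟨[(g.1, (true, (r.2.2.1, g.2.2.2 ++ r.2.2.1.reverse.tail)))], R', by rw [e]; rfl,
      by simp [shortcuts], ?_, by simp⟩
    rw [hR, List.append_eq_append_iff] at hR'
    have hsuf : ∃ Z, R₀ = Z ++ R' := by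
      rcases hR' with ⟨Z, h4, h5⟩ | ⟨Z, h4, h5⟩
      · exact ⟨Z ++ [r], by simp [h5]⟩
      · cases Z with
        | nil => exact ⟨[r], by simpa using h5.symm⟩
        | cons z Z =>
          rw [List.cons_append, List.cons.injEq] at h5
          have h6 := h3 z (by simp [h4])
          rw [← h5.1, hr] at h6
          exact absurd h6 hg
    obtain ⟨Z, rfl⟩ := hsuf
    rw [shortcuts_append] at h2
    omega

/-- A carrying walk grows by one location, or is new with two locations, or is a shortcut made of
two walks of length at most `b`; the last case is why `2 * b ≤ c` is needed. -/
theorem RouteBd.push {b c : ℕ} {R : List RouteRec} (h : RouteBd b c R) {g : LegData}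
    (h1 : g.2.1.2.length ≤ b) (h2 : g.2.2.2.length ≤ b) (hb : 2 * b ≤ c) (hc : 1 ≤ c) :
    RouteBd b (c + 1) (pushL R g) := by
  have hw : ∀ r ∈ R, r.2.2.1.length ≤ b ∧ r.2.2.2.length ≤ c + 1 :=
    fun r hr => ⟨(h r hr).1, (h r hr).2.trans (Nat.le_succ c)⟩
  rcases pushL_cases R g with ⟨-, e⟩ | ⟨r, R', hR', hr, e⟩ | ⟨q, Q, r, R', hR', hr, -, e⟩
  · rw [e]
    intro r hr
    rcases List.mem_cons.1 hr with rfl | hr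
    · simp only [plainRec, List.length_cons, List.length_nil]
      omega
    · exact hw r hr
  · rw [e]
    intro r' hr'
    rcases List.mem_cons.1 hr' with rfl | hr'
    · have := h r (by simp [hR'])
      simp only [List.length_cons]
      omega
    · exact hw r' (by simp [hR', hr'])
  · rw [e]
    intro r' hr'
    rcases List.mem_cons.1 hr' with rfl | hr'
    · have := h r (by simp [hR'])
      simp only [List.length_append, List.length_tail, List.length_reverse]
      omega
    · exact hw r' (by simp [hR', hr'])

/-- The agent reaches the start of the leg by `T`, hence a new trip involves no waiting in the
relaxed time, and an extended trip gets longer by just the leg. For a shortcut, the walks from the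
initial position to the old pick-up location and to the new location each take at most `T'`,
together `2 * T'`. -/
theorem RouteInv.push {R : List RouteRec} {w w' : Loc I.n} {T T' : ℝ} (h : RouteInv I R w T)
    {a : Fin I.k} {b b' : RawWalkData} {l l' : ℝ} (hb : I.RawWalk a b w (.node (I.pos a)) l)
    (hb' : I.RawWalk a b' w' (.node (I.pos a)) l') (hl : l / I.vel a ≤ T)
    (hs : I.Seg a w' w) (hw : I.IsLoc w) (hw' : I.IsLoc w')
    (hT' : T + I.segLen w' w / I.vel a ≤ T') (hl' : l' / I.vel a ≤ T') :
    RouteInv I (pushL R (a, ((encodeLoc w, b), (encodeLoc w', b')))) w' T' ∧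
      (shortcuts R ≤ I.k - 1 →
        shortcuts (pushL R (a, ((encodeLoc w, b), (encodeLoc w', b')))) ≤ I.k - 1) := by
  have hv := I.vel_pos a
  have hseg : 0 ≤ I.segLen w' w / I.vel a := div_nonneg (segLen_nonneg hw' hw hs) hv.le
  have hTT : T ≤ T' := by linarith
  rcases pushL_cases R (↑a, ((encodeLoc w, b), (encodeLoc w', b'))) with
    ⟨hn, e⟩ | ⟨r, R', hR', hr, e⟩ | ⟨q, Q, r, R', hR', hr, -, e⟩
  · rw [e]
    refine ⟨.cons h hn hb ((RawWalk.singleton a hw).cons hs hw') hTT (hl.trans hTT) ?_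
      (fun h => by cases h), fun hk => by simpa [shortcuts_cons, plainRec] using hk⟩
    intro _
    rw [max_eq_left hl, add_zero]
    exact hT'
  · subst hR'
    rw [e]
    cases h with
    | @cons _ w₀ _ T₀ _ a' s B C lB lC h ha hB hC hT hlB hp hsh =>
      obtain rfl : a' = a := Fin.ext hr
      refine ⟨.cons h ha hB (hC.cons hs hw') (hT.trans hTT) (hlB.trans hTT) (fun hf => ?_)
        (fun hf => ?_), fun hk => by simpa [shortcuts_cons] using hk⟩
      · have := hp hf
        rw [add_div]
        linarith
      · have := hsh hf
        rw [add_div]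
        linarith
  · have hlen := h.length_le
    rw [hR'] at h
    obtain ⟨w₀, T₀, a', lB, h1, h2, h3, h4, h5, h6⟩ := h.suffix
    obtain rfl : a' = a := Fin.ext (h3.symm.trans hr)
    rw [e]
    refine ⟨.cons h1 h6 h4 (hb'.trans h4.reverse) (h2.trans hTT) (h5.trans hTT)
      (fun h => by cases h) (fun _ => ?_), fun _ => ?_⟩
    · rw [add_div]
      linarith
    -- The old route has at most `k` trips, and `q` and `r` do not belong to `R'`; so `R'` has at
    -- most `k - 2` trips, even if all of them are shortcuts.
    · have h7 : shortcuts R' ≤ R'.length := List.countP_le_length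
      rw [hR'] at hlen
      simp only [List.length_append, List.length_cons] at hlen
      rw [shortcuts_cons]
      simp only [if_true]
      omega

/-! ### Handovers on an edge -/

/-- An agent on an edge: velocity, and earliest times at both ends with walks from there to the
initial position of the agent. -/
abbrev LocalAgent := ℕ × (ℝ × ((ℝ × RawWalkData) × (ℝ × RawWalkData)))

/-- The earliest time of an agent at distance `x` from the start of an edge of length `l`. -/
noncomputable def localReach (l : ℝ) (q : LocalAgent) (x : ℝ) : ℝ :=
  min (q.2.2.1.1 + x / q.2.1) (q.2.2.2.1 + (l - x) / q.2.1)

/-- If the package is at `x` at time `A + x / w`, this is the first position at which the agent `q`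
can take it, and the new value of `A` from there on. -/
noncomputable def meetL (l w A : ℝ) (q : LocalAgent) : ℝ × ℝ :=
  if realLtB ((q.2.2.1.1 - A) / (1 / w - 1 / q.2.1))
      ((q.2.2.2.1 + l / q.2.1 - A) / (1 / w + 1 / q.2.1)) = true then
    ((q.2.2.1.1 - A) / (1 / w - 1 / q.2.1), q.2.2.1.1)
  else
    ((q.2.2.2.1 + l / q.2.1 - A) / (1 / w + 1 / q.2.1),
      q.2.2.2.1 + (l - (1 + 1) * ((q.2.2.2.1 + l / q.2.1 - A) / (1 / w + 1 / q.2.1))) / q.2.1)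

section Meet

variable {l w A : ℝ} {q : LocalAgent}

theorem meetL_fst : (meetL l w A q).1 = min ((q.2.2.1.1 - A) / (1 / w - 1 / q.2.1))
    ((q.2.2.2.1 + l / q.2.1 - A) / (1 / w + 1 / q.2.1)) := by
  unfold meetL
  split_ifs with h
  · rw [min_eq_left (realLtB_iff.1 h).le]
  · rw [min_eq_right (not_lt.1 fun h' => h (realLtB_iff.2 h'))]

/-- An agent coming from either end is described by a linear inequality in `x`. As the agent is
faster than `w`, both inequalities have a positive coefficient and hold exactly from some position
on; `meetL` takes the smaller one. -/
theorem localReach_le_iff (hw : 0 < w) (hq : w < q.2.1) (x : ℝ) :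
    localReach l q x ≤ A + x / w ↔ (meetL l w A q).1 ≤ x := by
  have hv : 0 < q.2.1 := hw.trans hq
  have hd : 0 < 1 / w - 1 / q.2.1 := sub_pos.2 (one_div_lt_one_div_of_lt hw hq)
  have hd' : 0 < 1 / w + 1 / q.2.1 := by positivity
  rw [meetL_fst, localReach, min_le_iff, min_le_iff, div_le_iff₀ hd, div_le_iff₀ hd']
  refine or_congr ?_ ?_
  · rw [mul_sub, mul_one_div, mul_one_div]
    constructor <;> intro <;> linarith
  · rw [mul_add, mul_one_div, mul_one_div, sub_div]
    constructor <;> intro <;> linarith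

theorem le_localReach (hw : 0 < w) (hq : w < q.2.1) {x : ℝ} (hx : x ≤ (meetL l w A q).1) :
    A + x / w ≤ localReach l q x := by
  have hv : 0 < q.2.1 := hw.trans hq
  have hd : 0 < 1 / w - 1 / q.2.1 := sub_pos.2 (one_div_lt_one_div_of_lt hw hq)
  have hd' : 0 < 1 / w + 1 / q.2.1 := by positivity
  rw [meetL_fst, le_min_iff, le_div_iff₀ hd, le_div_iff₀ hd', mul_sub, mul_add, mul_one_div,
    mul_one_div] at hx
  refine le_min ?_ ?_
  · linarith
  · rw [sub_div]
    linarith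

/-- At the handover the time lines of the old and the new carrier intersect. -/
theorem meetL_snd (hw : 0 < w) (hq : w < q.2.1) :
    (meetL l w A q).2 + (meetL l w A q).1 / q.2.1 = A + (meetL l w A q).1 / w := by
  have hv : 0 < q.2.1 := hw.trans hq
  have hd : 0 < 1 / w - 1 / q.2.1 := sub_pos.2 (one_div_lt_one_div_of_lt hw hq)
  have hd' : 0 < 1 / w + 1 / q.2.1 := by positivity
  unfold meetL
  split_ifs with h
  · have := div_mul_cancel₀ (q.2.2.1.1 - A) hd.ne'
    simp only
    rw [mul_sub, mul_one_div, mul_one_div] at this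
    linarith
  · have := div_mul_cancel₀ (q.2.2.2.1 + l / q.2.1 - A) hd'.ne'
    simp only
    generalize (q.2.2.2.1 + l / q.2.1 - A) / (1 / w + 1 / q.2.1) = m at *
    rw [mul_add, mul_one_div, mul_one_div] at this
    rw [sub_div, mul_div_assoc]
    linarith

end Meet

/-- The earliest times of the package from position `x₀` on, where it is at time `A + x₀ / w` with
an agent of velocity `w`. -/
structure LocalTraj (l : ℝ) (Q : List LocalAgent) (x₀ w A t : ℝ) (τ : ℝ → ℝ) : Prop where
  first : τ x₀ = A + x₀ / w
  mono : ∀ x x', x₀ ≤ x → x ≤ x' → x' ≤ l → τ x ≤ τ x'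
  slope : ∀ x x', x₀ ≤ x → x ≤ x' → x' ≤ l → τ x' ≤ τ x + (x' - x) / w
  last : τ l = t
  carry : ∀ q ∈ Q, ∀ x x' t, x₀ ≤ x → x ≤ x' → x' ≤ l → τ x ≤ t → localReach l q x ≤ t →
    τ x' ≤ t + (x' - x) / q.2.1

theorem localReach_lipschitz {l : ℝ} {q : LocalAgent} (hv : 0 < q.2.1) {x x' : ℝ} (h : x ≤ x') :
    localReach l q x' ≤ localReach l q x + (x' - x) / q.2.1 := by
  have h1 : (l - x') / q.2.1 ≤ (l - x) / q.2.1 + (x' - x) / q.2.1 := by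
    rw [← add_div]
    gcongr
    linarith
  rw [← sub_le_iff_le_add]
  refine le_min ?_ ?_
  · have := min_le_left (q.2.2.1.1 + x' / q.2.1) (q.2.2.2.1 + (l - x') / q.2.1)
    rw [sub_div]
    unfold localReach
    linarith
  · have := min_le_right (q.2.2.1.1 + x' / q.2.1) (q.2.2.2.1 + (l - x') / q.2.1)
    unfold localReach
    linarith

/-- Nobody can outrun the current carrier before the next handover: a slower agent loses ground, and
a faster one is not yet there, because up to its meeting position even its own earliest time is not
before the line. -/
theorem line_le {l w A : ℝ} {q : LocalAgent} (hw : 0 < w) (hv : 0 < q.2.1) {x x' t : ℝ}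
    (hx : x ≤ x') (ht : A + x / w ≤ t) (hr : localReach l q x ≤ t)
    (hm : w < q.2.1 → x' ≤ (meetL l w A q).1) : A + x' / w ≤ t + (x' - x) / q.2.1 := by
  rcases le_or_gt q.2.1 w with h | h
  · have : (x' - x) / w ≤ (x' - x) / q.2.1 := by
      gcongr
    rw [sub_div] at this
    linarith
  · have h1 := localReach_lipschitz (l := l) hv hx
    linarith [le_localReach hw h (hm h)]

theorem LocalTraj.line {l w A x₀ : ℝ} {Q : List LocalAgent} (hw : 0 < w)
    (hv : ∀ q ∈ Q, 0 < q.2.1) (hQ : ∀ q ∈ Q, w < q.2.1 → l ≤ (meetL l w A q).1) :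
    LocalTraj l Q x₀ w A (A + l / w) (fun x => A + x / w) where
  first := rfl
  mono x x' _ h _ := by gcongr
  slope x x' _ h _ := by rw [sub_div]; linarith
  last := rfl
  carry q hq x x' t h0 h h1 ht hr :=
    line_le hw (hv q hq) h ht hr fun hwq => h1.trans (hQ q hq hwq)

/-- A competitor who crosses the handover point `m` is treated in two steps: up to `m` it does not
beat the line, and since its own earliest time at `m` is also respected, the bound of the later
trajectory applies from there. -/
theorem LocalTraj.concat {l w A x₀ m w' A' t : ℝ} {Q : List LocalAgent} {τ : ℝ → ℝ} (hw : 0 < w)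
    (hv : ∀ q ∈ Q, 0 < q.2.1) (hQ : ∀ q ∈ Q, w < q.2.1 → m ≤ (meetL l w A q).1) (hm : x₀ ≤ m)
    (hml : m ≤ l) (hww : w ≤ w') (hA : A' + m / w' = A + m / w) (h : LocalTraj l Q m w' A' t τ) :
    LocalTraj l Q x₀ w A t (fun x => if x ≤ m then A + x / w else τ x) := by
  have h0 : τ m = A + m / w := h.first.trans hA
  have hsl : ∀ x x', m ≤ x → x ≤ x' → x' ≤ l → τ x' ≤ τ x + (x' - x) / w := by
    intro x x' h1 h2 h3
    refine (h.slope x x' h1 h2 h3).trans ?_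
    have : (x' - x) / w' ≤ (x' - x) / w := by
      gcongr
    linarith
  refine ⟨by simp [hm], ?_, ?_, ?_, ?_⟩
  · intro x x' h1 h2 h3
    split_ifs with h4 h5 h5
    · gcongr
    · have := h.mono m x' le_rfl (not_le.1 h5).le h3
      have h6 : x / w ≤ m / w := by gcongr
      linarith
    · exact absurd (h2.trans h5) h4
    · exact h.mono x x' (not_le.1 h4).le h2 h3
  · intro x x' h1 h2 h3
    split_ifs with h4 h5 h5
    · rw [sub_div]; linarith
    · linarith
    · have := hsl m x' le_rfl (not_le.1 h4).le h3
      rw [h0] at this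
      rw [sub_div] at this ⊢
      linarith
    · exact hsl x x' (not_le.1 h5).le h2 h3
  · split_ifs with h4
    · obtain rfl : m = l := le_antisymm hml h4
      rw [← h.last, h0]
    · exact h.last
  · intro q hq x x' t h1 h2 h3 h4 h5
    have hvq := hv q hq
    split_ifs at h4 ⊢ with h6 h7 h7
    · exact line_le hw hvq h2 h4 h5 fun hwq => h6.trans (hQ q hq hwq)
    · exact absurd (h2.trans h6) h7
    · have h8 := line_le hw hvq h7 h4 h5 fun hwq => hQ q hq hwq
      have h9 := localReach_lipschitz (l := l) hvq h7
      have h10 := h.carry q hq m x' (t + (m - x) / q.2.1) le_rfl (not_le.1 h6).le h3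
        (by rw [h0]; exact h8) (h9.trans (by linarith))
      rw [sub_div] at h10 ⊢
      rw [sub_div] at h10
      linarith
    · exact h.carry q hq x x' t (not_le.1 h7).le h2 h3 h4 h5

end Instance

/-- A measure for the size of numbers that is compatible with arithmetic operations. -/
structure SizeModel (size : ℝ → ℕ) (Sz : ℕ → ℝ → Prop) : Prop where
  mono : ∀ {M N x}, Sz M x → M ≤ N → Sz N x
  zero : Sz 1 0
  one : Sz 1 1
  add : ∀ {M N x y}, Sz M x → Sz N y → Sz (M + N + 1) (x + y)
  sub : ∀ {M N x y}, Sz M x → Sz N y → Sz (M + N + 1) (x - y)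
  mul : ∀ {M N x y}, Sz M x → Sz N y → Sz (M + N + 1) (x * y)
  div : ∀ {M N x y}, Sz M x → Sz N y → Sz (M + N + 1) (x / y)
  size_le : ∀ {N x}, Sz N x → size x ≤ 2 * N

namespace Instance

variable {I : Instance}

/-! ### The package on an edge -/

/-- The data of the point at distance `x > 0` from the start of an edge. -/
noncomputable def locL (e : EdgeData) (x : ℝ) : ℕ × (ℕ × ℝ) :=
  if natLtB e.1.1 e.1.2 = true then (e.1.1, (e.1.2, x)) else (e.1.2, (e.1.1, e.2 - x))

/-- A shortest walk from a point of an edge to the initial position of an agent. -/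
noncomputable def backL (e : EdgeData) (x : ℝ) (q : LocalAgent) : RawWalkData :=
  if realLtB (q.2.2.1.1 + x / q.2.1) (q.2.2.2.1 + (e.2 - x) / q.2.1) = true then
    locL e x :: q.2.2.1.2
  else locL e x :: q.2.2.2.2

/-- The current agent, its value `A` (see `meetL`), the location where it took the package with a
walk from there to its initial position, and the route up to this location. -/
abbrev EdgeState :=
  LocalAgent × (ℝ × (((ℕ × (ℕ × ℝ)) × RawWalkData) × List RouteRec))

noncomputable def handoverCandsL (e : EdgeData) (Q : List LocalAgent) (s : EdgeState) :
    List ((ℝ × ℝ) × (LocalAgent × ℝ)) :=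
  collectL (fun q =>
    if realLtB s.1.2.1 q.2.1 = true then
      if realLtB ((meetL e.2 s.1.2.1 s.2.1 q).1) e.2 = true then
        [(((meetL e.2 s.1.2.1 s.2.1 q).1, q.2.1), (q, (meetL e.2 s.1.2.1 s.2.1 q).2))]
      else []
    else []) Q

/-- The first handover to a faster agent. -/
noncomputable def handoverL (e : EdgeData) (Q : List LocalAgent) (s : EdgeState) : EdgeState :=
  match argminL (handoverCandsL e Q s) with
  | [] => s
  | b :: _ => (b.2.1, (b.2.2, ((locL e b.1.1, backL e b.1.1 b.2.1),
      pushL s.2.2.2 (s.1.1, (s.2.2.1, (locL e b.1.1, backL e b.1.1 s.1))))))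

noncomputable def enterCandsL (Q : List LocalAgent) (T : ℝ) : List ((ℝ × ℝ) × LocalAgent) :=
  collectL (fun q =>
    [(((if realLtB T q.2.2.1.1 = true then q.2.2.1.1 else T), q.2.1), q)]) Q

/-- The time and the route of the package at the end of an edge. -/
noncomputable def traverseL (e : EdgeData) (Q : List LocalAgent) (c : ℝ × List RouteRec) :
    List (ℝ × List RouteRec) :=
  match argminL (enterCandsL Q c.1) with
  | [] => []
  | b :: _ =>
    let s := Q.foldl (fun s _ => handoverL e Q s)
      (b.2, (b.1.1, (((e.1.1, (e.1.1, 0)), b.2.2.2.1.2), c.2)))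
    [(s.2.1 + e.2 / s.1.2.1,
      pushL s.2.2.2 (s.1.1, (s.2.2.1, ((e.1.2, (e.1.2, 0)), s.1.2.2.2.2))))]

/-- The point at distance `x` from `u` on an edge. -/
noncomputable def locAt (I : Instance) (u v : Fin I.n) (x : ℝ) : Loc I.n :=
  if x = 0 then .node u else if u < v then .inner u v x else .inner v u (I.len s(u, v) - x)

noncomputable def edgeData (I : Instance) (u v : Fin I.n) : EdgeData :=
  (((u : ℕ), (v : ℕ)), I.len s(u, v))

section LocAt

variable {u v : Fin I.n} {a : Fin I.k} {x x' : ℝ}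

theorem encodeLoc_locAt (h : 0 < x) : encodeLoc (I.locAt u v x) = locL (I.edgeData u v) x := by
  unfold locAt locL edgeData
  rw [if_neg h.ne']
  by_cases huv : u < v
  · have : (u : ℕ) < v := huv
    simp [huv, encodeLoc]
  · have : ¬ (u : ℕ) < v := huv
    simp [huv, encodeLoc]

theorem isLoc_locAt (ha : I.G.Adj u v) (h0 : 0 ≤ x) (h : x < I.len s(u, v) ∨ x = 0) :
    I.IsLoc (I.locAt u v x) := by
  unfold locAt
  by_cases hx : x = 0
  · simp [hx, IsLoc]
  · have hx0 : 0 < x := lt_of_le_of_ne h0 (Ne.symm hx)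
    have h := h.resolve_right hx
    rw [if_neg hx]
    split_ifs with huv
    · exact ⟨huv, ha, hx0, h⟩
    · refine ⟨lt_of_le_of_ne (not_lt.1 huv) ha.ne.symm, ha.symm, by linarith, ?_⟩
      rw [Sym2.eq_swap (a := v)]
      linarith

theorem seg_locAt (ha : (I.range a).Adj u v) (h0 : 0 ≤ x) (h : x < x') :
    I.Seg a (I.locAt u v x') (I.locAt u v x) ∧
      I.segLen (I.locAt u v x') (I.locAt u v x) = x' - x := by
  have hne : u ≠ v := ha.adj_sub.ne
  have hx' : x' ≠ 0 := by linarith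
  unfold locAt
  rw [if_neg hx']
  by_cases hx : x = 0
  · subst hx
    rw [if_pos rfl]
    split_ifs with huv
    · exact ⟨⟨ha, Or.inl rfl⟩, by simp [segLen]⟩
    · refine ⟨⟨ha.symm, Or.inr rfl⟩, ?_⟩
      rw [segLen, if_neg hne, Sym2.eq_swap (a := v)]
      ring
  · rw [if_neg hx]
    split_ifs with huv
    · exact ⟨⟨ha, rfl, rfl⟩, abs_of_pos (by linarith)⟩
    · refine ⟨⟨ha.symm, rfl, rfl⟩, ?_⟩
      rw [segLen, sub_sub_sub_cancel_left, abs_sub_comm, abs_of_pos (by linarith)]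

theorem seg_locAt_end (ha : (I.range a).Adj u v) :
    I.Seg a (.node v) (I.locAt u v x) ∧
      I.segLen (.node v) (I.locAt u v x) = I.len s(u, v) - x := by
  have hne : v ≠ u := ha.adj_sub.ne.symm
  unfold locAt
  by_cases hx : x = 0
  · rw [if_pos hx]
    exact ⟨ha.symm, by rw [segLen, hx, sub_zero, Sym2.eq_swap]⟩
  · rw [if_neg hx]
    split_ifs with huv
    · exact ⟨⟨ha, Or.inr rfl⟩, by rw [segLen, if_neg hne]⟩
    · exact ⟨⟨ha.symm, Or.inl rfl⟩, by rw [segLen, if_pos rfl]⟩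

end LocAt

/-- The local agent `q` describes the agent `a` on the edge from `u` to `v`. -/
structure IsLocal (I : Instance) (ρ : Fin I.k → Fin I.n → ℝ) (b : ℕ) (u v : Fin I.n)
    (a : Fin I.k) (q : LocalAgent) : Prop where
  id : q.1 = a
  vel : q.2.1 = I.vel a
  adj : (I.range a).Adj u v
  fst : q.2.2.1.1 = ρ a u
  snd : q.2.2.2.1 = ρ a v
  back_fst : I.RawWalk a q.2.2.1.2 (.node u) (.node (I.pos a)) (I.vel a * ρ a u)
  back_snd : I.RawWalk a q.2.2.2.2 (.node v) (.node (I.pos a)) (I.vel a * ρ a v)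
  length_fst : q.2.2.1.2.length < b
  length_snd : q.2.2.2.2.length < b

structure EdgeHyp (I : Instance) (Sz : ℕ → ℝ → Prop) (W : ℕ) (ρ : Fin I.k → Fin I.n → ℝ) (b : ℕ)
    (u v : Fin I.n) (Q : List LocalAgent) : Prop where
  lipschitz : ∀ a u v, (I.range a).Adj u v → ρ a v ≤ ρ a u + I.len s(u, v) / I.vel a
  adj : I.G.Adj u v
  agent : ∀ q ∈ Q, ∃ a, IsLocal I ρ b u v a q
  complete : ∀ a, (I.range a).Adj u v → ∃ q ∈ Q, IsLocal I ρ b u v a q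
  sz_len : Sz W (I.len s(u, v))
  sz : ∀ q ∈ Q, Sz W q.2.1 ∧ Sz W q.2.2.1.1 ∧ Sz W q.2.2.2.1

variable {Sz : ℕ → ℝ → Prop} {W : ℕ} {ρ : Fin I.k → Fin I.n → ℝ} {b : ℕ} {u v : Fin I.n}
  {Q : List LocalAgent}

theorem IsLocal.vel_pos {a : Fin I.k} {q : LocalAgent} (h : IsLocal I ρ b u v a q) :
    0 < q.2.1 := h.vel ▸ I.vel_pos a

theorem EdgeHyp.vel_pos (H : EdgeHyp I Sz W ρ b u v Q) {q : LocalAgent} (hq : q ∈ Q) :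
    0 < q.2.1 := by
  obtain ⟨a, ha⟩ := H.agent q hq
  exact ha.vel_pos

theorem EdgeHyp.localReach_zero (H : EdgeHyp I Sz W ρ b u v Q) {q : LocalAgent} (hq : q ∈ Q) :
    localReach (I.len s(u, v)) q 0 = q.2.2.1.1 := by
  obtain ⟨a, ha⟩ := H.agent q hq
  rw [localReach, zero_div, add_zero, sub_zero, min_eq_left]
  rw [ha.fst, ha.snd, ha.vel, Sym2.eq_swap]
  exact H.lipschitz a v u ha.adj.symm

theorem EdgeHyp.localReach_end (H : EdgeHyp I Sz W ρ b u v Q) {q : LocalAgent} (hq : q ∈ Q) :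
    localReach (I.len s(u, v)) q (I.len s(u, v)) = q.2.2.2.1 := by
  obtain ⟨a, ha⟩ := H.agent q hq
  rw [localReach, sub_self, zero_div, add_zero, min_eq_right]
  rw [ha.fst, ha.snd, ha.vel]
  exact H.lipschitz a u v ha.adj

/-- The walk is exactly as long as what the agent travels until its earliest time at the point.
Therefore it serves, reversed, as the way to a pick-up and, in a shortcut, as the way from the
initial position to a drop-off. -/
theorem IsLocal.rawWalk_backL {a : Fin I.k} {q : LocalAgent} (h : IsLocal I ρ b u v a q) {x : ℝ}
    (hx : 0 < x) (hxl : x < I.len s(u, v)) :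
    I.RawWalk a (backL (I.edgeData u v) x q) (I.locAt u v x) (.node (I.pos a))
      (I.vel a * localReach (I.len s(u, v)) q x) ∧
      (backL (I.edgeData u v) x q).length ≤ b := by
  have hv := (I.vel_pos a).ne'
  have hloc := isLoc_locAt h.adj.adj_sub hx.le (Or.inl hxl)
  have h1 := seg_locAt h.adj le_rfl hx
  have h2 := seg_locAt_end (x := x) h.adj
  unfold backL
  split_ifs with hlt
  · have hlt := realLtB_iff.1 hlt
    have := h.length_fst
    refine ⟨?_, by simp only [List.length_cons]; omega⟩
    rw [← encodeLoc_locAt hx]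
    have h0 : I.locAt u v 0 = .node u := by simp [locAt]
    rw [h0] at h1
    have h3 := h.back_fst.cons h1.1 hloc
    have e : localReach (I.len s(u, v)) q x = q.2.2.1.1 + x / q.2.1 := min_eq_left hlt.le
    rw [h1.2] at h3
    rw [e, h.fst, h.vel, mul_add, mul_div_cancel₀ _ hv, add_comm]
    simpa using h3
  · have hlt := not_lt.1 fun h' => hlt (realLtB_iff.2 h')
    have := h.length_snd
    refine ⟨?_, by simp only [List.length_cons]; omega⟩
    rw [← encodeLoc_locAt hx]
    have h3 := h.back_snd.cons h2.1.symm hloc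
    have e : localReach (I.len s(u, v)) q x = q.2.2.2.1 + (I.len s(u, v) - x) / q.2.1 :=
      min_eq_right hlt
    rw [segLen_comm, h2.2] at h3
    rw [e, h.snd, h.vel, mul_add, mul_div_cancel₀ _ hv, add_comm]
    exact h3

/-- `A` occurs only once in the meeting position, and the meeting position only once in the new
value. Hence the size grows by a summand that does not depend on `N`; `8 * W + 16` comes from adding
up the operations in the longest formula. -/
theorem sz_meetL {size : ℝ → ℕ} (hS : SizeModel size Sz) {N : ℕ} {l w A : ℝ} {q : LocalAgent}
    (hl : Sz W l) (hw : Sz W w) (hA : Sz N A) (hq : Sz W q.2.1 ∧ Sz W q.2.2.1.1 ∧ Sz W q.2.2.2.1) :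
    Sz (N + (8 * W + 16)) (meetL l w A q).1 ∧ Sz (N + (8 * W + 16)) (meetL l w A q).2 := by
  obtain ⟨h1, h2, h3⟩ := hq
  have e1 := hS.div (hS.sub h2 hA) (hS.sub (hS.div hS.one hw) (hS.div hS.one h1))
  have e2 := hS.div (hS.sub (hS.add h3 (hS.div hl h1)) hA)
    (hS.add (hS.div hS.one hw) (hS.div hS.one h1))
  have e3 := hS.add h3 (hS.div (hS.sub hl (hS.mul (hS.add hS.one hS.one) e2)) h1)
  unfold meetL
  split_ifs
  · exact ⟨hS.mono e1 (by omega), hS.mono h2 (by omega)⟩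
  · exact ⟨hS.mono e2 (by omega), hS.mono e3 (by omega)⟩

/-- The invariant of the loop over the handovers on an edge; the package is at `x`. -/
structure EdgeInv (I : Instance) (Sz : ℕ → ℝ → Prop) (ρ : Fin I.k → Fin I.n → ℝ) (b : ℕ)
    (u v : Fin I.n) (Q : List LocalAgent) (j c N : ℕ) (s : EdgeState) (x : ℝ) : Prop where
  mem : s.1 ∈ Q
  nonneg : 0 ≤ x
  lt : x < I.len s(u, v) ∨ x = 0
  slower : ∀ q ∈ Q, s.1.2.1 < q.2.1 → s.2.1 + x / s.1.2.1 < localReach (I.len s(u, v)) q x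
  route : RouteInv I s.2.2.2 (I.locAt u v x) (s.2.1 + x / s.1.2.1)
  loc : s.2.2.1.1 = encodeLoc (I.locAt u v x)
  back : ∀ a, IsLocal I ρ b u v a s.1 → I.RawWalk a s.2.2.1.2 (I.locAt u v x)
    (.node (I.pos a)) (I.vel a * localReach (I.len s(u, v)) s.1 x)
  length_back : s.2.2.1.2.length ≤ b
  reach : localReach (I.len s(u, v)) s.1 x ≤ s.2.1 + x / s.1.2.1
  shape : RouteShape (fun i => ∃ a : Fin I.k, i = a ∧ I.vel a < s.1.2.1) j s.2.2.2
  short : shortcuts s.2.2.2 ≤ I.k - 1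
  bd : RouteBd b c s.2.2.2
  sz : Sz N s.2.1

theorem mem_handoverCandsL {e : EdgeData} {s : EdgeState} {d : (ℝ × ℝ) × (LocalAgent × ℝ)} :
    d ∈ handoverCandsL e Q s ↔ ∃ q ∈ Q, s.1.2.1 < q.2.1 ∧ (meetL e.2 s.1.2.1 s.2.1 q).1 < e.2 ∧
      d = (((meetL e.2 s.1.2.1 s.2.1 q).1, q.2.1), (q, (meetL e.2 s.1.2.1 s.2.1 q).2)) := by
  simp only [handoverCandsL, mem_collectL, realLtB_iff]
  refine exists_congr fun q => and_congr_right fun _ => ?_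
  split_ifs with h1 h2
  · simp [h1, h2]
  · simp [h2]
  · simp [h1]

theorem RouteBd.mono {b c c' : ℕ} {R : List RouteRec} (h : RouteBd b c R) (hc : c ≤ c') :
    RouteBd b c' R := fun r hr => ⟨(h r hr).1, (h r hr).2.trans hc⟩

theorem EdgeInv.mono {size : ℝ → ℕ} (hS : SizeModel size Sz) {j c c' N N' : ℕ} {s : EdgeState}
    {x : ℝ} (h : EdgeInv I Sz ρ b u v Q j c N s x) (hc : c ≤ c') (hN : N ≤ N') :
    EdgeInv I Sz ρ b u v Q j c' N' s x :=
  { h with bd := h.bd.mono hc, sz := hS.mono h.sz hN }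

/-- If no faster agent can be met before the end of the edge, the state is final. Otherwise the
first meeting position is the next handover, and no faster agent could have taken the package before
it. -/
theorem EdgeInv.step {size : ℝ → ℕ} (hS : SizeModel size Sz) (H : EdgeHyp I Sz W ρ b u v Q)
    {j c N : ℕ} {s : EdgeState} {x : ℝ}
    (h : EdgeInv I Sz ρ b u v Q j c N s x) (hbc : 2 * b ≤ c) (hc : 1 ≤ c) :
    (handoverL (I.edgeData u v) Q s = s ∧
      ∀ q ∈ Q, s.1.2.1 < q.2.1 → I.len s(u, v) ≤ (meetL (I.len s(u, v)) s.1.2.1 s.2.1 q).1) ∨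
    ∃ m, x ≤ m ∧ m ≤ I.len s(u, v) ∧ s.1.2.1 < (handoverL (I.edgeData u v) Q s).1.2.1 ∧
      (∀ q ∈ Q, s.1.2.1 < q.2.1 → m ≤ (meetL (I.len s(u, v)) s.1.2.1 s.2.1 q).1) ∧
      (handoverL (I.edgeData u v) Q s).2.1 + m / (handoverL (I.edgeData u v) Q s).1.2.1 =
        s.2.1 + m / s.1.2.1 ∧
      EdgeInv I Sz ρ b u v Q j (c + 1) (N + (8 * W + 16)) (handoverL (I.edgeData u v) Q s) m := by
  have hw := H.vel_pos h.mem
  rcases argminL_cases (handoverCandsL (I.edgeData u v) Q s) with ⟨hc', hm⟩ | ⟨d, hd, hm, hle⟩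
  · left
    refine ⟨by simp only [handoverL, hm], fun q hq hwq => ?_⟩
    by_contra hcon
    have : (_ : (ℝ × ℝ) × (LocalAgent × ℝ)) ∈ handoverCandsL (I.edgeData u v) Q s :=
      mem_handoverCandsL.2 ⟨q, hq, hwq, not_le.1 hcon, rfl⟩
    rw [hc'] at this
    cases this
  · right
    obtain ⟨q, hq, hwq, hml, rfl⟩ := mem_handoverCandsL.1 hd
    have hml : (meetL (I.len s(u, v)) s.1.2.1 s.2.1 q).1 < I.len s(u, v) := hml
    have hsnd := meetL_snd (l := I.len s(u, v)) (A := s.2.1) hw hwq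
    have hszm := sz_meetL hS H.sz_len (H.sz _ h.mem).1 h.sz (H.sz q hq)
    have hcand : ∀ q' ∈ Q, s.1.2.1 < q'.2.1 →
        KeyLe ((meetL (I.len s(u, v)) s.1.2.1 s.2.1 q).1, q.2.1)
          ((meetL (I.len s(u, v)) s.1.2.1 s.2.1 q').1, q'.2.1) := by
      intro q' hq' hwq'
      by_cases hml' : (meetL (I.len s(u, v)) s.1.2.1 s.2.1 q').1 < I.len s(u, v)
      · exact hle _ (mem_handoverCandsL.2 ⟨q', hq', hwq', hml', rfl⟩)
      · exact Or.inl (hml.trans_le (not_lt.1 hml'))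
    -- By `slower`, no faster agent is at `x` in time, so the meeting lies strictly beyond `x`. In
    -- particular it is not at a node.
    have hxm : x < (meetL (I.len s(u, v)) s.1.2.1 s.2.1 q).1 := by
      by_contra hcon
      have := (localReach_le_iff hw hwq x).2 (not_lt.1 hcon)
      exact absurd (h.slower q hq hwq) (not_lt.2 this)
    have hst : handoverL (I.edgeData u v) Q s =
        (q, ((meetL (I.len s(u, v)) s.1.2.1 s.2.1 q).2,
        ((locL (I.edgeData u v) (meetL (I.len s(u, v)) s.1.2.1 s.2.1 q).1,
          backL (I.edgeData u v) (meetL (I.len s(u, v)) s.1.2.1 s.2.1 q).1 q),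
        pushL s.2.2.2 (s.1.1, (s.2.2.1,
          (locL (I.edgeData u v) (meetL (I.len s(u, v)) s.1.2.1 s.2.1 q).1,
          backL (I.edgeData u v) (meetL (I.len s(u, v)) s.1.2.1 s.2.1 q).1 s.1)))))) := by
      simp only [handoverL, hm]
      rfl
    rw [hst]
    have hrm := (localReach_le_iff (l := I.len s(u, v)) (A := s.2.1) hw hwq _).2 le_rfl
    generalize hmA : meetL (I.len s(u, v)) s.1.2.1 s.2.1 q = mA at *
    obtain ⟨m, A⟩ := mA
    dsimp only at hxm hml hsnd hszm hrm ⊢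
    have hm0 : 0 < m := h.nonneg.trans_lt hxm
    obtain ⟨a, ha⟩ := H.agent _ h.mem
    obtain ⟨a', ha'⟩ := H.agent q hq
    have hseg := seg_locAt ha.adj h.nonneg hxm
    have hbm := ha.rawWalk_backL hm0 hml
    have hbm' := ha'.rawWalk_backL hm0 hml
    -- The current agent is not among the slower ones that were used on this edge, because its
    -- number determines its velocity.
    have hid : ¬ ∃ a' : Fin I.k, s.1.1 = a' ∧ I.vel a' < s.1.2.1 := by
      rintro ⟨a', e1, e2⟩
      obtain rfl : a' = a := Fin.ext (e1.symm.trans ha.id)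
      exact absurd ha.vel e2.ne'
    have hlip := localReach_lipschitz (l := I.len s(u, v)) ha.vel_pos hxm.le
    have hT : s.2.1 + x / s.1.2.1 + (m - x) / s.1.2.1 = s.2.1 + m / s.1.2.1 := by
      rw [sub_div]; ring
    have hpush := h.route.push (h.back a ha) hbm.1 (T' := s.2.1 + m / s.1.2.1)
      (by rw [mul_div_cancel_left₀ _ (I.vel_pos a).ne']; exact h.reach) hseg.1
      (isLoc_locAt H.adj h.nonneg h.lt) (isLoc_locAt H.adj hm0.le (Or.inl hml))
      (by rw [hseg.2, ← ha.vel, hT])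
      (by rw [mul_div_cancel_left₀ _ (I.vel_pos a).ne']; linarith [h.reach])
    rw [← h.loc, encodeLoc_locAt hm0, ← ha.id] at hpush
    refine ⟨m, hxm.le, hml.le, hwq, fun q' hq' hwq' => (hcand q' hq' hwq').fst_le, hsnd, ?_⟩
    constructor
    · exact hq
    · exact hm0.le
    · exact Or.inl hml
    · intro q' hq' hwq'
      dsimp only at hwq' ⊢
      rcases hcand q' hq' (hwq.trans hwq') with h1 | h1
      · have h2 := mt (localReach_le_iff (l := I.len s(u, v)) (A := s.2.1) hw (hwq.trans hwq') m).1
          (not_le.2 h1)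
        rw [hsnd]
        exact not_le.1 h2
      -- A still faster agent with the same meeting position would have won the tie.
      · exact absurd h1.2 (not_le.2 hwq')
    · dsimp only
      rw [hsnd]
      exact hpush.1
    · exact (encodeLoc_locAt hm0).symm
    · intro a'' ha''
      exact (ha''.rawWalk_backL hm0 hml).1
    · exact hbm'.2
    · dsimp only
      rw [hsnd]
      exact hrm
    · refine (h.shape.push (g := (s.1.1, (s.2.2.1,
        (locL (I.edgeData u v) m, backL (I.edgeData u v) m s.1)))) hid).imp ?_
      rintro i (⟨a', e1, e2⟩ | e)
      · exact ⟨a', e1, e2.trans hwq⟩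
      · exact ⟨a, e.trans ha.id, ha.vel ▸ hwq⟩
    · exact hpush.2 h.short
    · exact h.bd.push h.length_back hbm.2 hbc hc
    · exact hszm.2

/-- The number of agents that are faster than `w`. -/
noncomputable def faster (Q : List LocalAgent) (w : ℝ) : ℕ := Q.countP (fun q => realLtB w q.2.1)

theorem faster_lt {w w' : ℝ} {q : LocalAgent} (hq : q ∈ Q) (h : w < q.2.1) (hw : w < w')
    (hw' : q.2.1 = w') : faster Q w' < faster Q w := by
  subst hw'
  unfold faster
  rw [List.countP_eq_length_filter, List.countP_eq_length_filter]
  have e : Q.filter (fun q' => realLtB q.2.1 q'.2.1) =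
      (Q.filter (fun q' => realLtB w q'.2.1)).filter (fun q' => realLtB q.2.1 q'.2.1) := by
    rw [List.filter_filter]
    refine List.filter_congr fun q' _ => ?_
    by_cases h' : q.2.1 < q'.2.1
    · simp [h', h.trans h']
    · simp [h']
  rw [e]
  refine List.length_filter_lt_length_iff_exists.2 ⟨q, ?_, by simp⟩
  simp [hq, h]

/-- Each handover strictly decreases the number of faster agents, so one round per agent is enough;
when there is no candidate left, further rounds change nothing. The trajectory is put together from
the end of the edge backwards. -/
theorem EdgeInv.loop {size : ℝ → ℕ} (hS : SizeModel size Sz) (H : EdgeHyp I Sz W ρ b u v Q)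
    {j : ℕ} (F : List LocalAgent) {c N : ℕ} {s : EdgeState} {x : ℝ}
    (h : EdgeInv I Sz ρ b u v Q j c N s x) (hbc : 2 * b ≤ c) (hc : 1 ≤ c)
    (hF : faster Q s.1.2.1 ≤ F.length) :
    ∃ x' s', F.foldl (fun s _ => handoverL (I.edgeData u v) Q s) s = s' ∧
      EdgeInv I Sz ρ b u v Q j (c + F.length) (N + F.length * (8 * W + 16)) s' x' ∧
      ∃ τ, LocalTraj (I.len s(u, v)) Q x s.1.2.1 s.2.1
        (s'.2.1 + I.len s(u, v) / s'.1.2.1) τ := by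
  have hv : ∀ q ∈ Q, 0 < q.2.1 := fun q hq => H.vel_pos hq
  have hend : ∀ (F : List LocalAgent) (s : EdgeState), handoverL (I.edgeData u v) Q s = s →
      F.foldl (fun s _ => handoverL (I.edgeData u v) Q s) s = s := by
    intro F s hs
    induction F with
    | nil => rfl
    | cons a F ih => rw [List.foldl_cons, hs, ih]
  induction F generalizing c N s x with
  | nil =>
    refine ⟨x, s, rfl, by simpa using h, _, .line (hv _ h.mem) hv fun q hq hwq => ?_⟩
    have : 0 < faster Q s.1.2.1 := List.countP_pos_iff.2 ⟨q, hq, by simpa using hwq⟩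
    simp only [List.length_nil] at hF
    omega
  | cons a F ih =>
    rcases h.step hS H hbc hc with ⟨h1, h2⟩ | ⟨m, h1, h2, h3, h4, h5, h6⟩
    · refine ⟨x, s, hend _ _ h1, h.mono hS (by omega) (by omega), _, .line (hv _ h.mem) hv h2⟩
    · have hlt := faster_lt h6.mem h3 h3 rfl
      obtain ⟨x', s', e1, e2, τ, e3⟩ := ih h6 (by omega) (by omega)
        (by simp only [List.length_cons] at hF; omega)
      refine ⟨x', s', e1, e2.mono hS (by simp only [List.length_cons]; omega) ?_, _,
        .concat (hv _ h.mem) hv h4 h1 h2 h3.le h5 e3⟩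
      simp only [List.length_cons, add_mul]
      omega

/-- The first agent is one that can start earliest, and the fastest among those. So every faster
agent reaches `u` strictly later than the start, which is `slower` at position 0. -/
theorem enter_inv {size : ℝ → ℕ} (hS : SizeModel size Sz) (H : EdgeHyp I Sz W ρ b u v Q)
    {j c N : ℕ} {T : ℝ} {R : List RouteRec} (hQ : Q ≠ []) (hR : RouteInv I R (.node u) T)
    (hj : shortcuts R ≤ j) (hk : shortcuts R ≤ I.k - 1) (hb : RouteBd b c R) (hW : W ≤ N)
    (hT : Sz N T) :
    ∃ d ∈ enterCandsL Q T, argminL (enterCandsL Q T) = [d] ∧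
      T ≤ d.1.1 ∧ (∀ q ∈ Q, d.1.1 ≤ max T q.2.2.1.1) ∧
      EdgeInv I Sz ρ b u v Q j c N
        (d.2, (d.1.1, ((((u : ℕ), ((u : ℕ), 0)), d.2.2.2.1.2), R))) 0 := by
  have hmax : ∀ q : LocalAgent, (if realLtB T q.2.2.1.1 = true then q.2.2.1.1 else T) =
      max T q.2.2.1.1 := by
    intro q
    split_ifs with h
    · rw [max_eq_right (realLtB_iff.1 h).le]
    · rw [max_eq_left (not_lt.1 fun h' => h (realLtB_iff.2 h'))]
  have hmem : ∀ d, d ∈ enterCandsL Q T ↔ ∃ q ∈ Q, d = ((max T q.2.2.1.1, q.2.1), q) := by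
    intro d
    simp only [enterCandsL, mem_collectL, hmax, List.mem_singleton]
  rcases argminL_cases (enterCandsL Q T) with ⟨h1, -⟩ | ⟨d, hd, hm, hle⟩
  · obtain ⟨q, hq⟩ := List.exists_mem_of_ne_nil Q hQ
    have := (hmem _).2 ⟨q, hq, rfl⟩
    rw [h1] at this
    cases this
  · refine ⟨d, hd, hm, ?_⟩
    obtain ⟨q, hq, rfl⟩ := (hmem d).1 hd
    have h0 : I.locAt u v 0 = .node u := by simp [locAt]
    have hle' : ∀ q' ∈ Q, KeyLe (max T q.2.2.1.1, q.2.1) (max T q'.2.2.1.1, q'.2.1) :=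
      fun q' hq' => hle _ ((hmem _).2 ⟨q', hq', rfl⟩)
    have hTs : Sz N (max T q.2.2.1.1) := by
      rcases max_choice T q.2.2.1.1 with e | e
      · rw [e]; exact hT
      · rw [e]; exact hS.mono (H.sz q hq).2.1 hW
    refine ⟨le_max_left _ _, fun q' hq' => (hle' q' hq').fst_le, ?_⟩
    constructor
    · exact hq
    · exact le_rfl
    · exact Or.inr rfl
    · intro q' hq' hwq
      rw [H.localReach_zero hq', zero_div, add_zero]
      rcases hle' q' hq' with h1 | h1
      · rcases lt_max_iff.1 h1 with h2 | h2
        · exact absurd (le_max_left T q.2.2.1.1) (not_le.2 h2)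
        · exact h2
      · exact absurd h1.2 (not_le.2 hwq)
    · rw [h0, zero_div, add_zero]
      exact hR.mono (le_max_left _ _)
    · rw [h0]; rfl
    · intro a ha
      rw [h0, H.localReach_zero hq, ha.fst]
      exact ha.back_fst
    · obtain ⟨a, ha⟩ := H.agent q hq
      exact ha.length_fst.le
    · rw [H.localReach_zero hq, zero_div, add_zero]
      exact le_max_right _ _
    · exact .of_le hj
    · exact hk
    · exact hb
    · exact hTs

/-- The result of the algorithm for an edge. -/
theorem traverseL_spec {size : ℝ → ℕ} (hS : SizeModel size Sz) (H : EdgeHyp I Sz W ρ b u v Q)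
    {j c N : ℕ} {T : ℝ} {R : List RouteRec} (hQ : Q ≠ []) (hR : RouteInv I R (.node u) T)
    (hj : shortcuts R ≤ j) (hk : shortcuts R ≤ I.k - 1) (hb : RouteBd b c R) (hW : W ≤ N)
    (hT : Sz N T) (hbc : 2 * b ≤ c) (hc : 1 ≤ c) :
    ∃ T' R', traverseL (I.edgeData u v) Q (T, R) = [(T', R')] ∧ T ≤ T' ∧
      RouteInv I R' (.node v) T' ∧ shortcuts R' ≤ j + 1 ∧ shortcuts R' ≤ I.k - 1 ∧
      RouteBd b (c + Q.length + 1) R' ∧ Sz (N + (Q.length + 1) * (8 * W + 16)) T' ∧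
      ∀ t : Fin I.n → ℝ, t u = T → t v ≤ T' → ∃ τ, IsTraj I ρ t u v τ := by
  obtain ⟨d, -, hd1, hTd, hdQ, hinv⟩ := enter_inv hS H hQ hR hj hk hb hW hT
  obtain ⟨x, s, hs, hinv', τ, hτ⟩ := hinv.loop hS H Q hbc hc List.countP_le_length
  have hst : traverseL (I.edgeData u v) Q (T, R) = [(s.2.1 + I.len s(u, v) / s.1.2.1,
      pushL s.2.2.2 (s.1.1, (s.2.2.1, ((v, (v, 0)), s.1.2.2.2.2))))] := by
    simp only [traverseL, hd1]
    rw [← hs]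
    rfl
  obtain ⟨a, ha⟩ := H.agent _ hinv'.mem
  have hw := ha.vel_pos
  have hseg := seg_locAt_end (x := x) ha.adj
  have hxl : x ≤ I.len s(u, v) := by
    rcases hinv'.lt with h | h
    · exact h.le
    · rw [h]; exact I.len_nonneg _ H.adj
  have hlip := localReach_lipschitz (l := I.len s(u, v)) hw hxl
  rw [H.localReach_end hinv'.mem] at hlip
  have hT' : s.2.1 + x / s.1.2.1 + (I.len s(u, v) - x) / s.1.2.1 =
      s.2.1 + I.len s(u, v) / s.1.2.1 := by
    rw [sub_div]; ring
  have hpush := hinv'.route.push (hinv'.back a ha) ha.back_snd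
    (T' := s.2.1 + I.len s(u, v) / s.1.2.1)
    (by rw [mul_div_cancel_left₀ _ (I.vel_pos a).ne']; exact hinv'.reach) hseg.1
    (isLoc_locAt H.adj hinv'.nonneg hinv'.lt) trivial
    (by rw [hseg.2, ← ha.vel, hT'])
    (by rw [mul_div_cancel_left₀ _ (I.vel_pos a).ne', ← ha.snd]; linarith [hinv'.reach])
  rw [← hinv'.loc, ← ha.id] at hpush
  have hid : ¬ ∃ a' : Fin I.k, s.1.1 = a' ∧ I.vel a' < s.1.2.1 := by
    rintro ⟨a', e1, e2⟩
    obtain rfl : a' = a := Fin.ext (e1.symm.trans ha.id)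
    exact absurd ha.vel e2.ne'
  have h0l : 0 ≤ I.len s(u, v) := I.len_nonneg _ H.adj
  have hτ0 : τ 0 = d.1.1 := by
    have := hτ.first
    rwa [zero_div, add_zero] at this
  refine ⟨_, _, hst, ?_, hpush.1, ?_, hpush.2 hinv'.short, ?_, ?_, ?_⟩
  · have := hτ.mono 0 _ le_rfl h0l le_rfl
    rw [hτ.last, hτ0] at this
    exact hTd.trans this
  -- The exceptional part `R₁` accounts for the single shortcut that an edge may add.
  · exact (hinv'.shape.push (g := (s.1.1, (s.2.2.1, ((v, (v, 0)), s.1.2.2.2.2)))) hid).shortcuts_le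
  · exact hinv'.bd.push hinv'.length_back ha.length_snd.le (by omega) (by omega)
  · refine hS.mono (hS.add hinv'.sz (hS.div H.sz_len (H.sz _ hinv'.mem).1)) ?_
    rw [add_mul]
    omega
  -- The end `v` may have been reached earlier over another edge; a smaller time at `v` only makes
  -- the trajectory condition weaker.
  · intro t htu htv
    refine ⟨τ, ?_, ?_, ?_, ?_, ?_⟩
    · intro a ha t' x h1 h2 h3 h4
      obtain ⟨q, hq, hqa⟩ := H.complete a ha
      have h5 : max T q.2.2.1.1 ≤ t' := max_le (htu ▸ h1) (hqa.fst ▸ h2)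
      have := hτ.carry q hq 0 x t' le_rfl h3 h4 (hτ0 ▸ (hdQ q hq).trans h5)
        (by rw [H.localReach_zero hq, hqa.fst]; exact h2)
      rwa [sub_zero, hqa.vel] at this
    · rw [htu, hτ0]
      exact hTd
    · intro x x' h1 h2 h3
      exact hτ.mono x x' h1 h2 h3
    · intro a ha x x' t' h1 h2 h3 h4 h5
      obtain ⟨q, hq, hqa⟩ := H.complete a ha
      have := hτ.carry q hq x x' t' h1 h2 h3 h4
        (by rw [localReach, hqa.fst, hqa.snd, hqa.vel]; exact h5)
      rwa [hqa.vel] at this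
    · rw [hτ.last]
      exact htv

end Instance

namespace Prog

open Instance

variable {γ : Ty} {size : ℝ → ℕ} {N : ℕ}

@[reducible] def walkTy : Ty := .list locTy

@[reducible] def routeTy : Ty := .list (.prod .nat (.prod .bool (.prod walkTy walkTy)))

@[reducible] def legTy : Ty := .prod .nat (.prod (.prod locTy walkTy) (.prod locTy walkTy))

@[reducible] def localTy : Ty :=
  .prod .nat (.prod .real (.prod (.prod .real walkTy) (.prod .real walkTy)))

@[reducible] def stateTy : Ty := .prod localTy (.prod .real (.prod (.prod locTy walkTy) routeTy))

@[reducible] def labelTy : Ty := .prod .real routeTy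

/-! ### Programs for routes -/

/-- Concatenation of walks is a double reversal, since `revE` puts a reversed list in front of
another one. -/
def cutE : Prog (.prod legTy routeTy) routeTy :=
  foldE v0 nil (caseE v0
    (ite (natEqE (p1 v1) (p1 (up (up fst))))
      (single (pair (p1 (up (up fst))) (pair tt (pair (p1 (p2 (p2 v1)))
        (revE (revE (p2 (p2 (p2 (up (up fst))))) nil) (tailE (revE (p1 (p2 (p2 v1))) nil))))))) nil)
    (consE v3 v2))

theorem eval_cutE (x : (Ty.prod legTy routeTy).Val) :
    cutE.eval x = cutL x.1.1 x.1.2.2.2 x.2 := by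
  obtain ⟨g, R⟩ := x
  simp only [cutE, eval_foldE, cutL, eval_v0, eval_nil']
  congr 1
  funext s r
  rw [eval_caseE]
  cases s with
  | nil =>
    simp only [eval_v0, eval_ite', eval_natEqE, eval_p1, eval_v1, eval_up, eval_fst', eval_single,
      eval_pair', eval_tt', eval_p2, eval_revE, eval_nil', List.append_nil, List.reverse_reverse,
      eval_tailE]
  | cons x s => rfl

theorem good_cutE {g : LegData} {R : List RouteRec} (hR : R.length ≤ N)
    (hB : ∀ r ∈ R, r.2.2.1.length ≤ N) (hg : g.2.2.2.length ≤ N) :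
    cutE.Good size N (g, R) := by
  simp only [cutE, good_foldE, good_v0, good_nil', eval_v0, hR, true_and]
  refine LoopAll.of_forall (fun r hr s => ?_) _
  rw [good_caseE]
  refine ⟨good_v0, ?_⟩
  cases s with
  | nil =>
    have hBr := hB r hr
    simp only [eval_v0, good_ite', good_natEqE, good_p1, good_v1, good_up, good_fst', and_self,
      true_and]
    split_ifs
    · simp only [good_single, good_pair', good_p1, good_p2, good_up, good_fst', good_tt', good_v1,
        true_and]
      refine good_revE (good_revE (by simp) (by simp) (by simpa using hg))
        (good_tailE (good_revE (by simp) (by simp) (by simpa using hBr))) (by simpa using hg)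
    · trivial
  | cons x s => simp

def plainRecE (g : Prog γ legTy) : Prog γ (.prod .nat (.prod .bool (.prod walkTy walkTy))) :=
  pair (p1 g) (pair ff (pair (p2 (p1 (p2 g)))
    (consE (p1 (p2 (p2 g))) (single (p1 (p1 (p2 g)))))))

theorem good_plainRecE {g : Prog γ legTy} {x : γ.Val} (h : g.Good size N x) :
    (plainRecE g).Good size N x := by simp [plainRecE, h]

def pushE : Prog (.prod routeTy legTy) routeTy :=
  caseE fst (single (plainRecE snd))
    (ite (natEqE (p1 v1) (p1 (up (up snd))))
      (consE (pair (p1 v1) (pair (p1 (p2 v1)) (pair (p1 (p2 (p2 v1)))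
        (consE (p1 (p2 (p2 (up (up snd))))) (p2 (p2 (p2 v1))))))) v0)
      (caseE (revE (comp cutE (pair (up (up snd)) v0)) nil)
        (consE (plainRecE (up (up snd))) (consE v1 v0)) (consE v1 v0)))

theorem eval_pushE (x : (Ty.prod routeTy legTy).Val) : pushE.eval x = pushL x.1 x.2 := by
  obtain ⟨R, g⟩ := x
  rw [pushE, eval_caseE]
  cases R with
  | nil => rfl
  | cons r R =>
    simp only [eval_fst', eval_ite', eval_natEqE, eval_p1, eval_v1, eval_up, eval_snd', pushL]
    split_ifs with h
    · exact if_pos h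
    · refine (if_neg h).trans ?_
      rw [eval_caseE]
      simp only [eval_revE, eval_comp', eval_pair', eval_nil', eval_up, eval_snd', eval_v0,
        eval_cutE,         List.append_nil]
      cases (cutL g.1 g.2.2.2 R).reverse <;> rfl

theorem good_pushE {g : LegData} {R : List RouteRec} (hR : R.length ≤ N)
    (hB : ∀ r ∈ R, r.2.2.1.length ≤ N) (hg : g.2.2.2.length ≤ N) :
    pushE.Good size N (R, g) := by
  rw [pushE, good_caseE]
  refine ⟨good_fst', ?_⟩
  cases R with
  | nil =>
    rw [eval_fst', good_single]
    exact good_plainRecE good_snd'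
  | cons r R =>
    simp only [eval_fst', good_ite']
    refine ⟨by simp, ?_⟩
    split_ifs
    · simp
    · rw [good_caseE]
      constructor
      · refine good_revE ?_ (by simp) ?_
        · simp only [good_comp', good_pair', good_up, good_snd', good_v0, true_and]
          exact good_cutE ((Nat.le_succ _).trans hR)
            (fun r' hr' => hB r' (List.mem_cons_of_mem _ hr')) hg
        · simp only [eval_comp', eval_pair', eval_up, eval_snd', eval_v0, eval_cutE]
          rcases cutL_cases g.1 g.2.2.2 R with ⟨-, h⟩ | ⟨Q, r', R₀, h1, -, h2⟩
          · rw [h]; simp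
          · rw [← List.length_reverse, h2]
            have := congrArg List.length h1
            simp only [List.length_append, List.length_cons] at this hR ⊢
            omega
      · split
        · simp only [good_consE, good_v1, good_v0, and_true]
          exact good_plainRecE (by simp)
        · simp

def routeTripsE : Prog routeTy outputTy :=
  foldE id nil (consE (pair (p1 v1) (pair realZero (pair (revE (p1 (p2 (p2 v1))) nil)
    (revE (p2 (p2 (p2 v1))) nil)))) v0)

theorem eval_routeTripsE (R : List RouteRec) : routeTripsE.eval R = routeTrips R := by
  simp only [routeTripsE, eval_foldE, routeTrips, eval_id', eval_nil']
  congr 1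
  funext s r
  simp

theorem good_routeTripsE {R : List RouteRec} (hz : size 0 ≤ N) (hR : R.length ≤ N)
    (hB : ∀ r ∈ R, r.2.2.1.length ≤ N ∧ r.2.2.2.length ≤ N) : routeTripsE.Good size N R := by
  simp only [routeTripsE, good_foldE, good_id', good_nil', eval_id', hR, true_and]
  refine LoopAll.of_forall (fun r hr s => ?_) _
  have := hB r hr
  simp only [good_consE, good_pair', good_p1, good_v1, good_realZero', hz, good_v0, true_and,
    and_true]
  exact ⟨good_revE (by simp) (by simp) (by simpa using this.1),
    good_revE (by simp) (by simp) (by simpa using this.2)⟩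

/-! ### Programs for the package on an edge -/

def locE : Prog (.prod edgeTy .real) locTy :=
  ite (natLtE (p1 (p1 fst)) (p2 (p1 fst)))
    (pair (p1 (p1 fst)) (pair (p2 (p1 fst)) snd))
    (pair (p2 (p1 fst)) (pair (p1 (p1 fst)) (subE (p2 fst) snd)))

theorem eval_locE (x : (Ty.prod edgeTy .real).Val) : locE.eval x = locL x.1 x.2 := rfl

def backE : Prog (.prod (.prod edgeTy .real) localTy) walkTy :=
  ite (ltE (addE (p1 (p1 (p2 (p2 snd)))) (divE (p2 fst) (p1 (p2 snd))))
      (addE (p1 (p2 (p2 (p2 snd)))) (divE (subE (p2 (p1 fst)) (p2 fst)) (p1 (p2 snd)))))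
    (consE (comp locE fst) (p2 (p1 (p2 (p2 snd)))))
    (consE (comp locE fst) (p2 (p2 (p2 (p2 snd)))))

theorem eval_backE (x : (Ty.prod (.prod edgeTy .real) localTy).Val) :
    backE.eval x = backL x.1.1 x.1.2 x.2 := rfl

def meetE : Prog (.prod (.prod .real (.prod .real .real)) localTy) (.prod .real .real) :=
  letE (divE (subE (p1 (p1 (p2 (p2 snd)))) (p2 (p2 fst)))
    (subE (divE realOne (p1 (p2 fst))) (divE realOne (p1 (p2 snd)))))
  (letE (divE (subE (addE (p1 (p2 (p2 (p2 (up snd))))) (divE (p1 (up fst)) (p1 (p2 (up snd)))))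
        (p2 (p2 (up fst))))
      (addE (divE realOne (p1 (p2 (up fst)))) (divE realOne (p1 (p2 (up snd))))))
    (ite (ltE v1 v0) (pair v1 (p1 (p1 (p2 (p2 (up (up snd)))))))
      (pair v0 (addE (p1 (p2 (p2 (p2 (up (up snd))))))
        (divE (subE (p1 (up (up fst))) (mulE (addE realOne realOne) v0))
          (p1 (p2 (up (up snd)))))))))

theorem eval_meetE (x : (Ty.prod (.prod .real (.prod .real .real)) localTy).Val) :
    meetE.eval x = meetL x.1.1 x.1.2.1 x.1.2.2 x.2 := rfl

theorem good_meetE {Sz : ℕ → ℝ → Prop} {W : ℕ} (hS : SizeModel size Sz) {K : ℕ}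
    {l w A : ℝ} {q : LocalAgent}
    (hl : Sz W l) (hw : Sz W w) (hA : Sz K A) (hq : Sz W q.2.1 ∧ Sz W q.2.2.1.1 ∧ Sz W q.2.2.2.1)
    (hN : 2 * (K + 8 * W + 16) ≤ N) : meetE.Good size N ((l, (w, A)), q) := by
  obtain ⟨h1, h2, h3⟩ := hq
  have f : ∀ {M y}, Sz M y → M ≤ K + 8 * W + 16 → size y ≤ N :=
    fun h hM => (hS.size_le h).trans ((Nat.mul_le_mul_left 2 hM).trans hN)
  have a1 := hS.sub h2 hA
  have a2 := hS.div hS.one hw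
  have a3 := hS.div hS.one h1
  have a4 := hS.sub a2 a3
  have a5 := hS.div a1 a4
  have b1 := hS.div hl h1
  have b2 := hS.add h3 b1
  have b3 := hS.sub b2 hA
  have b4 := hS.add a2 a3
  have b5 := hS.div b3 b4
  have c1 := hS.add hS.one hS.one
  have c2 := hS.mul c1 b5
  have c3 := hS.sub hl c2
  have c4 := hS.div c3 h1
  have c5 := hS.add h3 c4
  have g1 := f h1 (by omega)
  have g2 := f h2 (by omega)
  have g3 := f h3 (by omega)
  have g4 := f hl (by omega)
  have g5 := f hw (by omega)
  have g6 := f hA (by omega)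
  have g7 := f hS.one (by omega)
  have k1 := f a1 (by omega)
  have k2 := f a2 (by omega)
  have k3 := f a3 (by omega)
  have k4 := f a4 (by omega)
  have k5 := f a5 (by omega)
  have l1 := f b1 (by omega)
  have l2 := f b2 (by omega)
  have l3 := f b3 (by omega)
  have l4 := f b4 (by omega)
  have l5 := f b5 (by omega)
  have m1 := f c1 (by omega)
  have m2 := f c2 (by omega)
  have m3 := f c3 (by omega)
  have m4 := f c4 (by omega)
  have m5 := f c5 (by omega)
  simp only [meetE, good_letE, good_divE, good_subE, good_p1, good_p2, good_snd', good_fst',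
    eval_p1, eval_p2, eval_snd', eval_fst', good_realOne', eval_realOne', eval_subE, eval_divE,
    eval_up, good_up, good_addE, eval_addE, good_ite', good_ltE, eval_v0, eval_v1, good_v0, good_v1,
    good_pair', good_mulE, eval_mulE, and_self, g1, g2, g3, g4, g5, g6, g7,
    k1, k2, k3, k4, k5, l1, l2, l3, l4, l5, m1, m2, m3, m4, m5, ite_self]

attribute [irreducible] meetE meetL

def handoverCandE : Prog (.prod (.prod (.prod edgeTy (.list localTy)) stateTy) localTy)
    (.list (.prod (.prod .real .real) (.prod localTy .real))) :=
  ite (ltE (p1 (p2 (p1 (up snd)))) (p1 (p2 v0)))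
    (letE (comp meetE (pair (pair (p2 (p1 (up fst)))
        (pair (p1 (p2 (p1 (up snd)))) (p1 (p2 (up snd))))) v0))
      (ite (ltE (p1 v0) (p2 (p1 (up (up fst)))))
        (single (pair (pair (p1 v0) (p1 (p2 v1))) (pair v1 (p2 v0)))) nil))
    nil

theorem eval_handoverCandE
    (x : (Ty.prod (.prod (.prod edgeTy (.list localTy)) stateTy) localTy).Val) :
    handoverCandE.eval x = if realLtB x.1.2.1.2.1 x.2.2.1 = true then
      if realLtB ((meetL x.1.1.1.2 x.1.2.1.2.1 x.1.2.2.1 x.2).1) x.1.1.1.2 = true then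
        [(((meetL x.1.1.1.2 x.1.2.1.2.1 x.1.2.2.1 x.2).1, x.2.2.1),
          (x.2, (meetL x.1.1.1.2 x.1.2.1.2.1 x.1.2.2.1 x.2).2))]
      else []
    else [] := by
  simp only [handoverCandE, eval_ite', eval_ltE, eval_p1, eval_p2, eval_up, eval_snd', eval_fst',
    eval_v0, eval_v1, eval_letE, eval_comp', eval_pair', eval_single, eval_nil', eval_meetE]
  rfl

def handoverCandsE : Prog (.prod (.prod edgeTy (.list localTy)) stateTy)
    (.list (.prod (.prod .real .real) (.prod localTy .real))) :=
  collectE (p2 fst) handoverCandE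

theorem eval_handoverCandsE (x : (Ty.prod (.prod edgeTy (.list localTy)) stateTy).Val) :
    handoverCandsE.eval x = handoverCandsL x.1.1 x.1.2 x.2 := by
  simp only [handoverCandsE, eval_collectE, handoverCandsL, eval_p2, eval_fst']
  congr 1
  funext q
  exact eval_handoverCandE _

def handoverE : Prog (.prod (.prod edgeTy (.list localTy)) stateTy) stateTy :=
  caseE (argminE handoverCandsE) snd
    (pair (p1 (p2 v1)) (pair (p2 (p2 v1))
      (pair (pair (comp locE (pair (p1 (up (up fst))) (p1 (p1 v1))))
          (comp backE (pair (pair (p1 (up (up fst))) (p1 (p1 v1))) (p1 (p2 v1)))))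
        (comp pushE (pair (p2 (p2 (p2 (up (up snd)))))
          (pair (p1 (p1 (up (up snd)))) (pair (p1 (p2 (p2 (up (up snd)))))
            (pair (comp locE (pair (p1 (up (up fst))) (p1 (p1 v1))))
              (comp backE (pair (pair (p1 (up (up fst))) (p1 (p1 v1)))
                (p1 (up (up snd)))))))))))))

theorem eval_handoverE (x : (Ty.prod (.prod edgeTy (.list localTy)) stateTy).Val) :
    handoverE.eval x = handoverL x.1.1 x.1.2 x.2 := by
  obtain ⟨⟨e, Q⟩, s⟩ := x
  rw [handoverE, eval_caseE, eval_argminE, eval_handoverCandsE, handoverL]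
  cases argminL (handoverCandsL e Q s) with
  | nil => rfl
  | cons b l =>
    simp only [eval_pair', eval_comp', eval_p1, eval_p2, eval_v1, eval_up, eval_fst', eval_snd',
      eval_locE, eval_backE, eval_pushE]

def enterCandsE : Prog (.prod (.list localTy) .real)
    (.list (.prod (.prod .real .real) localTy)) :=
  collectE fst (single (pair (pair
    (ite (ltE (up snd) (p1 (p1 (p2 (p2 v0))))) (p1 (p1 (p2 (p2 v0)))) (up snd))
    (p1 (p2 v0))) v0))

theorem eval_enterCandsE (x : (Ty.prod (.list localTy) .real).Val) :
    enterCandsE.eval x = enterCandsL x.1 x.2 := rfl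

def traverseE : Prog (.prod (.prod edgeTy (.list localTy)) labelTy) (.list labelTy) :=
  caseE (argminE (comp enterCandsE (pair (p2 fst) (p1 snd)))) nil
    (letE
      (foldE (p2 (up (up fst)))
        (pair (p2 v1) (pair (p1 (p1 v1)) (pair (pair (pair (p1 (p1 (p1 (up (up fst)))))
          (pair (p1 (p1 (p1 (up (up fst))))) realZero)) (p2 (p1 (p2 (p2 (p2 v1))))))
          (p2 (up (up snd))))))
        (comp handoverE (pair (up (up (up (up fst)))) v0)))
      (single (pair (addE (p1 (p2 v0)) (divE (p2 (p1 (up (up (up fst))))) (p1 (p2 (p1 v0)))))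
        (comp pushE (pair (p2 (p2 (p2 v0))) (pair (p1 (p1 v0)) (pair (p1 (p2 (p2 v0)))
          (pair (pair (p2 (p1 (p1 (up (up (up fst))))))
            (pair (p2 (p1 (p1 (up (up (up fst)))))) realZero))
            (p2 (p2 (p2 (p2 (p1 v0)))))))))))))

theorem eval_traverseE (x : (Ty.prod (.prod edgeTy (.list localTy)) labelTy).Val) :
    traverseE.eval x = traverseL x.1.1 x.1.2 x.2 := by
  obtain ⟨⟨e, Q⟩, c⟩ := x
  rw [traverseE, eval_caseE, eval_argminE, eval_comp', eval_pair']
  simp only [eval_p2, eval_fst', eval_p1, eval_snd', eval_enterCandsE, traverseL]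
  cases argminL (enterCandsL Q c.1) with
  | nil => rfl
  | cons b l =>
    simp only [eval_letE, eval_single, eval_foldE, eval_pair', eval_comp', eval_p1, eval_p2,
      eval_v1, eval_v0, eval_up, eval_fst', eval_snd', eval_handoverE, eval_pushE, eval_addE,
      eval_divE, eval_realZero']

/-! ### Bounds for lists and numbers while the package is on an edge -/

section GoodEdge

variable {I : Instance} {Sz : ℕ → ℝ → Prop} {W : ℕ} {ρ : Fin I.k → Fin I.n → ℝ} {b : ℕ}
  {u v : Fin I.n} {Q : List LocalAgent}

theorem good_backE (hS : SizeModel size Sz) {K : ℕ} {e : EdgeData} {x : ℝ} {q : LocalAgent}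
    (he : Sz W e.2) (hx : Sz K x) (hq : Sz W q.2.1 ∧ Sz W q.2.2.1.1 ∧ Sz W q.2.2.2.1)
    (hN : 2 * (K + 3 * W + 10) ≤ N) :
    locE.Good size N (e, x) ∧ backE.Good size N ((e, x), q) := by
  obtain ⟨h1, h2, h3⟩ := hq
  have f : ∀ {M y}, Sz M y → M ≤ K + 3 * W + 10 → size y ≤ N :=
    fun h hM => (hS.size_le h).trans ((Nat.mul_le_mul_left 2 hM).trans hN)
  have e1 := hS.div hx h1
  have e2 := hS.add h2 e1
  have e3 := hS.sub he hx
  have e4 := hS.div e3 h1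
  have e5 := hS.add h3 e4
  have f1 := f h1 (by omega)
  have f2 := f h2 (by omega)
  have f3 := f h3 (by omega)
  have f4 := f e1 (by omega)
  have f5 := f e2 (by omega)
  have f6 := f e3 (by omega)
  have f7 := f e4 (by omega)
  have f8 := f e5 (by omega)
  have f9 := f hx (by omega)
  have f10 := f he (by omega)
  have hl : locE.Good size N (e, x) := by simp [locE, f9, f10, f6]
  refine ⟨hl, ?_⟩
  simp [backE, hl, f1, f2, f3, f4, f5, f6, f7, f8, f9, f10]

theorem good_handoverE (hS : SizeModel size Sz) (H : EdgeHyp I Sz W ρ b u v Q) {j c K : ℕ}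
    {s : EdgeState} {x : ℝ} (h : EdgeInv I Sz ρ b u v Q j c K s x)
    (hQ : Q.length ≤ N) (hk : I.k ≤ N) (hb : b ≤ N) (hN1 : 1 ≤ N)
    (hN : 2 * (K + 11 * W + 30) ≤ N) :
    handoverE.Good size N ((I.edgeData u v, Q), s) := by
  have f : ∀ {M y}, Sz M y → M ≤ K + 11 * W + 30 → size y ≤ N :=
    fun h hM => (hS.size_le h).trans ((Nat.mul_le_mul_left 2 hM).trans hN)
  have hlen1 : ∀ q, (if realLtB s.1.2.1 q.2.1 = true then
      if realLtB ((meetL (I.edgeData u v).2 s.1.2.1 s.2.1 q).1) ((I.edgeData u v).2) = true then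
        [((((meetL (I.edgeData u v).2 s.1.2.1 s.2.1 q).1, q.2.1),
          (q, (meetL (I.edgeData u v).2 s.1.2.1 s.2.1 q).2)) : (ℝ × ℝ) × (LocalAgent × ℝ))]
      else []
    else []).length ≤ 1 := by
    intro q
    split_ifs <;> simp
  have hsl : Sz W (I.edgeData u v).2 := H.sz_len
  rw [handoverE, good_caseE]
  refine ⟨good_argminE ?_ ?_ ?_, ?_⟩
  · refine good_collectE (by simp) hQ fun q hq => ⟨?_, ?_⟩
    · rw [handoverCandE, good_ite']
      refine ⟨?_, ?_⟩
      · simp [f (H.sz _ h.mem).1 (by omega), f (H.sz q hq).1 (by omega)]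
      · split_ifs
        · rw [good_letE]
          refine ⟨?_, ?_⟩
          · simp only [good_comp', good_pair', good_p2, good_p1, good_up, good_fst', good_snd',
              good_v0, true_and]
            exact good_meetE hS hsl (H.sz _ h.mem).1 h.sz (H.sz q hq) (by omega)
          · have hm := sz_meetL hS hsl (H.sz _ h.mem).1 h.sz (H.sz q hq)
            simp only [good_ite', good_ltE, good_p1, good_v0, good_p2, good_up, good_fst',
              good_single, good_pair', good_v1, good_nil', ite_self, and_true, true_and, eval_p1,
              eval_p2, eval_v0, eval_up, eval_fst', eval_comp', eval_pair', eval_snd', eval_meetE]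
            exact ⟨f hm.1 (by omega), f hsl (by omega)⟩
        · trivial
    · rw [eval_handoverCandE]
      exact (hlen1 q).trans hN1
  · rw [eval_handoverCandsE]
    refine (length_collectL_le (m := 1) fun q _ => hlen1 q).trans ?_
    simpa using hQ
  · rw [eval_handoverCandsE]
    intro d hd
    obtain ⟨q, hq, -, -, rfl⟩ := mem_handoverCandsL.1 hd
    exact ⟨f (sz_meetL hS hsl (H.sz _ h.mem).1 h.sz (H.sz q hq)).1 (by omega),
      f (H.sz q hq).1 (by omega)⟩
  · rw [eval_argminE, eval_handoverCandsE]
    rcases argminL_cases (handoverCandsL (I.edgeData u v) Q s) with ⟨-, hm⟩ | ⟨d, hd, hm, -⟩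
    · rw [hm]; simp
    · rw [hm]
      obtain ⟨q, hq, -, hml, rfl⟩ := mem_handoverCandsL.1 hd
      have hsm := (sz_meetL hS hsl (H.sz _ h.mem).1 h.sz (H.sz q hq)).1
      have g1 := good_backE hS (N := N) hsl hsm (H.sz q hq) (by omega)
      have g2 := good_backE hS (N := N) hsl hsm (H.sz _ h.mem) (by omega)
      simp only [good_pair', good_comp', good_p1, good_p2, good_v1, good_up, good_fst', good_snd',
        eval_pair', eval_comp', eval_p1, eval_p2, eval_v1, eval_up, eval_fst', eval_snd', true_and,
        eval_locE, eval_backE, g1, g2]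
      refine good_pushE (h.route.length_le.trans hk) (fun r hr => (h.bd r hr).1.trans hb) ?_
      obtain ⟨a, ha⟩ := H.agent _ h.mem
      have : (backL (I.edgeData u v) (meetL (I.edgeData u v).2 s.1.2.1 s.2.1 q).1 s.1).length ≤
          b := by
        have h1 := ha.length_fst
        have h2 := ha.length_snd
        unfold backL
        split_ifs <;> simp only [List.length_cons] <;> omega
      exact this.trans hb

theorem good_traverseE (hS : SizeModel size Sz) (H : EdgeHyp I Sz W ρ b u v Q)
    {j c K : ℕ} {T : ℝ} {R : List RouteRec} (hQ : Q ≠ []) (hR : RouteInv I R (.node u) T)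
    (hj : shortcuts R ≤ j) (hk : shortcuts R ≤ I.k - 1) (hbd : RouteBd b c R) (hW : W ≤ K)
    (hT : Sz K T) (hbc : 2 * b ≤ c) (hc : 1 ≤ c) (hQN : Q.length ≤ N) (hkN : I.k ≤ N) (hb : b ≤ N)
    (hN : 2 * (K + (Q.length + 1) * (8 * W + 16) + 11 * W + 30) ≤ N) :
    traverseE.Good size N ((I.edgeData u v, Q), (T, R)) := by
  rw [add_mul, one_mul] at hN
  have f : ∀ {M y}, Sz M y → M ≤ K + (Q.length * (8 * W + 16) + (8 * W + 16)) + 11 * W + 30 →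
      size y ≤ N :=
    fun h hM => (hS.size_le h).trans ((Nat.mul_le_mul_left 2 hM).trans hN)
  have hsl : Sz W (I.edgeData u v).2 := H.sz_len
  have hN1 : 1 ≤ N := by omega
  obtain ⟨d, hd, hd1, hTd, hdQ, hinv⟩ := enter_inv hS H hQ hR hj hk hbd hW hT
  rw [traverseE, good_caseE]
  simp only [eval_argminE, eval_comp', eval_pair', eval_p2, eval_p1, eval_fst', eval_snd',
    eval_enterCandsE, hd1]
  refine ⟨good_argminE ?_ ?_ ?_, ?_⟩
  · rw [good_comp']
    refine ⟨by simp, good_collectE (by simp) hQN fun q hq => ⟨?_, by simpa using hN1⟩⟩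
    simp [f hT (by omega), f (H.sz q hq).2.1 (by omega)]
  · rw [eval_comp', eval_enterCandsE]
    refine (length_collectL_le (m := 1) fun q _ => by simp).trans ?_
    simpa using hQN
  · rw [eval_comp', eval_enterCandsE]
    intro d' hd'
    obtain ⟨q, hq, hd'⟩ := mem_collectL.1 hd'
    rw [List.mem_singleton] at hd'
    subst hd'
    refine ⟨?_, f (H.sz q hq).1 (by omega)⟩
    dsimp only
    split_ifs
    · exact f (H.sz q hq).2.1 (by omega)
    · exact f hT (by omega)
  · rw [good_letE]
    constructor
    · simp only [good_foldE, good_p2, good_up, good_fst', eval_p2, eval_up, eval_fst', good_pair',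
        good_v1, good_p1, good_realZero', good_snd', good_comp', good_v0, eval_pair', eval_v0,
        eval_comp', true_and, and_true, eval_v1, eval_p1, eval_realZero', eval_snd']
      refine ⟨f hS.zero (by omega), hQN, ?_⟩
      -- The number `i` of completed passes is recorded, as each pass may enlarge the size of the
      -- current time by `8 * W + 16`.
      refine LoopAll.of_inv (fun l s => ∃ x i, i + l.length = Q.length ∧
        EdgeInv I Sz ρ b u v Q j (c + i) (K + i * (8 * W + 16)) s x) ?_ _ _
        ⟨0, 0, by simp, hinv.mono hS (by omega) (by omega)⟩
      rintro q l s ⟨x, i, hi, hs⟩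
      rw [List.length_cons] at hi
      have hi' : i * (8 * W + 16) ≤ Q.length * (8 * W + 16) := Nat.mul_le_mul_right _ (by omega)
      refine ⟨good_handoverE hS H hs hQN hkN hb hN1 (by omega), ?_⟩
      rw [eval_handoverE]
      rcases hs.step hS H (by omega) (by omega) with ⟨h1, -⟩ | ⟨m, -, -, -, -, -, h1⟩
      · rw [h1]
        exact ⟨x, i + 1, by omega, hs.mono hS (by omega) (by rw [add_mul]; omega)⟩
      · exact ⟨m, i + 1, by omega, h1.mono hS (by omega) (by rw [add_mul]; omega)⟩
    · obtain ⟨x, s, hs, hinv', -⟩ := hinv.loop hS H Q hbc hc List.countP_le_length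
      have hev : Q.foldl (fun s q => handoverE.eval ((I.edgeData u v, Q), s))
          (d.2, (d.1.1, ((((u : ℕ), ((u : ℕ), (0 : ℝ))), d.2.2.2.1.2), R))) = s := by
        rw [← hs]
        congr 1
        funext s q
        exact eval_handoverE _
      simp only [eval_foldE, eval_p2, eval_up, eval_fst', eval_pair', eval_v1, eval_p1,
        eval_realZero', eval_snd', eval_comp', eval_v0, edgeData] at hev ⊢
      rw [hev]
      obtain ⟨a, ha⟩ := H.agent _ hinv'.mem
      have hdv := hS.div hsl (H.sz _ hinv'.mem).1
      have hs1 := f hdv (by omega)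
      have hs2 := f (hS.add hinv'.sz hdv) (by omega)
      have hs3 := f (H.sz _ hinv'.mem).1 (by omega)
      have hs4 := f hsl (by omega)
      have hs5 := f hinv'.sz (by omega)
      have hs6 := f hS.zero (by omega)
      have hp := good_pushE (size := size) (N := N) (R := s.2.2.2)
        (g := (s.1.1, (s.2.2.1, (((v : ℕ), ((v : ℕ), (0 : ℝ))), s.1.2.2.2.2))))
        (hinv'.route.length_le.trans hkN)
        (fun r hr => (hinv'.bd r hr).1.trans hb) (ha.length_snd.le.trans hb)
      simp only [edgeData] at hs1 hs2 hs4
      simp [hs1, hs2, hs3, hs4, hs5, hs6, hp]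

end GoodEdge

end Prog

namespace Instance

/-! ### Tables of earliest times -/

section TimeAt

variable {A : Type}

open Classical in
/-- The time of a node in a table. -/
noncomputable def timeAt (S : List (ℕ × (ℝ × A))) (u : ℕ) : ℝ :=
  if h : ∃ e ∈ S, e.1 = u then h.choose.2.1 else 0

theorem timeAt_eq {S : List (ℕ × (ℝ × A))} (h : (S.map Prod.fst).Nodup) {e : ℕ × (ℝ × A)}
    (he : e ∈ S) : timeAt S e.1 = e.2.1 := by
  have hx : ∃ e' ∈ S, e'.1 = e.1 := ⟨e, he, rfl⟩
  rw [timeAt, dif_pos hx, List.inj_on_of_nodup_map h hx.choose_spec.1 he hx.choose_spec.2]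

end TimeAt

theorem closed_of_connected {V : Type} {G : SimpleGraph V} (hG : G.Connected) {P : V → Prop} {u : V}
    (hu : P u) (h : ∀ v w, G.Adj v w → P v → P w) (v : V) : P v := by
  have := (SimpleGraph.reachable_iff_reflTransGen u v).1 (hG.preconnected u v)
  induction this with
  | refl => exact hu
  | tail _ hvw ih => exact h _ _ hvw ih

theorem mem_edgeList {n : ℕ} {Adj : Fin n → Fin n → Prop} {e : Fin n × Fin n} :
    e ∈ edgeList Adj ↔ e.1 < e.2 ∧ Adj e.1 e.2 := by
  obtain ⟨u, v⟩ := e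
  simp [edgeList, List.pair_mem_product]

theorem length_edgeList_le {n : ℕ} (Adj : Fin n → Fin n → Prop) :
    (edgeList Adj).length ≤ n * n := by
  refine (List.length_filter_le _ _).trans ?_
  simp [List.product]

variable {I : Instance}

noncomputable def edgesL (I : Instance) : List EdgeData :=
  (edgeList I.G.Adj).map (fun e => I.edgeData e.1 e.2)

noncomputable def rangeEdges (I : Instance) (a : Fin I.k) : List (ℕ × ℕ) :=
  (edgeList (I.range a).Adj).map (fun e => ((e.1 : ℕ), (e.2 : ℕ)))

def nodesL (I : Instance) : List ℕ := (List.finRange I.n).map (fun v => (v : ℕ))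

/-- Both orientations of the edges. -/
noncomputable def orientL (E : List EdgeData) : List EdgeData :=
  collectL (fun e => [e, ((e.1.2, e.1.1), e.2)]) E

/-- Both orientations of the edges in a list of pairs of nodes. -/
noncomputable def subEdgesL (E : List EdgeData) (F : List (ℕ × ℕ)) : List EdgeData :=
  collectL (fun e => collectL (fun f =>
    if natEqB e.1.1 f.1 = true then
      if natEqB e.1.2 f.2 = true then [e, ((e.1.2, e.1.1), e.2)] else []
    else []) F) E

theorem edgeData_swap (u v : Fin I.n) :
    (((v : ℕ), (u : ℕ)), I.len s(u, v)) = I.edgeData v u := by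
  rw [edgeData, Sym2.eq_swap]

theorem mem_orientL {d : EdgeData} :
    d ∈ orientL I.edgesL ↔ ∃ u v, I.G.Adj u v ∧ d = I.edgeData u v := by
  simp only [orientL, mem_collectL, edgesL, List.mem_map, mem_edgeList]
  constructor
  · rintro ⟨_, ⟨⟨u, v⟩, ⟨-, h⟩, rfl⟩, hd⟩
    simp only [List.mem_cons, List.not_mem_nil, or_false] at hd
    rcases hd with rfl | rfl
    · exact ⟨u, v, h, rfl⟩
    · exact ⟨v, u, h.symm, edgeData_swap u v⟩
  · rintro ⟨u, v, h, rfl⟩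
    rcases lt_or_gt_of_ne h.ne with huv | huv
    · exact ⟨_, ⟨(u, v), ⟨huv, h⟩, rfl⟩, by simp⟩
    · refine ⟨_, ⟨(v, u), ⟨huv, h.symm⟩, rfl⟩, ?_⟩
      simp only [List.mem_cons, List.not_mem_nil, or_false]
      exact Or.inr (edgeData_swap v u).symm

theorem mem_subEdgesL {a : Fin I.k} {d : EdgeData} :
    d ∈ subEdgesL I.edgesL (I.rangeEdges a) ↔
      ∃ u v, (I.range a).Adj u v ∧ d = I.edgeData u v := by
  simp only [subEdgesL, mem_collectL, edgesL, rangeEdges, List.mem_map, mem_edgeList]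
  constructor
  · rintro ⟨_, ⟨⟨u, v⟩, ⟨-, h⟩, rfl⟩, _, ⟨⟨u', v'⟩, ⟨-, h'⟩, rfl⟩, hd⟩
    split_ifs at hd with h1 h2
    · obtain rfl : u = u' := Fin.ext (natEqB_iff.1 h1)
      obtain rfl : v = v' := Fin.ext (natEqB_iff.1 h2)
      simp only [List.mem_cons, List.not_mem_nil, or_false] at hd
      rcases hd with rfl | rfl
      · exact ⟨u, v, h', rfl⟩
      · exact ⟨v, u, h'.symm, edgeData_swap u v⟩
    · cases hd
    · cases hd
  · rintro ⟨u, v, h, rfl⟩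
    rcases lt_or_gt_of_ne h.adj_sub.ne with huv | huv
    · exact ⟨_, ⟨(u, v), ⟨huv, h.adj_sub⟩, rfl⟩, _, ⟨(u, v), ⟨huv, h⟩, rfl⟩, by simp [edgeData]⟩
    · refine ⟨_, ⟨(v, u), ⟨huv, h.adj_sub.symm⟩, rfl⟩, _, ⟨(v, u), ⟨huv, h.symm⟩, rfl⟩, ?_⟩
      simp only [edgeData, natEqB_iff.2, if_true, List.mem_cons, List.not_mem_nil, or_false]
      exact Or.inr (edgeData_swap v u).symm

theorem length_edgesL_le : I.edgesL.length ≤ I.n * I.n := by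
  simpa [edgesL] using length_edgeList_le I.G.Adj

theorem length_rangeEdges_le (a : Fin I.k) : (I.rangeEdges a).length ≤ I.n * I.n := by
  simpa [rangeEdges] using length_edgeList_le (I.range a).Adj

theorem length_orientL_le : (orientL I.edgesL).length ≤ I.n * I.n * 2 :=
  (length_collectL_le (m := 2) fun _ _ => by simp).trans
    (Nat.mul_le_mul_right 2 length_edgesL_le)

theorem length_subEdgesL_inner_le (e : EdgeData) (F : List (ℕ × ℕ)) :
    (collectL (fun f : ℕ × ℕ =>
      if natEqB e.1.1 f.1 = true then
        if natEqB e.1.2 f.2 = true then [e, ((e.1.2, e.1.1), e.2)] else []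
      else []) F).length ≤ F.length * 2 := by
  refine length_collectL_le fun f _ => ?_
  split_ifs <;> simp

theorem length_subEdgesL_le (a : Fin I.k) : (subEdgesL I.edgesL (I.rangeEdges a)).length ≤
    I.n * I.n * (I.n * I.n * 2) :=
  (length_collectL_le fun e _ => (length_subEdgesL_inner_le e _).trans
    (Nat.mul_le_mul_right 2 (length_rangeEdges_le a))).trans
    (Nat.mul_le_mul_right _ length_edgesL_le)

/-! ### Earliest times of an agent -/

noncomputable def relaxAgentL (w : ℝ) (d : EdgeData) (c : ℝ × RawWalkData) :
    List (ℝ × RawWalkData) :=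
  [(c.1 + d.2 / w, (d.1.2, (d.1.2, (0 : ℝ))) :: c.2)]

noncomputable def agentTable (I : Instance) (a : Fin I.k) : List (ℕ × (ℝ × RawWalkData)) :=
  primL (relaxAgentL (I.vel a)) (subEdgesL I.edgesL (I.rangeEdges a)) I.nodesL
    ((I.pos a : ℕ), ((0 : ℝ), [((I.pos a : ℕ), ((I.pos a : ℕ), (0 : ℝ)))]))

/-- The earliest time of an agent at a node. -/
noncomputable def agentTime (I : Instance) (a : Fin I.k) (u : Fin I.n) : ℝ :=
  timeAt (I.agentTable a) u

/-- Bounds for all data of an instance. -/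
structure Bounded (I : Instance) (Sz : ℕ → ℝ → Prop) (s : ℕ) : Prop where
  n_le : I.n ≤ s
  k_le : I.k ≤ s
  len : ∀ u v, I.G.Adj u v → Sz s (I.len s(u, v))
  vel : ∀ a, Sz s (I.vel a)

/-- Every edge adds one quotient of a length and a velocity, of size at most `2 * s + 1`, and one
addition. The stored walk goes from the node back to the initial position, and its length divided by
the velocity is the time. -/
def AgentVal (I : Instance) (Sz : ℕ → ℝ → Prop) (s : ℕ) (a : Fin I.k) (j u : ℕ)
    (c : ℝ × RawWalkData) : Prop :=
  ∃ u' : Fin I.n, u = u' ∧ I.RawWalk a c.2 (.node u') (.node (I.pos a)) (I.vel a * c.1) ∧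
    c.2.length ≤ j + 1 ∧ Sz ((j + 1) * (2 * s + 2)) c.1

section Agent

variable {size : ℝ → ℕ} {Sz : ℕ → ℝ → Prop} {s : ℕ}

theorem Bounded.one_le (hI : I.Bounded Sz s) : 1 ≤ s := I.k_pos.trans hI.k_le

theorem agent_hyp (hS : SizeModel size Sz) (hI : I.Bounded Sz s) (a : Fin I.k) :
    PrimHyp (relaxAgentL (I.vel a)) (subEdgesL I.edgesL (I.rangeEdges a)) (AgentVal I Sz s a) I.n
      ((I.pos a : ℕ), ((0 : ℝ), [((I.pos a : ℕ), ((I.pos a : ℕ), (0 : ℝ)))])) where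
  mono := by
    rintro j u c ⟨u', h1, h2, h3, h4⟩
    exact ⟨u', h1, h2, by omega, hS.mono h4 (Nat.mul_le_mul_right _ (by omega))⟩
  relax := by
    rintro j c d hd ⟨u', h1, h2, h3, h4⟩ c' hc'
    obtain ⟨u, v, hadj, rfl⟩ := mem_subEdgesL.1 hd
    obtain rfl : u = u' := Fin.ext h1
    obtain rfl := List.mem_singleton.1 hc'
    have hv := I.vel_pos a
    have hl : 0 ≤ I.len s(u, v) := I.len_nonneg _ hadj.adj_sub
    refine ⟨⟨v, rfl, ?_, by simpa using h3, ?_⟩, ?_⟩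
    · have h5 := h2.cons (r := .node v) hadj.symm trivial
      have e : I.vel a * (c.1 + (I.edgeData u v).2 / I.vel a) =
          I.segLen (.node v) (.node u) + I.vel a * c.1 := by
        rw [mul_add, mul_div_cancel₀ _ hv.ne', add_comm, segLen, edgeData, Sym2.eq_swap]
      rw [e]
      exact h5
    · refine hS.mono (hS.add h4 (hS.div (hI.len u v hadj.adj_sub) (hI.vel a))) ?_
      rw [add_mul (j + 1), one_mul]
      omega
    · have : 0 ≤ I.len s(u, v) / I.vel a := by positivity
      simpa [edgeData] using this
  first := ⟨I.pos a, rfl, by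
    have := RawWalk.singleton a (p := .node (I.pos a)) trivial
    simpa [encodeLoc] using this, by simp, hS.mono hS.zero (by omega)⟩
  lt := by
    rintro j u c ⟨u', rfl, -⟩
    exact u'.2

theorem subEdgesL_ne (a : Fin I.k) : ∀ d ∈ subEdgesL I.edgesL (I.rangeEdges a), d.1.1 ≠ d.1.2 := by
  intro d hd
  obtain ⟨u, v, hadj, rfl⟩ := mem_subEdgesL.1 hd
  exact fun h => hadj.adj_sub.ne (Fin.ext h)

theorem orientL_ne : ∀ d ∈ orientL I.edgesL, d.1.1 ≠ d.1.2 := by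
  intro d hd
  obtain ⟨u, v, hadj, rfl⟩ := mem_orientL.1 hd
  exact fun h => hadj.ne (Fin.ext h)

theorem length_nodesL : I.nodesL.length = I.n := by simp [nodesL]

/-- As the range is connected, all of its nodes get settled. Outside the range `agentTime` has the
default value 0, which is harmless because inequalities are only claimed along edges of the range.
-/
theorem agentTable_spec (hS : SizeModel size Sz) (hI : I.Bounded Sz s) (a : Fin I.k) :
    (I.agentTable a).length ≤ I.n ∧
    (∀ e ∈ I.agentTable a, ∃ u : Fin I.n, e.1 = u ∧ e.2.1 = I.agentTime a u ∧
      I.RawWalk a e.2.2 (.node u) (.node (I.pos a)) (I.vel a * I.agentTime a u) ∧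
      e.2.2.length ≤ I.n ∧ Sz (s * (2 * s + 2)) e.2.1) ∧
    (∀ u ∈ (I.range a).verts, ∃ e ∈ I.agentTable a, e.1 = u) ∧
    I.agentTime a (I.pos a) = 0 ∧
    ∀ u v, (I.range a).Adj u v → I.agentTime a v ≤ I.agentTime a u + I.len s(u, v) / I.vel a := by
  have H := agent_hyp hS hI a
  obtain ⟨h1, h2⟩ := primL_spec H (subEdgesL_ne a) length_nodesL
  have hlen := h1.length_le H
  have hpos := h1.length_pos
  have htime : ∀ e ∈ I.agentTable a, ∀ u : Fin I.n, e.1 = u → e.2.1 = I.agentTime a u := by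
    intro e he u hu
    rw [agentTime, ← hu]
    exact (timeAt_eq h1.nodup he).symm
  have hstep : ∀ u v : Fin I.n, (I.range a).Adj u v → ∀ e ∈ I.agentTable a, e.1 = u →
      ∃ e' ∈ I.agentTable a, e'.1 = v ∧ e'.2.1 ≤ e.2.1 + I.len s(u, v) / I.vel a :=
    fun u v hadj e he heu => h2 e he _ (mem_subEdgesL.2 ⟨u, v, hadj, rfl⟩) heu.symm _
      (List.mem_singleton_self _)
  have hall : ∀ u ∈ (I.range a).verts, ∃ e ∈ I.agentTable a, e.1 = u := by
    intro u hu
    refine closed_of_connected (I.range_connected a).coe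
      (P := fun u => ∃ e ∈ I.agentTable a, e.1 = (u : Fin I.n)) (u := ⟨I.pos a, I.pos_mem a⟩)
      ⟨_, h1.first_mem, rfl⟩ ?_ ⟨u, hu⟩
    rintro ⟨v, hv⟩ ⟨w, hw⟩ hvw ⟨e, he, hev⟩
    obtain ⟨e', he', h3, -⟩ := hstep v w hvw e he hev
    exact ⟨e', he', h3⟩
  refine ⟨hlen, ?_, hall, ?_, ?_⟩
  · intro e he
    obtain ⟨u, h3, h4, h5, h6⟩ := h1.val e he
    have h7 := htime e he u h3
    have hn := hI.n_le
    rw [Nat.sub_add_cancel hpos] at h5 h6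
    exact ⟨u, h3, h7, h7 ▸ h4, h5.trans hlen,
      hS.mono h6 (Nat.mul_le_mul_right _ (hlen.trans hn))⟩
  · exact (htime _ h1.first_mem _ rfl).symm
  · intro u v hadj
    obtain ⟨e, he, heu⟩ := hall u ((I.range a).edge_vert hadj)
    obtain ⟨e', he', h3, h4⟩ := hstep u v hadj e he heu
    rwa [htime e he u heu, htime e' he' v h3] at h4

end Agent

/-! ### The agents on an edge -/

/-- An agent, its velocity, the edges of its range, and the table of its earliest times. -/
abbrev AgentData := ℕ × (ℝ × (List EdgeData × List (ℕ × (ℝ × RawWalkData))))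

noncomputable def agentData (I : Instance) (a : Fin I.k) : AgentData :=
  ((a : ℕ), (I.vel a, (subEdgesL I.edgesL (I.rangeEdges a), I.agentTable a)))

noncomputable def localOfL (u v : ℕ) (A : AgentData) : List LocalAgent :=
  collectL (fun e => if natEqB e.1 u = true then
    collectL (fun e' => if natEqB e'.1 v = true then [(A.1, (A.2.1, (e.2, e'.2)))] else []) A.2.2.2
    else []) A.2.2.2

noncomputable def localMatchL (d : EdgeData) (A : AgentData) : List LocalAgent :=
  collectL (fun d' =>
    if natEqB d'.1.1 d.1.1 = true then
      if natEqB d'.1.2 d.1.2 = true then localOfL d.1.1 d.1.2 A else []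
    else []) A.2.2.1

noncomputable def localAgentsL (L : List AgentData) (d : EdgeData) : List LocalAgent :=
  collectL (localMatchL d) L

section Local

variable {size : ℝ → ℕ} {Sz : ℕ → ℝ → Prop} {s : ℕ} {L : List AgentData}

theorem mem_localOfL {u v : ℕ} {A : AgentData} {q : LocalAgent} : q ∈ localOfL u v A ↔
    ∃ e ∈ A.2.2.2, ∃ e' ∈ A.2.2.2, e.1 = u ∧ e'.1 = v ∧ q = (A.1, (A.2.1, (e.2, e'.2))) := by
  simp only [localOfL, mem_collectL]
  constructor
  · rintro ⟨e, he, hq⟩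
    split_ifs at hq with h1
    · obtain ⟨e', he', hq⟩ := mem_collectL.1 hq
      split_ifs at hq with h2
      · exact ⟨e, he, e', he', natEqB_iff.1 h1, natEqB_iff.1 h2, List.mem_singleton.1 hq⟩
      · cases hq
    · cases hq
  · rintro ⟨e, he, e', he', h1, h2, rfl⟩
    refine ⟨e, he, ?_⟩
    rw [if_pos (natEqB_iff.2 h1), mem_collectL]
    exact ⟨e', he', by simp [h2]⟩

theorem length_localOfL_le (u v : ℕ) (A : AgentData) :
    (∀ e : ℕ × (ℝ × RawWalkData), (collectL (fun e' => if natEqB e'.1 v = true then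
      [((A.1, (A.2.1, (e.2, e'.2))) : LocalAgent)] else []) A.2.2.2).length ≤ A.2.2.2.length) ∧
    (localOfL u v A).length ≤ A.2.2.2.length * A.2.2.2.length := by
  have h : ∀ e : ℕ × (ℝ × RawWalkData), (collectL (fun e' => if natEqB e'.1 v = true then
      [((A.1, (A.2.1, (e.2, e'.2))) : LocalAgent)] else []) A.2.2.2).length ≤
      A.2.2.2.length := by
    intro e
    refine (length_collectL_le (m := 1) fun e' _ => ?_).trans (by simp)
    split_ifs <;> simp
  refine ⟨h, length_collectL_le fun e _ => ?_⟩
  split_ifs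
  · exact h e
  · simp

theorem mem_localAgentsL (hL : ∀ A, A ∈ L ↔ ∃ a, A = I.agentData a) {u v : Fin I.n}
    {q : LocalAgent} : q ∈ localAgentsL L (I.edgeData u v) ↔
      ∃ a, (I.range a).Adj u v ∧ q ∈ localOfL u v (I.agentData a) := by
  simp only [localAgentsL, localMatchL, mem_collectL]
  constructor
  · rintro ⟨A, hA, d, hd, hq⟩
    obtain ⟨a, rfl⟩ := (hL A).1 hA
    obtain ⟨u', v', hadj, rfl⟩ := mem_subEdgesL.1 hd
    split_ifs at hq with h1 h2
    · obtain rfl : u' = u := Fin.ext (natEqB_iff.1 h1)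
      obtain rfl : v' = v := Fin.ext (natEqB_iff.1 h2)
      exact ⟨a, hadj, hq⟩
    · cases hq
    · cases hq
  · rintro ⟨a, hadj, hq⟩
    refine ⟨_, (hL _).2 ⟨a, rfl⟩, _, mem_subEdgesL.2 ⟨u, v, hadj, rfl⟩, ?_⟩
    rw [if_pos (natEqB_iff.2 rfl), if_pos (natEqB_iff.2 rfl)]
    exact hq

theorem edgeHyp (hS : SizeModel size Sz) (hI : I.Bounded Sz s)
    (hL : ∀ A, A ∈ L ↔ ∃ a, A = I.agentData a) {u v : Fin I.n} (huv : I.G.Adj u v) :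
    EdgeHyp I Sz (s * (2 * s + 2)) I.agentTime (s + 1) u v (localAgentsL L (I.edgeData u v)) := by
  have hn := hI.n_le
  have hsW : s ≤ s * (2 * s + 2) := Nat.le_mul_of_pos_right _ (by omega)
  have hloc : ∀ q ∈ localAgentsL L (I.edgeData u v), ∃ a,
      IsLocal I I.agentTime (s + 1) u v a q ∧ Sz (s * (2 * s + 2)) q.2.1 ∧
        Sz (s * (2 * s + 2)) q.2.2.1.1 ∧ Sz (s * (2 * s + 2)) q.2.2.2.1 := by
    intro q hq
    obtain ⟨a, hadj, hq⟩ := (mem_localAgentsL hL).1 hq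
    obtain ⟨e, he, e', he', h1, h2, rfl⟩ := mem_localOfL.1 hq
    obtain ⟨-, h3, -⟩ := agentTable_spec hS hI a
    obtain ⟨u', h4, h5, h6, h7, h8⟩ := h3 e he
    obtain ⟨v', k4, k5, k6, k7, k8⟩ := h3 e' he'
    obtain rfl : u' = u := Fin.ext (h4.symm.trans h1)
    obtain rfl : v' = v := Fin.ext (k4.symm.trans h2)
    exact ⟨a, ⟨rfl, rfl, hadj, h5, k5, h6, k6, Nat.lt_succ_of_le (h7.trans hn),
      Nat.lt_succ_of_le (k7.trans hn)⟩, hS.mono (hI.vel a) hsW, h8, k8⟩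
  refine ⟨fun a => (agentTable_spec hS hI a).2.2.2.2, huv, fun q hq => ?_, fun a hadj => ?_,
    hS.mono (hI.len u v huv) hsW, fun q hq => ?_⟩
  · obtain ⟨a, ha, -⟩ := hloc q hq
    exact ⟨a, ha⟩
  · obtain ⟨-, h3, h4, -⟩ := agentTable_spec hS hI a
    obtain ⟨e, he, heu⟩ := h4 u ((I.range a).edge_vert hadj)
    obtain ⟨e', he', hev⟩ := h4 v ((I.range a).edge_vert hadj.symm)
    have hmem : (_ : LocalAgent) ∈ localAgentsL L (I.edgeData u v) :=
      (mem_localAgentsL hL).2 ⟨a, hadj, mem_localOfL.2 ⟨e, he, e', he', heu, hev, rfl⟩⟩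
    refine ⟨_, hmem, ?_⟩
    obtain ⟨a', ha', -⟩ := hloc _ hmem
    obtain rfl : a = a' := Fin.ext ha'.id
    exact ha'
  · obtain ⟨a, -, h⟩ := hloc q hq
    exact h

/-- The ranges cover the graph, so every edge can be crossed by somebody; without this the
relaxation of an edge would be empty. -/
theorem localAgentsL_ne_nil (hS : SizeModel size Sz) (hI : I.Bounded Sz s)
    (hL : ∀ A, A ∈ L ↔ ∃ a, A = I.agentData a) {u v : Fin I.n} (huv : I.G.Adj u v) :
    localAgentsL L (I.edgeData u v) ≠ [] := by
  have h : (⨆ a, I.range a).Adj u v := by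
    rw [I.range_cover]
    exact huv
  rw [SimpleGraph.Subgraph.iSup_adj] at h
  obtain ⟨a, ha⟩ := h
  obtain ⟨q, hq, -⟩ := (edgeHyp hS hI hL huv).complete a ha
  exact List.ne_nil_of_mem hq

/-- A crude count without regard to repetitions: at most `2 * s ^ 4` oriented edges of a range, each
with `s ^ 2` pairs of table entries, for each of at most `s` agents. -/
theorem length_localAgentsL_le (hS : SizeModel size Sz) (hI : I.Bounded Sz s)
    (hL : ∀ A, A ∈ L ↔ ∃ a, A = I.agentData a) (hk : L.length = I.k) (d : EdgeData) :
    (∀ A ∈ L, (localMatchL d A).length ≤ 2 * s ^ 6) ∧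
    (localAgentsL L d).length ≤ 2 * s ^ 7 := by
  have hn := hI.n_le
  have h : ∀ A ∈ L, (localMatchL d A).length ≤ 2 * s ^ 6 := by
    intro A hA
    obtain ⟨a, rfl⟩ := (hL A).1 hA
    refine (length_collectL_le (m := s * s) fun d' _ => ?_).trans ?_
    · have h1 := (length_localOfL_le d.1.1 d.1.2 (I.agentData a)).2
      have h2 : (I.agentTable a).length ≤ s := (agentTable_spec hS hI a).1.trans hn
      split_ifs
      · exact h1.trans (Nat.mul_le_mul h2 h2)
      · simp
      · simp
    · calc (subEdgesL I.edgesL (I.rangeEdges a)).length * (s * s)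
          ≤ (s * s * (s * s * 2)) * (s * s) := by
            gcongr
            exact (length_subEdgesL_le a).trans (by gcongr)
        _ = 2 * s ^ 6 := by ring
  refine ⟨h, (length_collectL_le h).trans ?_⟩
  calc L.length * (2 * s ^ 6) ≤ s * (2 * s ^ 6) := by
        rw [hk]
        gcongr
        exact hI.k_le
    _ = 2 * s ^ 7 := by ring

end Local

/-! ### Earliest times of the package -/

noncomputable def packageTable (I : Instance) (L : List AgentData) :
    List (ℕ × (ℝ × List RouteRec)) :=
  primL (fun d c => traverseL d (localAgentsL L d) c) (orientL I.edgesL) I.nodesL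
    ((I.source : ℕ), ((0 : ℝ), []))

/-- The level `j` bounds the number of edges behind the label, hence the shortcuts. Walks start with
the bound `2 * (s + 1)` that shortcuts need, and get longer with each leg, of which an edge has at
most `2 * s ^ 7 + 1`. -/
def PackageVal (I : Instance) (Sz : ℕ → ℝ → Prop) (s j u : ℕ) (c : ℝ × List RouteRec) : Prop :=
  ∃ u' : Fin I.n, u = u' ∧ RouteInv I c.2 (.node u') c.1 ∧ shortcuts c.2 ≤ j ∧
    shortcuts c.2 ≤ I.k - 1 ∧ RouteBd (s + 1) (2 * (s + 1) + j * (2 * s ^ 7 + 1)) c.2 ∧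
    Sz (s * (2 * s + 2) + j * ((2 * s ^ 7 + 1) * (8 * (s * (2 * s + 2)) + 16))) c.1

section Package

variable {size : ℝ → ℕ} {Sz : ℕ → ℝ → Prop} {s : ℕ} {L : List AgentData}

theorem package_step (hS : SizeModel size Sz) (hI : I.Bounded Sz s)
    (hL : ∀ A, A ∈ L ↔ ∃ a, A = I.agentData a) (hk : L.length = I.k) {u v : Fin I.n}
    (huv : I.G.Adj u v) {j : ℕ} {c : ℝ × List RouteRec} (hc : PackageVal I Sz s j u c) :
    ∃ c', traverseL (I.edgeData u v) (localAgentsL L (I.edgeData u v)) c = [c'] ∧ c.1 ≤ c'.1 ∧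
      PackageVal I Sz s (j + 1) v c' ∧
      ∀ t : Fin I.n → ℝ, t u = c.1 → t v ≤ c'.1 → ∃ τ, IsTraj I I.agentTime t u v τ := by
  obtain ⟨u', h1, h2, h3, h4, h5, h6⟩ := hc
  obtain rfl : u = u' := Fin.ext h1
  have hlen := (length_localAgentsL_le hS hI hL hk (I.edgeData u v)).2
  obtain ⟨T', R', e1, e2, e3, e4, e5, e6, e7, e8⟩ := traverseL_spec hS (edgeHyp hS hI hL huv)
    (localAgentsL_ne_nil hS hI hL huv) h2 h3 h4 h5 (by omega) h6 (by omega) (by omega)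
  refine ⟨(T', R'), e1, e2, ⟨v, rfl, e3, e4, e5, e6.mono ?_, hS.mono e7 ?_⟩, e8⟩
  · rw [add_mul j, one_mul]
    omega
  · rw [add_mul j, one_mul, ← add_assoc]
    gcongr

theorem package_hyp (hS : SizeModel size Sz) (hI : I.Bounded Sz s)
    (hL : ∀ A, A ∈ L ↔ ∃ a, A = I.agentData a) (hk : L.length = I.k) :
    PrimHyp (fun d c => traverseL d (localAgentsL L d) c) (orientL I.edgesL) (PackageVal I Sz s) I.n
      ((I.source : ℕ), ((0 : ℝ), [])) where
  mono := by
    rintro j u c ⟨u', h1, h2, h3, h4, h5, h6⟩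
    exact ⟨u', h1, h2, by omega, h4, h5.mono (by gcongr; omega),
      hS.mono h6 (by gcongr; omega)⟩
  relax := by
    intro j c d hd hc c' hc'
    obtain ⟨u, v, huv, rfl⟩ := mem_orientL.1 hd
    obtain ⟨c₁, h1, h2, h3, -⟩ := package_step hS hI hL hk huv hc
    rw [h1] at hc'
    obtain rfl := List.mem_singleton.1 hc'
    exact ⟨h3, h2⟩
  first := by
    refine ⟨I.source, rfl, .nil le_rfl, by simp [shortcuts], by simp [shortcuts],
      (fun r hr => nomatch hr), hS.mono hS.zero ?_⟩
    have : 1 * 1 ≤ s * (2 * s + 2) := Nat.mul_le_mul hI.one_le (by omega)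
    omega
  lt := by
    rintro j u c ⟨u', rfl, -⟩
    exact u'.2

/-- The route to the destination in the table is an approximation. -/
theorem packageTable_spec (hS : SizeModel size Sz) (hI : I.Bounded Sz s)
    (hL : ∀ A, A ∈ L ↔ ∃ a, A = I.agentData a) (hk : L.length = I.k) :
    (∀ e ∈ packageTable I L, ∃ j < I.n, PackageVal I Sz s j e.1 e.2) ∧
    (packageTable I L).length ≤ I.n ∧
    (∃ e ∈ packageTable I L, e.1 = I.target) ∧
    ∀ e ∈ packageTable I L, e.1 = I.target → ∃ S : Schedule I.n I.k,
      routeTrips e.2.2 = encodeSchedule S ∧ I.Feasible S ∧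
      ∀ S' : Schedule I.n I.k, I.Feasible S' →
        I.deliveryTime S ≤ min (2 * (I.n : ℝ) - 1) (2 * (I.k : ℝ) - 1) * I.deliveryTime S' := by
  have H := package_hyp hS hI hL hk
  obtain ⟨h1, h2⟩ := primL_spec H orientL_ne length_nodesL
  have hlen := h1.length_le H
  have hpos := h1.length_pos
  have hval : ∀ e ∈ packageTable I L, ∃ j < I.n, PackageVal I Sz s j e.1 e.2 :=
    fun e he => ⟨_, by omega, h1.val e he⟩
  have htime : ∀ e ∈ packageTable I L, ∀ u : Fin I.n, e.1 = u →
      timeAt (packageTable I L) u = e.2.1 := by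
    intro e he u hu
    rw [← hu]
    exact timeAt_eq h1.nodup he
  have hstep : ∀ u v : Fin I.n, I.G.Adj u v → ∀ e ∈ packageTable I L, e.1 = u →
      ∃ e' ∈ packageTable I L, e'.1 = v ∧
        ∃ τ, IsTraj I I.agentTime (fun u => timeAt (packageTable I L) u) u v τ := by
    intro u v huv e he heu
    obtain ⟨j, -, hj⟩ := hval e he
    rw [heu] at hj
    obtain ⟨c', h3, -, -, h4⟩ := package_step hS hI hL hk huv hj
    obtain ⟨e', he', h5, h6⟩ := h2 e he _ (mem_orientL.2 ⟨u, v, huv, rfl⟩) heu.symm c'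
      (by rw [h3]; exact List.mem_singleton_self _)
    refine ⟨e', he', h5, h4 _ (htime e he u heu) ?_⟩
    exact (htime e' he' v h5).trans_le h6
  have hall : ∀ u : Fin I.n, ∃ e ∈ packageTable I L, e.1 = u := by
    refine closed_of_connected I.connected (u := I.source) ⟨_, h1.first_mem, rfl⟩ ?_
    rintro v w hvw ⟨e, he, hev⟩
    obtain ⟨e', he', h3, -⟩ := hstep v w hvw e he hev
    exact ⟨e', he', h3⟩
  refine ⟨hval, hlen, hall _, fun e he het => ?_⟩
  obtain ⟨j, hj, u', h3, h4, h5, h6, -⟩ := hval e he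
  obtain rfl : u' = I.target := Fin.ext (h3.symm.trans het)
  obtain ⟨S, loc, free, e1, -, e3, e4⟩ := h4.exists_schedule
  refine ⟨S, e1, by simpa [Feasible] using e3 [] rfl, fun S' hS' => e4.trans ?_⟩
  -- The final tables satisfy all inequalities of the potential, so the label of the destination is
  -- a lower bound for every feasible schedule.
  have hopt := le_deliveryTime I.agentTime (fun u => timeAt (packageTable I L) u)
    (fun a => (agentTable_spec hS hI a).2.2.2.1.le)
    (fun a => (agentTable_spec hS hI a).2.2.2.2) (htime _ h1.first_mem _ rfl).le
    (fun u v huv => by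
      obtain ⟨e, he, heu⟩ := hall u
      obtain ⟨-, -, -, h⟩ := hstep u v huv e he heu
      exact h) hS'
  rw [htime e he _ het] at hopt
  have hT := h4.nonneg
  -- With at most `n - 1` and at most `k - 1` shortcuts, the factor `1 + 2 * c` is at most `2 * n -
  -- 1` and `2 * k - 1`.
  have hn1 : ((shortcuts e.2.2 : ℕ) : ℝ) + 1 ≤ I.n := by
    exact_mod_cast (show shortcuts e.2.2 + 1 ≤ I.n by omega)
  have hk1 : ((shortcuts e.2.2 : ℕ) : ℝ) + 1 ≤ I.k := by
    have := I.k_pos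
    exact_mod_cast (show shortcuts e.2.2 + 1 ≤ I.k by omega)
  have h0 : (0 : ℝ) ≤ shortcuts e.2.2 := Nat.cast_nonneg _
  refine mul_le_mul (le_min (by linarith) (by linarith)) hopt hT
    (le_min (by linarith) (by linarith))

end Package

end Instance

namespace Prog

open Instance

variable {γ : Ty} {size : ℝ → ℕ} {N : ℕ}

@[reducible] def agentInTy : Ty :=
  .prod .nat (.prod .real (.prod (.list .nat) (.list (.prod .nat .nat))))

@[reducible] def agentOutTy : Ty :=
  .prod .real (.prod (.list edgeTy) (.list (entryTy walkTy)))

@[reducible] def agentTy : Ty := .prod .nat agentOutTy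

/-! ### The program for the tables of the agents -/

def orientE : Prog (.list edgeTy) (.list edgeTy) :=
  collectE id (consE v0 (single (pair (pair (p2 (p1 v0)) (p1 (p1 v0))) (p2 v0))))

theorem eval_orientE (E : List EdgeData) : orientE.eval E = orientL E := rfl

theorem good_orientE {E : List EdgeData} (hE : E.length ≤ N) (hN : 2 ≤ N) :
    orientE.Good size N E :=
  good_collectE good_id' hE fun e _ => ⟨by simp, hN⟩

def subEdgesE : Prog (.prod (.list edgeTy) (.list (.prod .nat .nat))) (.list edgeTy) :=
  collectE fst (collectE (up snd)
    (ite (natEqE (p1 (p1 v1)) (p1 v0))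
      (ite (natEqE (p2 (p1 v1)) (p2 v0))
        (consE v1 (single (pair (pair (p2 (p1 v1)) (p1 (p1 v1))) (p2 v1)))) nil) nil))

theorem eval_subEdgesE (x : (Ty.prod (.list edgeTy) (.list (.prod .nat .nat))).Val) :
    subEdgesE.eval x = subEdgesL x.1 x.2 := rfl

theorem good_subEdgesE {E : List EdgeData} {F : List (ℕ × ℕ)} (hE : E.length ≤ N)
    (hF : F.length * 2 ≤ N) (hN : 2 ≤ N) : subEdgesE.Good size N (E, F) := by
  refine good_collectE good_fst' hE fun e _ => ⟨good_collectE (by simp) ?_ fun f _ => ⟨?_, ?_⟩, ?_⟩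
  · exact (Nat.le_mul_of_pos_right _ two_pos).trans hF
  · simp
  · simp only [eval_ite']
    split_ifs
    · simpa using hN
    · exact Nat.zero_le _
    · exact Nat.zero_le _
  · exact (length_subEdgesL_inner_le e F).trans hF

def relaxAgentE :
    Prog (.prod (.prod .real edgeTy) (.prod .real walkTy)) (.list (.prod .real walkTy)) :=
  single (pair (addE (p1 v0) (divE (p2 v1) (up fst)))
    (consE (pair (p2 (p1 v1)) (pair (p2 (p1 v1)) realZero)) (p2 v0)))

theorem eval_relaxAgentE (x : (Ty.prod (.prod .real edgeTy) (.prod .real walkTy)).Val) :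
    relaxAgentE.eval x = relaxAgentL x.1.1 x.1.2 x.2 := rfl

def agentE : Prog (.prod inputTy agentInTy) agentOutTy :=
  letE (comp subEdgesE (pair (p1 (p2 fst)) (p2 (p2 (p2 v0)))))
    (pair (p1 (p2 v1)) (pair v0 (primE relaxAgentE (p1 (p2 v1)) v0 (p1 (up fst))
      (pair (p1 v1) (pair realZero (single (pair (p1 v1) (pair (p1 v1) realZero))))))))

def agentsE : Prog inputTy (.list agentTy) :=
  p2 (foldE (p1 (p2 (p2 id))) (pair zero nil)
    (pair (comp succ (p1 v0)) (consE (pair (p1 v0) (up agentE)) (p2 v0))))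

/-- The part of the input that describes an agent. -/
noncomputable def agentIn (I : Instance) (a : Fin I.k) : agentInTy.Val :=
  ((I.pos a : ℕ), (I.vel a, ((I.rangeNodes a).map (fun v => (v : ℕ)), I.rangeEdges a)))

variable {I : Instance} {Sz : ℕ → ℝ → Prop} {s : ℕ}

theorem eval_agentE (a : Fin I.k) :
    agentE.eval (I.encode, agentIn I a) = (I.agentData a).2 := by
  simp only [agentE, eval_letE, eval_pair', eval_primE, eval_relaxAgentE, eval_comp',
    eval_subEdgesE]
  rfl

/-- The numbers of the agents come from a loop counter. The list is built in reverse, but later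
arguments use only its elements and its length. -/
theorem eval_agentsE (I : Instance) :
    (∀ A, A ∈ (agentsE.eval I.encode : List AgentData) ↔ ∃ a, A = I.agentData a) ∧
      (agentsE.eval I.encode : List AgentData).length = I.k := by
  have key : ∀ (l : List (Fin I.k)) (m : ℕ) (r : List AgentData),
      (∀ (i : ℕ) (h : i < l.length), (l[i] : ℕ) = m + i) →
      (l.map (agentIn I)).foldl (fun (s : ℕ × List AgentData) a =>
        (s.1 + 1, (s.1, agentE.eval (I.encode, a)) :: s.2)) (m, r) =
      (m + l.length, (l.map I.agentData).reverse ++ r) := by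
    intro l
    induction l with
    | nil => intro m r _; rfl
    | cons a l ih =>
      intro m r h
      have h0 : (a : ℕ) = m := h 0 (by simp)
      rw [List.map_cons, List.foldl_cons, ih]
      · rw [eval_agentE, List.length_cons, List.map_cons, List.reverse_cons, List.append_assoc]
        refine Prod.ext (by dsimp only; omega) ?_
        rw [← h0]
        rfl
      · intro i hi
        have := h (i + 1) (by simpa using hi)
        rw [List.getElem_cons_succ] at this
        omega
  have e : (agentsE.eval I.encode : List AgentData) =
      ((List.finRange I.k).map I.agentData).reverse ++ [] := by
    exact congrArg Prod.snd (key (List.finRange I.k) 0 [] (by simp))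
  rw [e]
  refine ⟨fun A => ?_, by simp⟩
  simp only [List.append_nil, List.mem_reverse, List.mem_map, List.mem_finRange, true_and]
  exact exists_congr fun a => eq_comm

/-- A bound for the lengths of all lists and for the sizes of all numbers. -/
def sizeBound (s : ℕ) : ℕ :=
  2 * (s * (2 * s + 2) + (s + 1) * ((2 * s ^ 7 + 1) * (8 * (s * (2 * s + 2)) + 16)) +
    11 * (s * (2 * s + 2)) + 30)

theorem le_sizeBound (s : ℕ) : 2 * s ^ 7 ≤ sizeBound s ∧ s * (2 * s + 2) ≤ sizeBound s ∧
    2 * (s * (2 * s + 2) + 11 * (s * (2 * s + 2)) + 30) ≤ sizeBound s ∧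
    2 * (s + 1) + s * (2 * s ^ 7 + 1) ≤ sizeBound s := by
  have h : (s + 1) * (2 * s ^ 7 + 1) * 1 ≤
      (s + 1) * ((2 * s ^ 7 + 1) * (8 * (s * (2 * s + 2)) + 16)) := by
    rw [← mul_assoc]
    gcongr
    omega
  have h' : s ≤ s * (2 * s + 2) := Nat.le_mul_of_pos_right _ (by omega)
  unfold sizeBound
  generalize (s + 1) * ((2 * s ^ 7 + 1) * (8 * (s * (2 * s + 2)) + 16)) = x at *
  generalize s * (2 * s + 2) = y at *
  rw [mul_one, add_mul, one_mul] at h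
  refine ⟨by omega, by omega, by omega, by omega⟩

theorem pow_le_sizeBound {s : ℕ} (hs : 1 ≤ s) : 2 * (s * s * (s * s)) * s ≤ sizeBound s ∧
    s ≤ sizeBound s ∧ 2 * (s * s) * s ≤ sizeBound s ∧ 2 * s ^ 6 ≤ sizeBound s := by
  have h := (le_sizeBound s).1
  have h1 : ∀ m ≤ 7, 2 * s ^ m ≤ sizeBound s :=
    fun m hm => (Nat.mul_le_mul_left 2 (Nat.pow_le_pow_right hs hm)).trans h
  refine ⟨?_, ?_, ?_, h1 6 (by norm_num)⟩
  · calc _ = 2 * s ^ 5 := by ring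
      _ ≤ _ := h1 5 (by norm_num)
  · have := h1 1 (by norm_num)
    rw [pow_one] at this
    omega
  · calc _ = 2 * s ^ 3 := by ring
      _ ≤ _ := h1 3 (by norm_num)

/-- At level `j` the size of the time has grown over `j` edges, and crossing one more edge adds a
further share; the factor `s + 1` in `sizeBound` leaves room for it. -/
theorem le_sizeBound_of_le {s j q : ℕ} (hj : j ≤ s) (hq : q ≤ 2 * s ^ 7) :
    2 * (s * (2 * s + 2) + j * ((2 * s ^ 7 + 1) * (8 * (s * (2 * s + 2)) + 16)) +
      (q + 1) * (8 * (s * (2 * s + 2)) + 16) + 11 * (s * (2 * s + 2)) + 30) ≤ sizeBound s ∧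
    2 * (s * (2 * s + 2) + (j + 1) * ((2 * s ^ 7 + 1) * (8 * (s * (2 * s + 2)) + 16))) ≤
      sizeBound s := by
  unfold sizeBound
  generalize 2 * s ^ 7 = m at *
  generalize s * (2 * s + 2) = y
  have h1 := Nat.mul_le_mul_right ((m + 1) * (8 * y + 16)) hj
  have h2 := Nat.mul_le_mul_right (8 * y + 16) (Nat.add_le_add_right hq 1)
  constructor <;> linarith

theorem good_agentE (hS : SizeModel size Sz) (hI : I.Bounded Sz s) (hN : sizeBound s ≤ N)
    (a : Fin I.k) : agentE.Good size N (I.encode, agentIn I a) := by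
  have hn := hI.n_le
  have hs := hI.one_le
  obtain ⟨b1, b2, b3, b4⟩ := le_sizeBound s
  obtain ⟨c1, c2, c3, c4⟩ := pow_le_sizeBound hs
  have hnn : I.n * I.n ≤ s * s := Nat.mul_le_mul hn hn
  have hnN : I.n ≤ N := hn.trans (c2.trans hN)
  have hnn2 : I.n * I.n * 2 ≤ N := by
    have : s * s * 2 ≤ 2 * (s * s) * s := by
      rw [mul_comm (s * s) 2]
      exact Nat.le_mul_of_pos_right _ hs
    omega
  have f : ∀ {M y}, Sz M y → M ≤ s * (2 * s + 2) + 11 * (s * (2 * s + 2)) + 30 → size y ≤ N :=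
    fun h hM => (hS.size_le h).trans ((Nat.mul_le_mul_left 2 hM).trans (b3.trans hN))
  have hsW : s ≤ s * (2 * s + 2) := Nat.le_mul_of_pos_right _ (by omega)
  have hz : size 0 ≤ N := f hS.zero (by omega)
  have hE : I.edgesL.length ≤ N := length_edgesL_le.trans (by omega)
  have hD : subEdgesE.eval (I.edgesL, I.rangeEdges a) = subEdgesL I.edgesL (I.rangeEdges a) :=
    eval_subEdgesE _
  rw [agentE, good_letE]
  constructor
  · simp only [good_comp', good_pair', good_p1, good_p2, good_fst', good_v0, true_and]
    exact good_subEdgesE hE ((Nat.mul_le_mul_right 2 (length_rangeEdges_le a)).trans hnn2)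
      (by omega)
  · simp only [good_pair', good_p1, good_p2, good_v1, good_v0, true_and]
    have hev : ((comp subEdgesE (pair (p1 (p2 fst)) (p2 (p2 (p2 v0))))).eval
        (I.encode, agentIn I a) : List EdgeData) = subEdgesL I.edgesL (I.rangeEdges a) := by
      rw [eval_comp', ← hD]
      rfl
    rw [hev]
    refine good_primE (Val := AgentVal I Sz s a) (n := I.n) (agent_hyp hS hI a) (subEdgesL_ne a)
      (by simp) (by simp) (by simp) (by simpa using hz) ?_ ?_ hnN hz ?_
    · exact length_nodesL.le.trans hnN
    · refine (Nat.mul_le_mul hn ((length_subEdgesL_le a).trans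
        (Nat.mul_le_mul hnn (Nat.mul_le_mul_right 2 hnn)))).trans ?_
      calc s * (s * s * (s * s * 2)) = 2 * (s * s * (s * s)) * s := by ring
        _ ≤ N := c1.trans hN
    · intro j hj c d hd hc
      obtain ⟨u, v, hadj, rfl⟩ := mem_subEdgesL.1 hd
      obtain ⟨-, -, -, -, h4⟩ := hc
      have h4 := hS.mono h4 (Nat.mul_le_mul_right (2 * s + 2) (show j + 1 ≤ s by omega))
      have h5 := hI.len u v hadj.adj_sub
      have h6 := hI.vel a
      have h7 := hS.div h5 h6
      have h8 := hS.add h4 h7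
      have g4 := f h4 (by omega)
      have g5 := f h5 (by omega)
      have g6 := f h6 (by omega)
      have g7 := f h7 (by omega)
      have g8 := f h8 (by omega)
      refine ⟨?_, le_rfl, ?_⟩
      · simp only [relaxAgentE, good_single, good_pair', good_addE, good_p1, good_v0, good_divE,
          good_p2, good_v1, good_up, good_fst', good_consE, good_realZero', eval_p1, eval_p2,
          eval_v0, eval_v1, eval_up, eval_fst', eval_divE, true_and, and_true, and_self, hz]
        exact ⟨⟨g5, g6, g7⟩, g4, g7, g8⟩
      · intro c' hc'
        obtain rfl := List.mem_singleton.1 hc'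
        exact g8

theorem good_agentsE (hS : SizeModel size Sz) (hI : I.Bounded Sz s) (hN : sizeBound s ≤ N) :
    agentsE.Good size N I.encode := by
  have hk : I.k ≤ N := hI.k_le.trans ((pow_le_sizeBound hI.one_le).2.1.trans hN)
  have hl : (p1 (p2 (p2 id)) : Prog inputTy (.list agentInTy)).eval I.encode =
      (List.finRange I.k).map (agentIn I) := rfl
  simp only [agentsE, good_p2, good_foldE, good_p1, good_id', good_pair', good_zero', good_nil',
    true_and, good_comp', good_v0, good_succ', good_consE, good_up, and_true, hl]
  refine ⟨by simpa using hk, LoopAll.of_forall (fun a ha s => ?_) _⟩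
  obtain ⟨a, -, rfl⟩ := List.mem_map.1 ha
  exact good_agentE hS hI hN a

/-! ### The program for the package -/

def localOfE : Prog (.prod (.prod .nat .nat) agentTy) (.list localTy) :=
  collectE (p2 (p2 (p2 v0)))
    (ite (natEqE (p1 v0) (p1 (up fst)))
      (collectE (p2 (p2 (p2 v1)))
        (ite (natEqE (p1 v0) (p2 (up (up fst))))
          (single (pair (p1 v2) (pair (p1 (p2 v2)) (pair (p2 v1) (p2 v0))))) nil))
      nil)

theorem good_localOfE {u v : ℕ} {A : AgentData} (h : A.2.2.2.length ≤ N) (hN : 1 ≤ N) :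
    localOfE.Good size N ((u, v), A) := by
  refine good_collectE (by simp) h fun e _ => ⟨?_, ?_⟩
  · rw [good_ite']
    refine ⟨by simp, ?_⟩
    split_ifs
    · refine good_collectE (by simp) h fun e' _ => ⟨by simp, ?_⟩
      rw [eval_ite']
      split_ifs
      · exact hN
      · exact Nat.zero_le _
    · trivial
  · rw [eval_ite']
    split_ifs
    · exact ((length_localOfL_le u v A).1 e).trans h
    · exact Nat.zero_le _

def localMatchE : Prog (.prod edgeTy agentTy) (.list localTy) :=
  collectE (p1 (p2 (p2 v0)))
    (ite (natEqE (p1 (p1 v0)) (p1 (p1 (up fst))))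
      (ite (natEqE (p2 (p1 v0)) (p2 (p1 (up fst))))
        (comp localOfE (pair (p1 (up fst)) v1)) nil) nil)

theorem eval_localMatchE (x : (Ty.prod edgeTy agentTy).Val) :
    localMatchE.eval x = localMatchL x.1 x.2 := rfl

def localAgentsE : Prog (.prod (.list agentTy) edgeTy) (.list localTy) :=
  collectE fst (comp localMatchE (pair (up snd) v0))

theorem eval_localAgentsE (x : (Ty.prod (.list agentTy) edgeTy).Val) :
    localAgentsE.eval x = localAgentsL x.1 x.2 := by
  simp only [localAgentsE, eval_collectE, localAgentsL, eval_fst']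
  congr 1

theorem good_localAgentsE (hS : SizeModel size Sz) (hI : I.Bounded Sz s) {L : List AgentData}
    (hL : ∀ A, A ∈ L ↔ ∃ a, A = I.agentData a) (hk : L.length = I.k) (hN : sizeBound s ≤ N)
    (d : EdgeData) : localAgentsE.Good size N (L, d) := by
  have hn := hI.n_le
  obtain ⟨c1, c2, c3, c4⟩ := pow_le_sizeBound hI.one_le
  have hs := hI.one_le
  refine good_collectE good_fst' (hk.le.trans (hI.k_le.trans (c2.trans hN))) fun A hA => ⟨?_, ?_⟩
  · obtain ⟨a, rfl⟩ := (hL A).1 hA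
    have ht : (I.agentTable a).length ≤ s := (agentTable_spec hS hI a).1.trans hn
    have hss : s * s ≤ N := by
      have : s * s ≤ 2 * (s * s) * s := by nlinarith [Nat.mul_le_mul hs hs]
      omega
    simp only [good_comp', good_pair', good_up, good_snd', good_v0, true_and, eval_pair', eval_up,
      eval_snd', eval_v0]
    refine good_collectE (by simp) ?_ fun d' _ => ⟨?_, ?_⟩
    · refine (length_subEdgesL_le a).trans (le_trans ?_ hN)
      refine le_trans ?_ c1
      calc I.n * I.n * (I.n * I.n * 2) ≤ s * s * (s * s * 2) := by gcongr
        _ = 2 * (s * s * (s * s)) * 1 := by ring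
        _ ≤ 2 * (s * s * (s * s)) * s := by gcongr
    · rw [good_ite']
      refine ⟨by simp, ?_⟩
      split_ifs
      · rw [good_ite']
        refine ⟨by simp, ?_⟩
        split_ifs
        · simp only [good_comp', good_pair', good_p1, good_up, good_fst', good_v1, true_and]
          exact good_localOfE (ht.trans (c2.trans hN)) (by omega)
        · trivial
      · trivial
    · simp only [eval_ite']
      split_ifs
      · exact (length_localOfL_le d.1.1 d.1.2 (I.agentData a)).2.trans
          ((Nat.mul_le_mul ht ht).trans hss)
      · exact Nat.zero_le _
      · exact Nat.zero_le _
  · rw [eval_comp', eval_localMatchE]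
    exact ((length_localAgentsL_le hS hI hL hk d).1 A hA).trans (c4.trans hN)

def relaxPackageE : Prog (.prod (.prod (.list agentTy) edgeTy) labelTy) (.list labelTy) :=
  comp traverseE (pair (pair (p2 fst) (comp localAgentsE fst)) snd)

theorem eval_relaxPackageE (x : (Ty.prod (.prod (.list agentTy) edgeTy) labelTy).Val) :
    relaxPackageE.eval x = traverseL x.1.2 (localAgentsL x.1.1 x.1.2) x.2 := by
  rw [relaxPackageE, eval_comp', eval_traverseE]
  simp only [eval_pair', eval_p2, eval_fst', eval_comp', eval_localAgentsE, eval_snd']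

def packageE : Prog (.prod inputTy (.list agentTy)) (.list (entryTy routeTy)) :=
  letE (comp orientE (p1 (p2 fst)))
    (primE relaxPackageE v1 v0 (p1 (up fst))
      (pair (p1 (p2 (p2 (p2 (up fst))))) (pair realZero nil)))

theorem eval_packageE (I : Instance) (L : List AgentData) :
    packageE.eval (I.encode, L) = packageTable I L := by
  simp only [packageE, eval_letE, eval_primE, eval_relaxPackageE, eval_comp', eval_orientE]
  rfl

theorem good_packageE (hS : SizeModel size Sz) (hI : I.Bounded Sz s) {L : List AgentData}
    (hL : ∀ A, A ∈ L ↔ ∃ a, A = I.agentData a) (hk : L.length = I.k) (hN : sizeBound s ≤ N) :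
    packageE.Good size N (I.encode, L) := by
  have hn := hI.n_le
  have hs := hI.one_le
  obtain ⟨b1, b2, b3, b4⟩ := le_sizeBound s
  obtain ⟨c1, c2, c3, c4⟩ := pow_le_sizeBound hs
  have hnn : I.n * I.n ≤ s * s := Nat.mul_le_mul hn hn
  have hnN : I.n ≤ N := hn.trans (c2.trans hN)
  have hnn2 : I.n * I.n * 2 ≤ N := by
    have : s * s * 2 ≤ 2 * (s * s) * s := by
      rw [mul_comm (s * s) 2]
      exact Nat.le_mul_of_pos_right _ hs
    omega
  have f : ∀ {M y}, Sz M y → 2 * M ≤ sizeBound s → size y ≤ N :=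
    fun h hM => (hS.size_le h).trans (hM.trans hN)
  have hz : size 0 ≤ N := f hS.zero (by omega)
  have hE : I.edgesL.length ≤ N := length_edgesL_le.trans (by omega)
  rw [packageE, good_letE]
  constructor
  · simp only [good_comp', good_p1, good_p2, good_fst', true_and]
    exact good_orientE hE (by omega)
  · have hev : ((comp orientE (p1 (p2 fst)) : Prog (.prod inputTy (.list agentTy)) _).eval
        (I.encode, L) : List EdgeData) = orientL I.edgesL := rfl
    rw [hev]
    have hP := package_hyp hS hI hL hk
    refine good_primE (Val := PackageVal I Sz s) (n := I.n) ?_ orientL_ne (by simp) (by simp)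
      (by simp) (by simpa using hz) ?_ ?_ hnN hz ?_
    · simp only [eval_relaxPackageE]
      exact hP
    · exact length_nodesL.le.trans hnN
    · refine (Nat.mul_le_mul hn (length_orientL_le.trans (Nat.mul_le_mul_right 2 hnn))).trans ?_
      calc s * (s * s * 2) = 2 * (s * s) * s := by ring
        _ ≤ N := c3.trans hN
    · intro j hj c d hd hc
      obtain ⟨u, v, huv, rfl⟩ := mem_orientL.1 hd
      have hlen := (length_localAgentsL_le hS hI hL hk (I.edgeData u v)).2
      obtain ⟨c', h1, -, h2, -⟩ := package_step hS hI hL hk huv hc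
      obtain ⟨u', e1, e2, e3, e4, e5, e6⟩ := hc
      obtain rfl : u = u' := Fin.ext e1
      obtain ⟨T, R⟩ := c
      have hjs : j ≤ s := by omega
      refine ⟨?_, ?_, ?_⟩
      · simp only [relaxPackageE, good_comp', good_pair', good_p2, good_fst', good_snd', true_and,
          and_true, eval_pair', eval_p2, eval_fst', eval_snd', eval_comp', eval_localAgentsE]
        refine ⟨good_localAgentsE hS hI hL hk hN _, ?_⟩
        have hsN : s + 1 ≤ N := by omega
        refine good_traverseE hS (edgeHyp hS hI hL huv) (localAgentsL_ne_nil hS hI hL huv) e2 e3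
          e4 e5 (Nat.le_add_right _ _) e6 (Nat.le_add_right _ _) (by omega)
          (hlen.trans (b1.trans hN)) (hI.k_le.trans (c2.trans hN)) hsN ((le_sizeBound_of_le hjs hlen).1.trans hN)
      · refine (congrArg List.length ((eval_relaxPackageE _).trans h1)).trans_le ?_
        exact le_rfl
      · intro c'' hc''
        rw [(eval_relaxPackageE _).trans h1] at hc''
        obtain rfl := List.mem_singleton.1 hc''
        obtain ⟨-, -, -, -, -, -, h6⟩ := h2
        exact f h6 (le_sizeBound_of_le hjs hlen).2

/-! ### The complete algorithm -/

def approxE : Prog inputTy outputTy :=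
  letE agentsE (letE packageE
    (caseE (collectE v0 (ite (natEqE (p1 v0) (p2 (p2 (p2 (p2 (up (up fst))))))) (single v0) nil))
      nil (comp routeTripsE (p2 (p2 v1)))))

/-- The graph is connected, so the destination is in the table and the branch of the program for an
empty list is never taken. -/
theorem approxE_cases (hS : SizeModel size Sz) (hI : I.Bounded Sz s) :
    ∃ e l, collectL (fun e : ℕ × (ℝ × List RouteRec) =>
        if natEqB e.1 I.target = true then [e] else [])
        (packageTable I (agentsE.eval I.encode)) = e :: l ∧
      e ∈ packageTable I (agentsE.eval I.encode) ∧ e.1 = I.target := by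
  obtain ⟨hL, hk⟩ := eval_agentsE I
  obtain ⟨-, -, ⟨e, he, het⟩, -⟩ := packageTable_spec hS hI hL hk
  have hmem : ∀ e, e ∈ collectL (fun e : ℕ × (ℝ × List RouteRec) =>
      if natEqB e.1 I.target = true then [e] else []) (packageTable I (agentsE.eval I.encode)) ↔
      e ∈ packageTable I (agentsE.eval I.encode) ∧ e.1 = I.target := by
    intro e
    rw [mem_collectL]
    constructor
    · rintro ⟨e', he', h⟩
      split_ifs at h with h1
      · obtain rfl := List.mem_singleton.1 h
        exact ⟨he', natEqB_iff.1 h1⟩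
      · cases h
    · rintro ⟨h1, h2⟩
      exact ⟨e, h1, by simp [h2]⟩
  cases h : collectL (fun e : ℕ × (ℝ × List RouteRec) =>
      if natEqB e.1 I.target = true then [e] else []) (packageTable I (agentsE.eval I.encode)) with
  | nil =>
    have := (hmem e).2 ⟨he, het⟩
    rw [h] at this
    cases this
  | cons e' l => exact ⟨e', l, rfl, (hmem e').1 (by rw [h]; exact List.mem_cons_self)⟩

theorem eval_approxE (hS : SizeModel size Sz) (hI : I.Bounded Sz s) :
    ∃ S : Schedule I.n I.k, approxE.eval I.encode = encodeSchedule S ∧ I.Feasible S ∧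
      ∀ S' : Schedule I.n I.k, I.Feasible S' →
        I.deliveryTime S ≤ min (2 * (I.n : ℝ) - 1) (2 * (I.k : ℝ) - 1) * I.deliveryTime S' := by
  obtain ⟨hL, hk⟩ := eval_agentsE I
  obtain ⟨e, l, h1, h2, h3⟩ := approxE_cases hS hI
  obtain ⟨-, -, -, h⟩ := packageTable_spec hS hI hL hk
  obtain ⟨S, h4, h5⟩ := h e h2 h3
  refine ⟨S, ?_, h5⟩
  rw [approxE, eval_letE, eval_letE, eval_packageE, eval_caseE]
  have hc : (collectE v0 (ite (natEqE (p1 v0) (p2 (p2 (p2 (p2 (up (up fst))))))) (single v0) nil) :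
      Prog (.prod (.prod inputTy (.list agentTy)) (.list (entryTy routeTy))) _).eval
      ((I.encode, agentsE.eval I.encode), packageTable I (agentsE.eval I.encode)) = e :: l := h1
  rw [hc]
  simp only [eval_comp', eval_p2, eval_v1]
  exact (eval_routeTripsE _).trans h4

theorem good_approxE (hS : SizeModel size Sz) (hI : I.Bounded Sz s) (hN : sizeBound s ≤ N) :
    approxE.Good size N I.encode := by
  obtain ⟨hL, hk⟩ := eval_agentsE I
  obtain ⟨e, l, h1, h2, h3⟩ := approxE_cases hS hI
  obtain ⟨hval, hlen, -, -⟩ := packageTable_spec hS hI hL hk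
  obtain ⟨b1, b2, b3, b4⟩ := le_sizeBound s
  obtain ⟨c1, c2, c3, c4⟩ := pow_le_sizeBound hI.one_le
  have hn := hI.n_le
  rw [approxE, good_letE, good_letE, eval_packageE, good_caseE]
  refine ⟨good_agentsE hS hI hN, good_packageE hS hI hL hk hN, ?_, ?_⟩
  · refine good_collectE (by simp) (hlen.trans (hn.trans (c2.trans hN))) fun e _ => ⟨by simp, ?_⟩
    rw [eval_ite']
    have := hI.one_le
    split_ifs
    · exact show 1 ≤ N by omega
    · exact Nat.zero_le _
  · have hc : (collectE v0 (ite (natEqE (p1 v0) (p2 (p2 (p2 (p2 (up (up fst))))))) (single v0)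
        nil) : Prog (.prod (.prod inputTy (.list agentTy)) (.list (entryTy routeTy))) _).eval
        ((I.encode, agentsE.eval I.encode), packageTable I (agentsE.eval I.encode)) = e :: l := h1
    rw [hc]
    simp only [good_comp', good_p2, good_v1, true_and, eval_p2, eval_v1]
    obtain ⟨j, hj, u, -, e2, -, -, e5, -⟩ := hval e h2
    refine good_routeTripsE ?_ (e2.length_le.trans (hI.k_le.trans (c2.trans hN))) fun r hr => ?_
    · exact (hS.size_le hS.zero).trans (by omega)
    · have h4 := e5 r hr
      have h5 : j * (2 * s ^ 7 + 1) ≤ s * (2 * s ^ 7 + 1) := Nat.mul_le_mul_right _ (by omega)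
      omega

end Prog

/-! ### The two size measures: step count, and bit length of rational numbers -/

theorem sizeModel_zero : SizeModel (fun _ => 0) (fun _ _ => True) := by
  constructor <;> intros <;> first | trivial | exact Nat.zero_le _

/-- Rational numbers with numerator and denominator below `2 ^ N`. -/
def RatSize (N : ℕ) (x : ℝ) : Prop :=
  ∃ (a : ℤ) (b : ℕ), x = a / b ∧ 0 < b ∧ a.natAbs < 2 ^ N ∧ b < 2 ^ N

/-- The fraction in `RatSize` need not be reduced, which makes arithmetic easy to bound; reduction
replaces numerator and denominator by divisors. -/
theorem RatSize.bitLength_le {N : ℕ} {x : ℝ} (h : RatSize N x) : bitLength x ≤ 2 * N := by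
  obtain ⟨a, b, rfl, hb, ha, hbN⟩ := h
  have e : ((a : ℝ) / b) = (((a : ℚ) / b : ℚ) : ℝ) := by push_cast; rfl
  rw [e, bitLength_ratCast, two_mul]
  have hb' : (b : ℤ) ≠ 0 := by exact_mod_cast hb.ne'
  refine Nat.add_le_add (Nat.size_le.2 ?_) (Nat.size_le.2 ?_)
  · by_cases ha0 : a = 0
    · simp [ha0]
    · have h1 : ((a : ℚ) / b).num ∣ a := by
        have := Rat.num_dvd a hb'
        rwa [Rat.divInt_eq_div] at this
      exact (Nat.le_of_dvd (Int.natAbs_pos.2 ha0) (Int.natAbs_dvd_natAbs.2 h1)).trans_lt ha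
  · have h1 : ((((a : ℚ) / b).den : ℕ) : ℤ) ∣ b := by
      have := Rat.den_dvd a b
      rwa [Rat.divInt_eq_div] at this
    exact (Nat.le_of_dvd hb (by exact_mod_cast h1)).trans_lt hbN

theorem ratSize_bitLength {x : ℝ} (h : ∃ r : ℚ, (r : ℝ) = x) {N : ℕ} (hN : bitLength x ≤ N) :
    RatSize N x := by
  obtain ⟨r, rfl⟩ := h
  rw [bitLength_ratCast] at hN
  refine ⟨r.num, r.den, ?_, r.pos, ?_, ?_⟩
  · exact_mod_cast (Rat.num_div_den r).symm
  · exact (Nat.lt_size_self _).trans_le (Nat.pow_le_pow_right two_pos (by omega))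
  · exact (Nat.lt_size_self _).trans_le (Nat.pow_le_pow_right two_pos (by omega))

/-- The numerator `a * d + c * b` is a sum of two products below `2 ^ (M + N)`, whence the
additional bit. -/
theorem RatSize.add {M N : ℕ} {x y : ℝ} (hx : RatSize M x) (hy : RatSize N y) :
    RatSize (M + N + 1) (x + y) := by
  obtain ⟨a, b, rfl, hb, ha, hbM⟩ := hx
  obtain ⟨c, d, rfl, hd, hc, hdN⟩ := hy
  have hb' : (b : ℝ) ≠ 0 := by exact_mod_cast hb.ne'
  have hd' : (d : ℝ) ≠ 0 := by exact_mod_cast hd.ne'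
  refine ⟨a * d + c * b, b * d, ?_, Nat.mul_pos hb hd, ?_, ?_⟩
  · push_cast
    field_simp
  · have h1 : a.natAbs * d ≤ 2 ^ M * 2 ^ N := Nat.mul_le_mul ha.le hdN.le
    have h2 : c.natAbs * b < 2 ^ M * 2 ^ N := by
      rw [mul_comm]
      exact Nat.mul_lt_mul'' hbM hc
    have h3 := Int.natAbs_add_le (a * d) (c * b)
    rw [Int.natAbs_mul, Int.natAbs_mul, Int.natAbs_natCast, Int.natAbs_natCast] at h3
    rw [pow_succ, pow_add]
    omega
  · have h2 : b * d < 2 ^ M * 2 ^ N := Nat.mul_lt_mul'' hbM hdN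
    rw [pow_succ, pow_add]
    omega

theorem RatSize.neg {N : ℕ} {x : ℝ} (hx : RatSize N x) : RatSize N (-x) := by
  obtain ⟨a, b, rfl, hb, ha, hbM⟩ := hx
  exact ⟨-a, b, by push_cast; ring, hb, by simpa using ha, hbM⟩

theorem RatSize.mono {M N : ℕ} {x : ℝ} (hx : RatSize M x) (h : M ≤ N) : RatSize N x := by
  obtain ⟨a, b, e, hb, ha, hbM⟩ := hx
  have := Nat.pow_le_pow_right two_pos h
  exact ⟨a, b, e, hb, ha.trans_le this, hbM.trans_le this⟩

theorem RatSize.mul {M N : ℕ} {x y : ℝ} (hx : RatSize M x) (hy : RatSize N y) :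
    RatSize (M + N) (x * y) := by
  obtain ⟨a, b, rfl, hb, ha, hbM⟩ := hx
  obtain ⟨c, d, rfl, hd, hc, hdN⟩ := hy
  refine ⟨a * c, b * d, ?_, Nat.mul_pos hb hd, ?_, ?_⟩
  · push_cast
    rw [div_mul_div_comm]
  · rw [Int.natAbs_mul, pow_add]
    exact Nat.mul_lt_mul'' ha hc
  · rw [pow_add]
    exact Nat.mul_lt_mul'' hbM hdN

/-- Numerator and denominator change places and the sign moves along; for 0 the inverse is 0 by
convention. -/
theorem RatSize.inv {N : ℕ} {x : ℝ} (hx : RatSize N x) : RatSize N x⁻¹ := by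
  obtain ⟨a, b, rfl, hb, ha, hbM⟩ := hx
  rcases lt_trichotomy a 0 with h | rfl | h
  · refine ⟨-b, a.natAbs, ?_, Int.natAbs_pos.2 h.ne, by simpa using hbM, ha⟩
    have e : ((a.natAbs : ℕ) : ℝ) = -(a : ℝ) := by
      rw [Nat.cast_natAbs, abs_of_neg h]
      push_cast
      rfl
    rw [e, inv_div]
    push_cast
    rw [neg_div_neg_eq]
  · exact ⟨0, b, by simp, hb, ha, hbM⟩
  · refine ⟨b, a.natAbs, ?_, Int.natAbs_pos.2 h.ne', by simpa using hbM, ha⟩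
    have e : ((a.natAbs : ℕ) : ℝ) = (a : ℝ) := by
      rw [Nat.cast_natAbs, abs_of_pos h]
    rw [e, inv_div]
    push_cast
    rfl

theorem sizeModel_bitLength : SizeModel bitLength RatSize where
  mono := RatSize.mono
  zero := ⟨0, 1, by simp, one_pos, by simp, by simp⟩
  one := ⟨1, 1, by simp, one_pos, by simp, by simp⟩
  add := RatSize.add
  sub hx hy := by
    rw [sub_eq_add_neg]
    exact hx.add hy.neg
  mul hx hy := (hx.mul hy).mono (Nat.le_succ _)
  div hx hy := by
    rw [div_eq_mul_inv]
    exact (hx.mul hy.inv).mono (Nat.le_succ _)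
  size_le := RatSize.bitLength_le

namespace Instance

variable {I : Instance}

theorem bounded_zero (I : Instance) : I.Bounded (fun _ _ => True) (I.n + I.k) :=
  ⟨Nat.le_add_right _ _, Nat.le_add_left _ _, fun _ _ _ => trivial, fun _ => trivial⟩

theorem IsRational.bounded (hI : I.IsRational) : I.Bounded RatSize I.bitSize := by
  have hlen : ∀ u v, I.G.Adj u v → u < v → bitLength (I.len s(u, v)) ≤ I.bitSize := by
    intro u v huv hlt
    have h1 : bitLength (I.len s(u, v)) ∈
        (edgeList I.G.Adj).map (fun e => bitLength (I.len s(e.1, e.2))) :=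
      List.mem_map.2 ⟨(u, v), mem_edgeList.2 ⟨hlt, huv⟩, rfl⟩
    have h2 := List.single_le_sum (fun _ _ => Nat.zero_le _) _ h1
    unfold bitSize
    omega
  refine ⟨by unfold bitSize; omega, by unfold bitSize; omega, fun u v huv => ?_, fun a => ?_⟩
  · refine ratSize_bitLength (hI.1 _ huv) ?_
    rcases lt_or_gt_of_ne huv.ne with h | h
    · exact hlen u v huv h
    · rw [Sym2.eq_swap]
      exact hlen v u huv.symm h
  · refine ratSize_bitLength (hI.2 a) ?_
    have h := Finset.single_le_sum (f := fun a => bitLength (I.vel a)) (fun _ _ => Nat.zero_le _)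
      (Finset.mem_univ a)
    unfold bitSize
    exact h.trans (Nat.le_add_left _ _)

end Instance

open Polynomial in
theorem exists_polynomial_sizeBound : ∃ p : ℕ[X], ∀ s, p.eval s = Prog.sizeBound s :=
  ⟨2 * (X * (2 * X + 2) + (X + 1) * ((2 * X ^ 7 + 1) * (8 * (X * (2 * X + 2)) + 16)) +
    11 * (X * (2 * X + 2)) + 30), fun s => by simp [Prog.sizeBound]⟩

end DroneDelivery

theorem theorem6 :
    ∃ (P : DroneDelivery.Prog DroneDelivery.Instance.inputTy DroneDelivery.Instance.outputTy)
      (p q : Polynomial ℕ),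
      ∀ I : DroneDelivery.Instance,
        (∃ S : DroneDelivery.Schedule I.n I.k,
          P.eval I.encode = DroneDelivery.Instance.encodeSchedule S ∧
          I.Feasible S ∧
          ∀ S' : DroneDelivery.Schedule I.n I.k, I.Feasible S' →
            I.deliveryTime S ≤ min (2 * (I.n : ℝ) - 1) (2 * (I.k : ℝ) - 1) * I.deliveryTime S') ∧
        P.steps I.encode ≤ p.eval (I.n + I.k) ∧
        (I.IsRational → P.bitCost I.encode ≤ q.eval I.bitSize) := by
  open DroneDelivery in
  obtain ⟨r, hr⟩ := exists_polynomial_sizeBound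
  -- Both polynomials are the cost bound of the program composed with `sizeBound`; only the argument
  -- differs, `n + k` for steps and the bit size for bit cost.
  refine ⟨Prog.approxE, Prog.approxE.bound.comp r, Prog.approxE.bound.comp r, fun I => ⟨?_, ?_, ?_⟩⟩
  · exact Prog.eval_approxE sizeModel_zero I.bounded_zero
  · rw [Polynomial.eval_comp, hr]
    exact (Prog.good_approxE sizeModel_zero I.bounded_zero le_rfl).cost_le
  · intro hI
    rw [Polynomial.eval_comp, hr]
    exact (Prog.good_approxE sizeModel_bitLength hI.bounded le_rfl).cost_le
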